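/- Let $\varpi,\alpha>0$ and $h<0$ satisfy $\tfrac12<\varpi^2|h|<\tfrac12(1+4\alpha^{-1})^2$. Consider, for $(p_r,p_z,r,z)\in\mathbb{R}^2\times(0,\infty)\times\mathbb{R}$, the Hamiltonian of the spatial isosceles three-body problem $$H=\frac{p_r^2+p_z^2}{2}+V(r,z),\qquad V(r,z)=\frac{\varpi^2}{2r^2}-\frac1r-\frac{4\alpha^{-1}}{(r^2+(1+2\alpha)z^2)^{1/2}},$$ with Hamilton's equations $\dot r=p_r$, $\dot z=p_z$, $\dot p_r=-\partial_rV$, $\dot p_z=-\partial_zV$, i.e. with vector field $X_H=-\partial_rV\,\partial_{p_r}-\partial_zV\,\partial_{p_z}+p_r\,\partial_r+p_z\,\partial_z$. Let $\mathfrak{M}=H^{-1}(h)$ (a regular sphere-like hypersurface), let $\Pi(p_r,p_z,r,z)=(r,z)$, let $\mathcal{H}=\Pi(\mathfrak{M})=\{V\le h\}$ be the Hill region and $\partial\mathcal{H}=\{V=h\}$ the zero velocity curve, and put $\mathcal{B}_+=\partial\mathcal{H}\cap\{z\ge0\}$, $\mathcal{B}_-=\partial\mathcal{H}\cap\{z\le0\}$.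 Orbits are orbits of the flow of $X_H$ on $\mathfrak{M}$, and are counted as subsets of $\mathfrak{M}$. A periodic orbit $\zeta\subset\mathfrak{M}$ is *$z$-symmetric* if $\Pi(\zeta)$ is invariant under $(r,z)\mapsto(r,-z)$. It is a *brake orbit* if $\Pi(\zeta)$ meets $\partial\mathcal{H}$; it then meets $\partial\mathcal{H}$ in exactly two points, and $\Pi(\zeta)$ is a curve joining them that is traversed back and forth. A brake orbit is *simple* if this curve has no self-intersection; it is of *type I* if one of the two points lies in $\mathcal{B}_+$ and the other in $\mathcal{B}_-$, and of *type II* if both lie in $\mathcal{B}_+$ or both lie in $\mathcal{B}_-$. The *Euler orbit* $\zeta_e$ is the brake orbit $\mathfrak{M}\cap\{p_z=z=0\}$. The *rotation number* $\rho(\zeta)$ of a periodic orbit $\zeta$ with least period $T$ is half of its mean index, that is, $\rho(\zeta)=T\lim_{t\to\infty}\theta(t)/(2\pi t)$, where $\theta$ is a continuous argument of the component transverse to $X_H$ of any solution, tangent to $\mathfrak{M}$ and not parallel to $X_H$, of the linearized flow along $\zeta$, measured in the global frame $$X_1=\partial_zV\,\partial_{p_r}-\partial_rV\,\partial_{p_z}+p_z\,\partial_r-p_r\,\partial_z,\qquad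 X_2=-p_z\,\partial_{p_r}+p_r\,\partial_{p_z}+\partial_zV\,\partial_r-\partial_rV\,\partial_z .$$ **Theorem 2.7.** Let $\zeta_z\subset\mathfrak{M}\setminus\zeta_e$ be a $z$-symmetric simple brake orbit (then $\zeta_e\cup\zeta_z$ is a Hopf link). If this link is non-resonant, that is, if $\rho(\zeta_e)^{-1}+\rho(\zeta_z)^{-1}\neq1$, then on $\mathfrak{M}$ 1. there exist infinitely many $z$-symmetric brake orbits; 2. there exist infinitely many type-I brake orbits that are not $z$-symmetric; 3. there exist infinitely many type-II brake orbits; 4. there exist infinitely many $z$-symmetric periodic orbits that are not brake orbits. -/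

import Mathlib

open Set Filter Topology

namespace Isosceles

noncomputable section

/-- Phase space; a point is `(p_r, p_z, r, z)`. The physical domain is `r > 0`. -/
abbrev Phase : Type := ℝ × ℝ × ℝ × ℝ

/-- The momentum `p_r`. -/
abbrev pr (x : Phase) : ℝ := x.1

/-- The momentum `p_z`. -/
abbrev pz (x : Phase) : ℝ := x.2.1

/-- The position coordinate `r`. -/
abbrev rad (x : Phase) : ℝ := x.2.2.1

/-- The position coordinate `z`. -/
abbrev height (x : Phase) : ℝ := x.2.2.2

/-- The foot point projection `(p_r, p_z, r, z) ↦ (r, z)`. -/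
def footPoint (x : Phase) : ℝ × ℝ := (rad x, height x)

/-- The potential
`V(r, z) = ϖ² / (2 r²) - 1 / r - (4 / α) / (r² + (1 + 2 α) z²)^(1/2)`. -/
def potential (ϖ α r z : ℝ) : ℝ :=
  ϖ ^ 2 / (2 * r ^ 2) - 1 / r - 4 * α⁻¹ / Real.sqrt (r ^ 2 + (1 + 2 * α) * z ^ 2)

/-- The partial derivative `∂V/∂r`, see `hasDerivAt_potential_r`. -/
def potentialDr (ϖ α r z : ℝ) : ℝ :=
  -(ϖ ^ 2 / r ^ 3) + 1 / r ^ 2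
    + 4 * α⁻¹ * r / Real.sqrt (r ^ 2 + (1 + 2 * α) * z ^ 2) ^ 3

/-- The partial derivative `∂V/∂z`, see `hasDerivAt_potential_z`. -/
def potentialDz (α r z : ℝ) : ℝ :=
  4 * α⁻¹ * (1 + 2 * α) * z / Real.sqrt (r ^ 2 + (1 + 2 * α) * z ^ 2) ^ 3

theorem hasDerivAt_potential_r {ϖ α r : ℝ} (hα : 0 < α) (hr : 0 < r) (z : ℝ) :
    HasDerivAt (fun s => potential ϖ α s z) (potentialDr ϖ α r z) r := by
  have hpos : 0 < r ^ 2 + (1 + 2 * α) * z ^ 2 := by positivity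
  have hs : 0 < Real.sqrt (r ^ 2 + (1 + 2 * α) * z ^ 2) := Real.sqrt_pos.mpr hpos
  have h1 : HasDerivAt (fun s : ℝ => s ^ 2 + (1 + 2 * α) * z ^ 2) (2 * r) r := by
    simpa using (hasDerivAt_pow 2 r).add_const ((1 + 2 * α) * z ^ 2)
  have h2 := h1.sqrt hpos.ne'
  have h3 := (hasDerivAt_const r (4 * α⁻¹)).fun_div h2 hs.ne'
  have h4 : HasDerivAt (fun s : ℝ => 2 * s ^ 2) (2 * (2 * r)) r := by
    simpa using (hasDerivAt_pow 2 r).const_mul 2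
  have h5 := (hasDerivAt_const r (ϖ ^ 2)).fun_div h4 (by positivity)
  have h6 := (hasDerivAt_const r (1 : ℝ)).fun_div (hasDerivAt_id r) hr.ne'
  refine ((h5.fun_sub h6).fun_sub h3).congr_deriv ?_
  unfold potentialDr
  simp only [id]
  field_simp
  ring

theorem hasDerivAt_potential_z {ϖ α r : ℝ} (hα : 0 < α) (hr : 0 < r) (z : ℝ) :
    HasDerivAt (fun s => potential ϖ α r s) (potentialDz α r z) z := by
  have hpos : 0 < r ^ 2 + (1 + 2 * α) * z ^ 2 := by positivity
  have hs : 0 < Real.sqrt (r ^ 2 + (1 + 2 * α) * z ^ 2) := Real.sqrt_pos.mpr hpos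
  have h1 : HasDerivAt (fun s : ℝ => r ^ 2 + (1 + 2 * α) * s ^ 2)
      ((1 + 2 * α) * (2 * z)) z := by
    simpa using ((hasDerivAt_pow 2 z).const_mul (1 + 2 * α)).const_add (r ^ 2)
  have h2 := h1.sqrt hpos.ne'
  have h3 := (hasDerivAt_const z (4 * α⁻¹)).fun_div h2 hs.ne'
  refine (h3.const_sub (ϖ ^ 2 / (2 * r ^ 2) - 1 / r)).congr_deriv ?_
  unfold potentialDz
  field_simp
  ring

/-- The Hamiltonian `H = (p_r² + p_z²) / 2 + V(r, z)`. -/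
def hamiltonian (ϖ α : ℝ) (x : Phase) : ℝ :=
  (pr x ^ 2 + pz x ^ 2) / 2 + potential ϖ α (rad x) (height x)

/-- The energy surface `H⁻¹(h)`, inside `{r > 0}`. -/
def energySurface (ϖ α h : ℝ) : Set Phase :=
  {x | 0 < rad x ∧ hamiltonian ϖ α x = h}

/-- The Hamiltonian vector field
`X_H = -∂_r V ∂_{p_r} - ∂_z V ∂_{p_z} + p_r ∂_r + p_z ∂_z`. -/
def hamiltonianField (ϖ α : ℝ) (x : Phase) : Phase :=
  (-potentialDr ϖ α (rad x) (height x), -potentialDz α (rad x) (height x), pr x, pz x)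

/-- Solutions of Hamilton's equations, defined for all times, on the energy surface. -/
def IsTrajectory (ϖ α h : ℝ) (x : ℝ → Phase) : Prop :=
  ∀ t, x t ∈ energySurface ϖ α h ∧ HasDerivAt x (hamiltonianField ϖ α (x t)) t

/-- A periodic orbit, as the subset of phase space that it traces. (Under the standing
assumptions there are no equilibria on the energy surface.) -/
def IsPeriodicOrbit (ϖ α h : ℝ) (O : Set Phase) : Prop :=
  ∃ (x : ℝ → Phase) (T : ℝ),
    IsTrajectory ϖ α h x ∧ 0 < T ∧ Function.Periodic x T ∧ range x = O

/-- The zero velocity curve `{V = h}`, which is the boundary of the Hill region `{V ≤ h}`. -/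
def zeroVelocityCurve (ϖ α h : ℝ) : Set (ℝ × ℝ) :=
  {q | 0 < q.1 ∧ potential ϖ α q.1 q.2 = h}

/-- The part of the zero velocity curve in `{z ≥ 0}`. -/
def upperCurve (ϖ α h : ℝ) : Set (ℝ × ℝ) := zeroVelocityCurve ϖ α h ∩ {q | 0 ≤ q.2}

/-- The part of the zero velocity curve in `{z ≤ 0}`. -/
def lowerCurve (ϖ α h : ℝ) : Set (ℝ × ℝ) := zeroVelocityCurve ϖ α h ∩ {q | q.2 ≤ 0}

/-- The projection of `O` to the `(r, z)`-plane is invariant under `(r, z) ↦ (r, -z)`. -/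
def IsZSymmetric (O : Set Phase) : Prop :=
  (fun q : ℝ × ℝ => (q.1, -q.2)) '' (footPoint '' O) = footPoint '' O

/-- A brake orbit: a periodic orbit whose projection meets the zero velocity curve. -/
def IsBrakeOrbit (ϖ α h : ℝ) (O : Set Phase) : Prop :=
  IsPeriodicOrbit ϖ α h O ∧ (footPoint '' O ∩ zeroVelocityCurve ϖ α h).Nonempty

/-- `x` traces `O`, and `a < b` are consecutive times at which its projection lies on the zero
velocity curve. For a brake orbit `O`, the projection of `x` over `[a, b]` is then the whole
projection of `O`, which is traversed back and forth. -/
def IsBrakeArc (ϖ α h : ℝ) (O : Set Phase) (x : ℝ → Phase) (a b : ℝ) : Prop :=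
  IsTrajectory ϖ α h x ∧ range x = O ∧ a < b ∧
    footPoint (x a) ∈ zeroVelocityCurve ϖ α h ∧
    footPoint (x b) ∈ zeroVelocityCurve ϖ α h ∧
    ∀ t ∈ Ioo a b, footPoint (x t) ∉ zeroVelocityCurve ϖ α h

/-- A simple brake orbit: its projection, traversed once from one brake point to the other,
has no self-intersection. -/
def IsSimpleBrakeOrbit (ϖ α h : ℝ) (O : Set Phase) : Prop :=
  IsBrakeOrbit ϖ α h O ∧
    ∃ (x : ℝ → Phase) (a b : ℝ), IsBrakeArc ϖ α h O x a b ∧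
      InjOn (fun t => footPoint (x t)) (Icc a b)

/-- Type-I brake orbits: one brake point lies in `{z ≥ 0}` and the other in `{z ≤ 0}`. -/
def IsTypeIBrakeOrbit (ϖ α h : ℝ) (O : Set Phase) : Prop :=
  IsBrakeOrbit ϖ α h O ∧
    ∃ (x : ℝ → Phase) (a b : ℝ), IsBrakeArc ϖ α h O x a b ∧
      ((footPoint (x a) ∈ upperCurve ϖ α h ∧ footPoint (x b) ∈ lowerCurve ϖ α h) ∨
        (footPoint (x a) ∈ lowerCurve ϖ α h ∧ footPoint (x b) ∈ upperCurve ϖ α h))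

/-- Type-II brake orbits: both brake points lie in `{z ≥ 0}`, or both lie in `{z ≤ 0}`. -/
def IsTypeIIBrakeOrbit (ϖ α h : ℝ) (O : Set Phase) : Prop :=
  IsBrakeOrbit ϖ α h O ∧
    ∃ (x : ℝ → Phase) (a b : ℝ), IsBrakeArc ϖ α h O x a b ∧
      ((footPoint (x a) ∈ upperCurve ϖ α h ∧ footPoint (x b) ∈ upperCurve ϖ α h) ∨
        (footPoint (x a) ∈ lowerCurve ϖ α h ∧ footPoint (x b) ∈ lowerCurve ϖ α h))

/-- The Euler orbit: the orbit on the energy surface that projects to `{z = 0}`. -/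
def eulerOrbit (ϖ α h : ℝ) : Set Phase :=
  {x | x ∈ energySurface ϖ α h ∧ pz x = 0 ∧ height x = 0}

/-- The first vector field
`X₁ = ∂_z V ∂_{p_r} - ∂_r V ∂_{p_z} + p_z ∂_r - p_r ∂_z` of the global positive frame
`{X₁, X₂}` on the energy surface. The frame is tangent to the energy surface and its span is
transverse to `X_H`. -/
def frameOne (ϖ α : ℝ) (x : Phase) : Phase :=
  (potentialDz α (rad x) (height x), -potentialDr ϖ α (rad x) (height x), pz x, -pr x)

/-- The second vector field
`X₂ = -p_z ∂_{p_r} + p_r ∂_{p_z} + ∂_z V ∂_r - ∂_r V ∂_z` of the frame. -/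
def frameTwo (ϖ α : ℝ) (x : Phase) : Phase :=
  (-pz x, pr x, potentialDz α (rad x) (height x), -potentialDr ϖ α (rad x) (height x))

/-- `v` is a solution of the linearized Hamiltonian flow along `x`. -/
def IsLinearizedSolution (ϖ α : ℝ) (x v : ℝ → Phase) : Prop :=
  ∀ t, HasDerivAt v (fderiv ℝ (hamiltonianField ϖ α) (x t) (v t)) t

/-- `ρ` is the rotation number (half of the mean index) of the periodic orbit `O`: if `x`
traces `O` with least period `T`, and the transverse part of a solution `v` of the linearized
flow along `x` is written in the global frame as `R (cos θ X₁ + sin θ X₂)` with `R > 0` and a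
continuous argument `θ`, then `ρ = T lim_{t → ∞} θ(t) / (2 π t)`. The limit depends neither on
`v` nor on `x` nor on `θ`. -/
def IsRotationNumber (ϖ α h : ℝ) (O : Set Phase) (ρ : ℝ) : Prop :=
  ∃ (x v : ℝ → Phase) (T : ℝ) (R θ c : ℝ → ℝ),
    IsTrajectory ϖ α h x ∧ range x = O ∧
    IsLeast {S : ℝ | 0 < S ∧ Function.Periodic x S} T ∧
    IsLinearizedSolution ϖ α x v ∧
    Continuous θ ∧
    (∀ t, 0 < R t ∧
      v t = (R t * Real.cos (θ t)) • frameOne ϖ α (x t)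
        + (R t * Real.sin (θ t)) • frameTwo ϖ α (x t)
        + c t • hamiltonianField ϖ α (x t)) ∧
    Tendsto (fun t => T * (θ t / (2 * Real.pi * t))) atTop (𝓝 ρ)

/-- The pair of periodic orbits `O₁, O₂` is non-resonant: `ρ₁⁻¹ + ρ₂⁻¹ ≠ 1`. -/
def IsNonResonant (ϖ α h : ℝ) (O₁ O₂ : Set Phase) : Prop :=
  ∃ ρ₁ ρ₂ : ℝ, IsRotationNumber ϖ α h O₁ ρ₁ ∧ IsRotationNumber ϖ α h O₂ ρ₂ ∧
    ρ₁⁻¹ + ρ₂⁻¹ ≠ 1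

end

end Isosceles

open Isosceles

namespace Isosceles

/-! Write z = R cos φ and p_z = -R sin φ. The vertical equation is z'' = -kz with k > 0, so the
phase φ increases strictly along orbits and can replace time. This is an open book. Its binding R =
0 is the Euler orbit; on the page of phase φ the energy determines R from (u, p) = (1/r, p_r), a
point of a fixed disc whose boundary circle carries the Euler orbit. The mirror symmetry z ↦ -z
shifts φ by π, and time reversal is φ ↦ -φ, p ↦ -p. Hence p = 0 at a phase kπ/2 makes a solution
symmetric about that phase: a brake point if k is even, a perpendicular crossing of z = 0 if k is
odd. Two such phases make the orbit periodic. A z-symmetric simple brake orbit is a solution of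
period π in φ with p = 0 at every kπ/2 (`exists_reference`); the other solutions turn around it.

The new orbits come from shooting. Start on p = 0 at phase 0 or π/2, between the reference orbit and
the Euler orbit, and measure the angle by which the solution turns around the reference in the
pages. If this angle is mπ after j quarter turns of the phase, then p = 0 again. The angle depends
continuously on the starting point. Near the reference it grows per unit of phase like ρ(ζ_z) - 1,
because the angle in the global frame exceeds the angle in the page by the phase
(`IsReference.exists_pageArg_near`, `IsReference.tendsto_rotation`). On the Euler orbit it grows
like 1 / (ρ(ζ_e) - 1), because the frame angle is there, up to a bounded error, the angle travelled
along the boundary circle plus the phase of the transverse Hill equation (`tendsto_pageArg_euler`).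
The two rates agree exactly at resonance. Otherwise, for large j, every m in an interval of length
proportional to j is attained (`exists_rotation_interval`).

Arithmetic sorts the orbits. If j and m are coprime, symmetric phases occur only at multiples of j
quarter turns from the start (`isShot_of_pageArg_eq`), so different j give different orbits. With j
= 2^e q, q an odd prime and m odd, the exponent e and the starting phase decide which of the four
families the orbit belongs to. -/

/-! ### Analytic preliminaries and continuous arguments of planar curves -/

theorem exists_global_solution {E : Type*} [NormedAddCommGroup E] [NormedSpace ℝ E]
    [CompleteSpace E] {f : ℝ → E → E} {K L : NNReal} (hK : ∀ t, LipschitzWith K (f t))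
    (hc : ∀ x, Continuous fun t => f t x) (hL : ∀ t x, ‖f t x‖ ≤ L) (t₀ : ℝ) (x₀ : E) :
    ∃ γ : ℝ → E, γ t₀ = x₀ ∧ ∀ t, HasDerivAt γ (f t (γ t)) t := by
  have key : ∀ n : ℕ, ∃ γ : ℝ → E, γ t₀ = x₀ ∧
      ∀ t ∈ Ioo (t₀ - (n + 1)) (t₀ + (n + 1)), HasDerivAt γ (f t (γ t)) t := by
    intro n
    have hn : (0 : ℝ) ≤ n := Nat.cast_nonneg n
    -- Since the field is bounded by L, a ball of radius L(n + 1) cannot be left within time n + 1,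
    -- so one Picard–Lindelöf step covers an interval of any length.
    have hpl : IsPicardLindelof f (tmin := t₀ - (n + 1)) (tmax := t₀ + (n + 1))
        ⟨t₀, by constructor <;> linarith⟩ x₀ (L * (n + 1)) 0 L K := by
      refine ⟨fun t _ => (hK t).lipschitzOnWith, fun x _ => (hc x).continuousOn,
        fun t _ x _ => hL t x, ?_⟩
      simp
    obtain ⟨γ, h0, hγ⟩ := hpl.exists_eq_forall_mem_Icc_hasDerivWithinAt₀
    exact ⟨γ, h0, fun t ht => (hγ t (Ioo_subset_Icc_self ht)).hasDerivAt (Icc_mem_nhds ht.1 ht.2)⟩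
  choose γ h0 hγ using key
  have agree : ∀ m n : ℕ, m ≤ n → EqOn (γ m) (γ n) (Ioo (t₀ - (m + 1)) (t₀ + (m + 1))) := by
    intro m n hmn
    have hmn' : (m : ℝ) ≤ n := by exact_mod_cast hmn
    have hm : (0 : ℝ) ≤ m := Nat.cast_nonneg m
    refine ODE_solution_unique_of_mem_Ioo (v := f) (s := fun _ => univ) (K := K) (t₀ := t₀)
      (fun t _ => (hK t).lipschitzOnWith) (by constructor <;> linarith)
      (fun t ht => ⟨hγ m t ht, trivial⟩)
      (fun t ht => ⟨hγ n t ⟨by linarith [ht.1], by linarith [ht.2]⟩, trivial⟩) ?_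
    rw [h0, h0]
  have hmem : ∀ (t : ℝ) (n : ℕ), |t - t₀| ≤ n → t ∈ Ioo (t₀ - (n + 1)) (t₀ + (n + 1)) := by
    intro t n h
    rw [abs_le] at h
    constructor <;> linarith
  refine ⟨fun t => γ ⌈|t - t₀|⌉₊ t, h0 _, fun t => ?_⟩
  set N := ⌈|t - t₀|⌉₊ with hN
  have htN := hmem t N (Nat.le_ceil _)
  have : (fun t => γ ⌈|t - t₀|⌉₊ t) =ᶠ[𝓝 t] γ N := by
    filter_upwards [isOpen_Ioo.mem_nhds htN] with s hs
    rcases le_total ⌈|s - t₀|⌉₊ N with h | h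
    · exact agree _ _ h (hmem s _ (Nat.le_ceil _))
    · exact (agree _ _ h hs).symm
  exact (hγ N t htN).congr_of_eventuallyEq this

/-- Uniform continuity of the derivative on the compact set makes the modulus independent of the
base point, so that one threshold serves along a whole piece of orbit. -/
theorem exists_uniform_taylor {E F : Type*} [NormedAddCommGroup E] [NormedSpace ℝ E]
    [NormedAddCommGroup F] [NormedSpace ℝ F] {f : E → F} {U C : Set E} (hU : IsOpen U)
    (hf : ContDiffOn ℝ 1 f U) (hC : IsCompact C) (hconv : Convex ℝ C) (hCU : C ⊆ U)
    {η : ℝ} (hη : 0 < η) :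
    ∃ ρ > 0, ∀ x ∈ C, ∀ y ∈ C, ‖y - x‖ ≤ ρ →
      ‖f y - f x - fderiv ℝ f x (y - x)‖ ≤ η * ‖y - x‖ := by
  have hcont : ContinuousOn (fderiv ℝ f) C := (hf.continuousOn_fderiv_of_isOpen hU le_rfl).mono hCU
  have huc := hC.uniformContinuousOn_of_continuous hcont
  rw [Metric.uniformContinuousOn_iff_le] at huc
  obtain ⟨ρ, hρ, h⟩ := huc η hη
  refine ⟨ρ, hρ, fun x hx y hy hxy => ?_⟩
  have hseg : segment ℝ x y ⊆ C := hconv.segment_subset hx hy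
  refine Convex.norm_image_sub_le_of_norm_fderiv_le' (𝕜 := ℝ) (s := segment ℝ x y)
    (fun z hz => ?_) (fun z hz => ?_) (convex_segment x y) (left_mem_segment ℝ x y)
    (right_mem_segment ℝ x y)
  · exact (hf.contDiffAt (hU.mem_nhds (hCU (hseg hz)))).differentiableAt one_ne_zero
  · have hzx : dist z x ≤ ρ := by
      rw [dist_eq_norm]
      refine le_trans ?_ hxy
      obtain ⟨a, b, ha, hb, hab, rfl⟩ := hz
      have : a • x + b • y - x = b • (y - x) := by
        rw [← eq_sub_iff_add_eq] at hab
        subst hab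
        module
      rw [this, norm_smul, Real.norm_of_nonneg hb]
      exact mul_le_of_le_one_left (norm_nonneg _) (by linarith)
    simpa [dist_eq_norm] using h z (hseg hz) x hx hzx

theorem eq_mul_exp_of_hasDerivAt_mul {f a : ℝ → ℝ} (ha : Continuous a)
    (hf : ∀ t, HasDerivAt f (a t * f t) t) (t₀ t : ℝ) :
    f t = f t₀ * Real.exp (∫ s in t₀..t, a s) := by
  have hA : ∀ t, HasDerivAt (fun t => ∫ s in t₀..t, a s) (a t) t := fun t =>
    intervalIntegral.integral_hasDerivAt_right (ha.intervalIntegrable _ _)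
      (ha.stronglyMeasurableAtFilter _ _) ha.continuousAt
  have hd : ∀ t, HasDerivAt (fun t => f t * Real.exp (-∫ s in t₀..t, a s)) 0 t := by
    intro t
    refine ((hf t).mul ((hA t).neg.exp)).congr_deriv ?_
    simp only [Pi.neg_apply]
    ring
  have hc := is_const_of_deriv_eq_zero (fun t => (hd t).differentiableAt) (fun t => (hd t).deriv) t t₀
  simp only [intervalIntegral.integral_same, neg_zero, Real.exp_zero, mul_one] at hc
  rw [← hc, mul_assoc, ← Real.exp_add]
  simp

theorem tendsto_div_of_add_period {f : ℝ → ℝ} (hf : Continuous f) {T c : ℝ} (hT : 0 < T)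
    (h : ∀ t, f (t + T) = f t + c) : Tendsto (fun t => f t / t) atTop (𝓝 (c / T)) := by
  have hp : Function.Periodic (fun t => f t - c / T * t) T := by
    intro t
    simp only [h]
    field_simp
    ring
  have hb : ∃ M, ∀ t, ‖f t - c / T * t‖ ≤ M := by
    obtain ⟨M, hM⟩ := (hp.compact_of_continuous hT.ne' (by fun_prop)).isBounded.exists_norm_le
    exact ⟨M, fun t => hM _ (mem_range_self t)⟩
  obtain ⟨M, hM⟩ := hb
  have h0 : Tendsto (fun t : ℝ => (f t - c / T * t) * t⁻¹) atTop (𝓝 0) := by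
    refine bdd_le_mul_tendsto_zero' M (Eventually.of_forall fun t => hM t) tendsto_inv_atTop_zero
  have h1 := h0.add_const (c / T)
  rw [zero_add] at h1
  refine h1.congr' ?_
  filter_upwards [eventually_gt_atTop 0] with t ht
  field_simp
  ring

/-- `ψ` is a continuous argument of the planar curve `(f₁, f₂)` over `s`. -/
def IsArgOn (f₁ f₂ ψ : ℝ → ℝ) (s : Set ℝ) : Prop :=
  ContinuousOn ψ s ∧ ∀ x ∈ s, ∃ ρ > 0, f₁ x = ρ * Real.cos (ψ x) ∧ f₂ x = ρ * Real.sin (ψ x)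

theorem IsArgOn.mono {f₁ f₂ ψ : ℝ → ℝ} {s t : Set ℝ} (h : IsArgOn f₁ f₂ ψ t) (hst : s ⊆ t) :
    IsArgOn f₁ f₂ ψ s :=
  ⟨h.1.mono hst, fun x hx => h.2 x (hst hx)⟩

/-- In the frame turned by χ the curve stays in the open right half plane, where the arctangent of
the slope is a global argument. -/
theorem exists_isArgOn_of_dot_pos {f₁ f₂ χ : ℝ → ℝ} {s : Set ℝ} (h₁ : ContinuousOn f₁ s)
    (h₂ : ContinuousOn f₂ s) (hχ : ContinuousOn χ s)
    (h : ∀ x ∈ s, 0 < f₁ x * Real.cos (χ x) + f₂ x * Real.sin (χ x)) :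
    ∃ μ, IsArgOn f₁ f₂ μ s ∧ ∀ x ∈ s, |μ x - χ x| < Real.pi / 2 := by
  set P : ℝ → ℝ := fun x => f₁ x * Real.cos (χ x) + f₂ x * Real.sin (χ x) with hP
  set Q : ℝ → ℝ := fun x => f₂ x * Real.cos (χ x) - f₁ x * Real.sin (χ x) with hQ
  have hcos : ContinuousOn (fun x => Real.cos (χ x)) s := Real.continuous_cos.comp_continuousOn hχ
  have hsin : ContinuousOn (fun x => Real.sin (χ x)) s := Real.continuous_sin.comp_continuousOn hχ
  refine ⟨fun x => χ x + Real.arctan (Q x / P x), ⟨?_, fun x hx => ?_⟩, fun x hx => ?_⟩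
  · refine hχ.add (Real.continuous_arctan.comp_continuousOn (ContinuousOn.div ?_ ?_ ?_))
    · exact (h₂.mul hcos).sub (h₁.mul hsin)
    · exact (h₁.mul hcos).add (h₂.mul hsin)
    · exact fun x hx => (h x hx).ne'
  · have hp : 0 < P x := h x hx
    set r := Real.sqrt (1 + (Q x / P x) ^ 2) with hr
    have hr0 : 0 < r := Real.sqrt_pos.mpr (by positivity)
    have hPc : P x = f₁ x * Real.cos (χ x) + f₂ x * Real.sin (χ x) := rfl
    have hQc : Q x = f₂ x * Real.cos (χ x) - f₁ x * Real.sin (χ x) := rfl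
    have hcs := Real.sin_sq_add_cos_sq (χ x)
    refine ⟨P x * r, by positivity, ?_, ?_⟩
    · rw [Real.cos_add, Real.cos_arctan, Real.sin_arctan, ← hr]
      have : P x * r * (Real.cos (χ x) * (1 / r) - Real.sin (χ x) * (Q x / P x / r)) =
        P x * Real.cos (χ x) - Q x * Real.sin (χ x) := by field_simp
      rw [this, hPc, hQc]
      linear_combination (-f₁ x) * hcs
    · rw [Real.sin_add, Real.cos_arctan, Real.sin_arctan, ← hr]
      have : P x * r * (Real.sin (χ x) * (1 / r) + Real.cos (χ x) * (Q x / P x / r)) =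
        P x * Real.sin (χ x) + Q x * Real.cos (χ x) := by field_simp
      rw [this, hPc, hQc]
      linear_combination (-f₂ x) * hcs
  · rw [add_sub_cancel_left, abs_lt]
    exact ⟨by linarith [Real.neg_pi_div_two_lt_arctan (Q x / P x)], Real.arctan_lt_pi_div_two _⟩

/-- A change by π or more would carry d + c through a multiple of π. In this way a nonvanishing
determinant or a positive inner product of two curves bounds the drift between their arguments,
whatever the length of the interval. -/
theorem abs_sub_lt_pi_of_sin_ne_zero {d : ℝ → ℝ} {a b c : ℝ} (hd : ContinuousOn d (Icc a b))
    (h : ∀ x ∈ Icc a b, Real.sin (d x + c) ≠ 0) {x : ℝ} (hx : x ∈ Icc a b) :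
    |d x - d a| < Real.pi := by
  by_contra! hcon
  have hsub : Icc a x ⊆ Icc a b := Icc_subset_Icc_right hx.2
  have hdx : ContinuousOn d (uIcc a x) := by
    rw [uIcc_of_le hx.1]; exact hd.mono hsub
  have hiv := intermediate_value_uIcc hdx
  -- an integer multiple of π in the image
  have hex : ∃ n : ℤ, n * Real.pi - c ∈ uIcc (d a) (d x) := by
    have hpi := Real.pi_pos
    set m := min (d a) (d x) with hm
    set M := max (d a) (d x) with hM
    have hMm : Real.pi ≤ M - m := by rw [hM, hm, max_sub_min_eq_abs']; rwa [abs_sub_comm]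
    refine ⟨⌈(m + c) / Real.pi⌉, ?_⟩
    have h1 := Int.le_ceil ((m + c) / Real.pi)
    have h2 := (Int.ceil_lt_add_one ((m + c) / Real.pi)).le
    rw [div_le_iff₀ hpi] at h1
    have h3 : (⌈(m + c) / Real.pi⌉ : ℝ) * Real.pi ≤ ((m + c) / Real.pi + 1) * Real.pi := by gcongr
    have h4 : ((m + c) / Real.pi + 1) * Real.pi = m + c + Real.pi := by field_simp
    exact ⟨by linarith, by linarith⟩
  obtain ⟨n, hn⟩ := hex
  obtain ⟨y, hy, hyn⟩ := hiv hn
  rw [uIcc_of_le hx.1] at hy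
  apply h y (hsub hy)
  rw [hyn, sub_add_cancel, Real.sin_int_mul_pi]

theorem abs_sub_lt_pi_of_det_ne_zero {f₁ f₂ g₁ g₂ ψ χ : ℝ → ℝ} {a b : ℝ}
    (hf : IsArgOn f₁ f₂ ψ (Icc a b)) (hg : IsArgOn g₁ g₂ χ (Icc a b))
    (h : ∀ x ∈ Icc a b, f₁ x * g₂ x - f₂ x * g₁ x ≠ 0) {x : ℝ} (hx : x ∈ Icc a b) :
    |(ψ x - χ x) - (ψ a - χ a)| < Real.pi := by
  refine abs_sub_lt_pi_of_sin_ne_zero (d := fun x => ψ x - χ x) (c := 0) (hf.1.sub hg.1)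
    (fun y hy h0 => h y hy ?_) hx
  obtain ⟨ρ, -, h1, h2⟩ := hf.2 y hy
  obtain ⟨σ, -, h3, h4⟩ := hg.2 y hy
  rw [add_zero, Real.sin_sub] at h0
  rw [h1, h2, h3, h4]
  linear_combination (-ρ * σ) * h0

theorem abs_sub_lt_pi_of_dot_pos {f₁ f₂ g₁ g₂ ψ χ : ℝ → ℝ} {a b : ℝ}
    (hf : IsArgOn f₁ f₂ ψ (Icc a b)) (hg : IsArgOn g₁ g₂ χ (Icc a b))
    (h : ∀ x ∈ Icc a b, 0 < f₁ x * g₁ x + f₂ x * g₂ x) {x : ℝ} (hx : x ∈ Icc a b) :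
    |(ψ x - χ x) - (ψ a - χ a)| < Real.pi := by
  refine abs_sub_lt_pi_of_sin_ne_zero (d := fun x => ψ x - χ x) (c := Real.pi / 2)
    (hf.1.sub hg.1) (fun y hy h0 => (h y hy).ne' ?_) hx
  obtain ⟨ρ, -, h1, h2⟩ := hf.2 y hy
  obtain ⟨σ, -, h3, h4⟩ := hg.2 y hy
  rw [Real.sin_add_pi_div_two, Real.cos_sub] at h0
  rw [h1, h2, h3, h4]
  linear_combination (ρ * σ) * h0

theorem continuous_eq_const_of_mem_zmultiples {d : ℝ → ℝ} {c : ℝ} (hc : 0 < c)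
    (hd : Continuous d) (h : ∀ x, ∃ n : ℤ, d x = n * c) (x y : ℝ) : d x = d y := by
  by_contra hne
  wlog hlt : d x < d y generalizing x y
  · exact this y x (Ne.symm hne) (lt_of_le_of_ne (not_lt.mp hlt) (Ne.symm hne))
  obtain ⟨n, hn⟩ := h x
  obtain ⟨m, hm⟩ := h y
  have hnm : n < m := by
    rw [hn, hm] at hlt
    exact_mod_cast lt_of_mul_lt_mul_right hlt hc.le
  have hnm' : (n : ℝ) + 1 ≤ m := by exact_mod_cast hnm
  have hmem : ((n : ℝ) + 1 / 2) * c ∈ uIcc (d x) (d y) := by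
    rw [uIcc_of_le hlt.le, hn, hm]
    constructor <;> nlinarith
  obtain ⟨z, -, hz⟩ := intermediate_value_uIcc hd.continuousOn hmem
  obtain ⟨k, hk⟩ := h z
  rw [hk] at hz
  have h2 : (k : ℝ) = n + 1 / 2 := mul_right_cancel₀ hc.ne' hz
  have h3 : (2 * k : ℝ) = 2 * n + 1 := by linarith
  have h4 : 2 * k = 2 * n + 1 := by exact_mod_cast h3
  omega

theorem IsArgOn.eq_of_eq {f₁ f₂ ψ χ : ℝ → ℝ} (hψ : IsArgOn f₁ f₂ ψ univ)
    (hχ : IsArgOn f₁ f₂ χ univ) {a : ℝ} (ha : ψ a = χ a) (x : ℝ) : ψ x = χ x := by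
  have h := continuous_eq_const_of_mem_zmultiples (d := fun x => ψ x - χ x) Real.two_pi_pos
    ((continuousOn_univ.mp hψ.1).sub (continuousOn_univ.mp hχ.1)) (fun x => ?_) x a
  · simp only [ha, sub_self] at h
    linarith
  · obtain ⟨ρ, hρ, h1, h2⟩ := hψ.2 x trivial
    obtain ⟨σ, hσ, h3, h4⟩ := hχ.2 x trivial
    have e1 := Real.sin_sq_add_cos_sq (ψ x)
    have e2 := Real.sin_sq_add_cos_sq (χ x)
    have hρσ : ρ = σ := by
      have : ρ ^ 2 = σ ^ 2 := by
        calc ρ ^ 2 = f₁ x ^ 2 + f₂ x ^ 2 := by rw [h1, h2]; linear_combination (-ρ ^ 2) * e1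
          _ = σ ^ 2 := by rw [h3, h4]; linear_combination (σ ^ 2) * e2
      exact (sq_eq_sq₀ hρ.le hσ.le).mp this
    subst hρσ
    have hc : Real.cos (ψ x) = Real.cos (χ x) := mul_left_cancel₀ hρ.ne' (h1.symm.trans h3)
    have hs : Real.sin (ψ x) = Real.sin (χ x) := mul_left_cancel₀ hρ.ne' (h2.symm.trans h4)
    have : Real.cos (ψ x - χ x) = 1 := by
      rw [Real.cos_sub, hc, hs]; linear_combination e2
    obtain ⟨n, hn⟩ := (Real.cos_eq_one_iff _).mp this
    exact ⟨n, hn.symm⟩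

/-! ### The phase as time: coordinates around the Euler orbit -/

/-- The standing assumptions on the parameters. -/
structure Admissible (ϖ α h : ℝ) : Prop where
  ϖ_pos : 0 < ϖ
  α_pos : 0 < α
  low : 1 / 2 < ϖ ^ 2 * -h
  upp : ϖ ^ 2 * -h < (1 + 4 * α⁻¹) ^ 2 / 2

/-- Coordinates `(u, p, R)` on the page with phase `φ`, see `phys`. -/
abbrev State : Type := ℝ × ℝ × ℝ

/-- `1 + (1 + 2 α) (z / r)²`. -/
noncomputable def ratioSq (α φ : ℝ) (y : State) : ℝ :=
  1 + (1 + 2 * α) * (y.1 * (y.2.2 * Real.cos φ)) ^ 2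

/-- The factor `k` of Hill's equation `z'' = -k z`. -/
noncomputable def stiffness (α φ : ℝ) (y : State) : ℝ :=
  4 * α⁻¹ * (1 + 2 * α) * y.1 ^ 3 / Real.sqrt (ratioSq α φ y) ^ 3

/-- The time derivative of the phase. -/
noncomputable def phaseSpeed (α φ : ℝ) (y : State) : ℝ :=
  Real.sin φ ^ 2 + stiffness α φ y * Real.cos φ ^ 2

/-- Hamilton's equations in the coordinates `(u, p, R)`, with the phase as time. -/
noncomputable def polarField (ϖ α φ : ℝ) (y : State) : State :=
  (-(y.2.1 * y.1 ^ 2) / phaseSpeed α φ y,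
    (ϖ ^ 2 * y.1 ^ 3 - y.1 ^ 2 - 4 * α⁻¹ * y.1 ^ 2 / Real.sqrt (ratioSq α φ y) ^ 3)
      / phaseSpeed α φ y,
    (y.2.2 * Real.sin φ * Real.cos φ * (stiffness α φ y - 1)) / phaseSpeed α φ y)

/-- The Hamiltonian in the coordinates `(u, p, R)`. -/
noncomputable def polarEnergy (ϖ α φ : ℝ) (y : State) : ℝ :=
  y.2.1 ^ 2 / 2 + (y.2.2 * Real.sin φ) ^ 2 / 2 + ϖ ^ 2 * y.1 ^ 2 / 2 - y.1
    - 4 * α⁻¹ * y.1 / Real.sqrt (ratioSq α φ y)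

/-- The point of phase space with phase `φ` and coordinates `(u, p, R)`. -/
noncomputable def phys (φ : ℝ) (y : State) : Phase :=
  (y.2.1, -(y.2.2 * Real.sin φ), y.1⁻¹, y.2.2 * Real.cos φ)

section basic
variable {ϖ α h φ : ℝ} {y : State}

theorem one_le_ratioSq (hα : 0 < α) : 1 ≤ ratioSq α φ y := by
  unfold ratioSq
  have : 0 ≤ (1 + 2 * α) * (y.1 * (y.2.2 * Real.cos φ)) ^ 2 := by positivity
  linarith

theorem one_le_sqrt_ratioSq (hα : 0 < α) : 1 ≤ Real.sqrt (ratioSq α φ y) :=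
  Real.one_le_sqrt.mpr (one_le_ratioSq hα)

theorem stiffness_pos (hα : 0 < α) (hu : 0 < y.1) : 0 < stiffness α φ y := by
  have := one_le_sqrt_ratioSq (φ := φ) (y := y) hα
  unfold stiffness
  positivity

theorem phaseSpeed_pos (hα : 0 < α) (hu : 0 < y.1) : 0 < phaseSpeed α φ y := by
  have hk := stiffness_pos (φ := φ) hα hu
  unfold phaseSpeed
  rcases eq_or_ne (Real.cos φ) 0 with hc | hc
  · have := Real.sin_sq_add_cos_sq φ
    rw [hc] at this ⊢
    nlinarith
  · positivity

theorem sqrt_phys (hu : 0 < y.1) :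
    Real.sqrt ((y.1⁻¹) ^ 2 + (1 + 2 * α) * (y.2.2 * Real.cos φ) ^ 2)
      = y.1⁻¹ * Real.sqrt (ratioSq α φ y) := by
  have : (y.1⁻¹) ^ 2 + (1 + 2 * α) * (y.2.2 * Real.cos φ) ^ 2 = (y.1⁻¹) ^ 2 * ratioSq α φ y := by
    unfold ratioSq
    field_simp
  rw [this, Real.sqrt_mul (by positivity), Real.sqrt_sq (by positivity)]

theorem hamiltonian_phys (hα : 0 < α) (hu : 0 < y.1) :
    hamiltonian ϖ α (phys φ y) = polarEnergy ϖ α φ y := by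
  have hs := one_le_sqrt_ratioSq (φ := φ) (y := y) hα
  simp only [hamiltonian, potential, phys, polarEnergy, sqrt_phys hu]
  field_simp
  ring

theorem phys_mem_energySurface (hα : 0 < α) (hu : 0 < y.1) (hE : polarEnergy ϖ α φ y = h) :
    phys φ y ∈ energySurface ϖ α h :=
  ⟨inv_pos.mpr hu, (hamiltonian_phys hα hu).trans hE⟩

theorem potentialDr_phys (hα : 0 < α) (hu : 0 < y.1) :
    potentialDr ϖ α y.1⁻¹ (y.2.2 * Real.cos φ) =
      -(ϖ ^ 2 * y.1 ^ 3 - y.1 ^ 2 - 4 * α⁻¹ * y.1 ^ 2 / Real.sqrt (ratioSq α φ y) ^ 3) := by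
  have hs := one_le_sqrt_ratioSq (φ := φ) (y := y) hα
  simp only [potentialDr, sqrt_phys hu]
  field_simp
  ring

theorem potentialDz_phys (hα : 0 < α) (hu : 0 < y.1) :
    potentialDz α y.1⁻¹ (y.2.2 * Real.cos φ) = stiffness α φ y * (y.2.2 * Real.cos φ) := by
  have hs := one_le_sqrt_ratioSq (φ := φ) (y := y) hα
  simp only [potentialDz, stiffness, sqrt_phys hu]
  field_simp

/-- With z = R cos φ and p_z = -R sin φ, the equation z'' = -kz gives φ' = sin² φ + k cos² φ. This
is positive and does not involve R except through k, so the coordinates extend over R = 0; dividing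
the flow by it makes φ the time. -/
theorem hasDerivAt_phys (hα : 0 < α) {y : ℝ → State} (hu : 0 < (y φ).1)
    (hy : HasDerivAt y (polarField ϖ α φ (y φ)) φ) :
    HasDerivAt (fun φ => phys φ (y φ))
      ((phaseSpeed α φ (y φ))⁻¹ • hamiltonianField ϖ α (phys φ (y φ))) φ := by
  have hg := phaseSpeed_pos (φ := φ) hα hu
  have h1 : HasDerivAt (fun φ => (y φ).1) _ φ := hy.fst
  have h2 : HasDerivAt (fun φ => (y φ).2.1) _ φ := hy.snd.fst
  have h3 : HasDerivAt (fun φ => (y φ).2.2) _ φ := hy.snd.snd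
  have hcs := Real.sin_sq_add_cos_sq φ
  have e1 := h2
  have e2 := (h3.mul (Real.hasDerivAt_sin φ)).neg
  have e3 := h1.inv hu.ne'
  have e4 := h3.mul (Real.hasDerivAt_cos φ)
  refine (e1.prodMk (e2.prodMk (e3.prodMk e4))).congr_deriv ?_
  simp only [hamiltonianField, phys, potentialDr_phys hα hu, potentialDz_phys hα hu, polarField,
    Prod.smul_mk, smul_eq_mul, Prod.mk.injEq]
  refine ⟨by field_simp, ?_, ?_, ?_⟩
  · field_simp
    rw [phaseSpeed]
    ring_nf
    have : Real.cos φ ^ 2 = 1 - Real.sin φ ^ 2 := by linarith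
    have h3 : Real.cos φ ^ 3 = Real.cos φ * (1 - Real.sin φ ^ 2) := by rw [← this]; ring
    simp only [h3]
    ring
  · field_simp
  · field_simp
    rw [phaseSpeed]
    ring_nf
    have h3 : Real.sin φ ^ 3 = Real.sin φ * (1 - Real.cos φ ^ 2) := by
      rw [show (1:ℝ) - Real.cos φ ^ 2 = Real.sin φ ^ 2 by linarith]; ring
    simp only [h3]
    ring

end basic

theorem contDiffAt_hamiltonian {ϖ α : ℝ} (hα : 0 < α) {x : Phase} (hx : 0 < rad x) :
    ContDiffAt ℝ 1 (hamiltonian ϖ α) x := by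
  have h1 : rad x ^ 2 + (1 + 2 * α) * height x ^ 2 ≠ 0 := by positivity
  have h2 : Real.sqrt (rad x ^ 2 + (1 + 2 * α) * height x ^ 2) ≠ 0 :=
    (Real.sqrt_pos.mpr (by positivity)).ne'
  have h3 : 2 * rad x ^ 2 ≠ 0 := by positivity
  unfold hamiltonian potential
  have e := hx.ne'
  simp only [pr, pz, rad, height] at *
  fun_prop (disch := assumption)

theorem contDiffAt_hamiltonianField {ϖ α : ℝ} (hα : 0 < α) {x : Phase} (hx : 0 < rad x) :
    ContDiffAt ℝ 1 (hamiltonianField ϖ α) x := by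
  have h1 : rad x ^ 2 + (1 + 2 * α) * height x ^ 2 ≠ 0 := by positivity
  have h2 : Real.sqrt (rad x ^ 2 + (1 + 2 * α) * height x ^ 2) ^ 3 ≠ 0 :=
    pow_ne_zero _ (Real.sqrt_pos.mpr (by positivity)).ne'
  have h3 : rad x ^ 2 ≠ 0 := by positivity
  have h4 : rad x ^ 3 ≠ 0 := by positivity
  unfold hamiltonianField potentialDr potentialDz
  simp only [pr, pz, rad, height] at *
  fun_prop (disch := assumption)

theorem contDiffAt_polarField {ϖ α : ℝ} (hα : 0 < α) {q : ℝ × State} (hq : 0 < q.2.1) :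
    ContDiffAt ℝ 1 (fun q : ℝ × State => (polarField ϖ α q.1 q.2, (phaseSpeed α q.1 q.2)⁻¹)) q := by
  have h0 : ratioSq α q.1 q.2 ≠ 0 := (zero_lt_one.trans_le (one_le_ratioSq hα)).ne'
  have h1 : Real.sqrt (ratioSq α q.1 q.2) ^ 3 ≠ 0 :=
    pow_ne_zero _ (zero_lt_one.trans_le (one_le_sqrt_ratioSq hα)).ne'
  have h2 : phaseSpeed α q.1 q.2 ≠ 0 := (phaseSpeed_pos hα hq).ne'
  have c0 : ContDiffAt ℝ 1 (fun q : ℝ × State => ratioSq α q.1 q.2) q := by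
    unfold ratioSq; fun_prop
  have c1 : ContDiffAt ℝ 1 (fun q : ℝ × State => stiffness α q.1 q.2) q := by
    unfold stiffness; fun_prop (disch := assumption)
  have c2 : ContDiffAt ℝ 1 (fun q : ℝ × State => phaseSpeed α q.1 q.2) q := by
    unfold phaseSpeed; fun_prop
  unfold polarField
  fun_prop (disch := assumption)

/-! ### Compactness of the energy surface -/

/-- `b / ϖ`, the centre of the disc of the coordinates `(ϖ u - b / ϖ, p)`. -/
noncomputable def centre (ϖ α : ℝ) : ℝ := (1 + 4 * α⁻¹) / ϖ

/-- The radius of the disc that is swept by the coordinates `(ϖ u - b / ϖ, p)`. -/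
noncomputable def discRadius (ϖ α h : ℝ) : ℝ := Real.sqrt (2 * h + centre ϖ α ^ 2)

section bounds
variable {ϖ α h φ : ℝ} {y : State}

theorem Admissible.discRadius_arg_pos (H : Admissible ϖ α h) : 0 < 2 * h + centre ϖ α ^ 2 := by
  have h1 := H.upp
  have h2 := H.ϖ_pos
  unfold centre
  rw [div_pow, ← neg_lt_iff_pos_add', lt_div_iff₀ (by positivity)]
  linarith

theorem Admissible.discRadius_pos (H : Admissible ϖ α h) : 0 < discRadius ϖ α h :=
  Real.sqrt_pos.mpr H.discRadius_arg_pos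

theorem Admissible.discRadius_sq (H : Admissible ϖ α h) :
    discRadius ϖ α h ^ 2 = 2 * h + centre ϖ α ^ 2 :=
  Real.sq_sqrt H.discRadius_arg_pos.le

theorem Admissible.h_neg (H : Admissible ϖ α h) : h < 0 := by
  have h1 := H.low
  have h2 := H.ϖ_pos
  by_contra! hh
  have : ϖ ^ 2 * -h ≤ 0 := mul_nonpos_of_nonneg_of_nonpos (by positivity) (by linarith)
  linarith

theorem Admissible.centre_pos (H : Admissible ϖ α h) : 0 < centre ϖ α := by
  have := H.ϖ_pos
  have := H.α_pos
  unfold centre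
  positivity

theorem Admissible.discRadius_lt_centre (H : Admissible ϖ α h) :
    discRadius ϖ α h < centre ϖ α := by
  have h1 := H.discRadius_sq
  have h2 := H.h_neg
  exact lt_of_pow_lt_pow_left₀ 2 H.centre_pos.le (by linarith)

/-- The square in u is completed so that the last bracket is the energy of the vertical motion. It
is nonnegative and vanishes for R = 0: each page lies over the disc, with the Euler orbit over the
boundary circle. -/
theorem two_mul_polarEnergy (hϖ : 0 < ϖ) :
    2 * polarEnergy ϖ α φ y = (ϖ * y.1 - centre ϖ α) ^ 2 + y.2.1 ^ 2 - centre ϖ α ^ 2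
      + ((y.2.2 * Real.sin φ) ^ 2
        + 2 * (4 * α⁻¹ * y.1 * (1 - 1 / Real.sqrt (ratioSq α φ y)))) := by
  unfold polarEnergy centre
  field_simp
  ring

theorem height_energy_nonneg (hα : 0 < α) (hu : 0 < y.1) :
    0 ≤ 4 * α⁻¹ * y.1 * (1 - 1 / Real.sqrt (ratioSq α φ y)) := by
  have hs := one_le_sqrt_ratioSq (φ := φ) (y := y) hα
  have : 1 / Real.sqrt (ratioSq α φ y) ≤ 1 := by
    rw [div_le_one (by linarith)]; exact hs
  have : 0 ≤ 1 - 1 / Real.sqrt (ratioSq α φ y) := by linarith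
  positivity

theorem Admissible.disc_le (H : Admissible ϖ α h) (hu : 0 < y.1)
    (hE : polarEnergy ϖ α φ y = h) :
    (ϖ * y.1 - centre ϖ α) ^ 2 + y.2.1 ^ 2 + (y.2.2 * Real.sin φ) ^ 2 ≤ discRadius ϖ α h ^ 2 := by
  have h1 := two_mul_polarEnergy (α := α) (φ := φ) (y := y) H.ϖ_pos
  have h2 := height_energy_nonneg (φ := φ) H.α_pos hu
  rw [H.discRadius_sq]
  linarith

/-- The disc bounds u and p, and since h < 0 it stays away from u = 0. The bound on z needs ϖ²|h| >
1/2: for |z| → ∞ the last term of the potential disappears, and the rest ϖ²u²/2 - u is at least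
-1/(2ϖ²) > h. -/
theorem Admissible.exists_bound (H : Admissible ϖ α h) :
    ∃ M : ℝ, 1 < M ∧ ∀ (φ : ℝ) (y : State), 0 < y.1 → polarEnergy ϖ α φ y = h →
      M⁻¹ < y.1 ∧ y.1 < M ∧ |y.2.1| < M ∧ |y.2.2| < M := by
  have hϖ := H.ϖ_pos
  have hα := H.α_pos
  set ρ := discRadius ϖ α h with hρ
  have hρ0 : 0 < ρ := H.discRadius_pos
  set c := centre ϖ α
  have hρc : ρ < c := H.discRadius_lt_centre
  set u₀ := (c - ρ) / ϖ with hu₀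
  set u₁ := (c + ρ) / ϖ with hu₁
  have hu₀p : 0 < u₀ := div_pos (by linarith) hϖ
  have hu₁p : 0 < u₁ := div_pos (by linarith) hϖ
  set δ := -h - 1 / (2 * ϖ ^ 2) with hδ
  have hδp : 0 < δ := by
    rw [hδ, sub_pos, div_lt_iff₀ (by positivity)]
    linarith [H.low]
  set B := (4 * α⁻¹ * u₁ / δ) ^ 2 / ((1 + 2 * α) * u₀ ^ 2) with hB
  have hBp : 0 ≤ B := by positivity
  refine ⟨u₁ + u₀⁻¹ + ρ + (ρ ^ 2 + B) + 2, by linarith [inv_pos.mpr hu₀p, sq_nonneg ρ], ?_⟩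
  intro φ y hu hE
  have hd := H.disc_le hu hE
  have hX : |ϖ * y.1 - c| ≤ ρ := abs_le_of_sq_le_sq (by linarith [sq_nonneg y.2.1, sq_nonneg (y.2.2 * Real.sin φ)]) hρ0.le
  have hp : |y.2.1| ≤ ρ := abs_le_of_sq_le_sq (by linarith [sq_nonneg (ϖ * y.1 - c), sq_nonneg (y.2.2 * Real.sin φ)]) hρ0.le
  have hs : (y.2.2 * Real.sin φ) ^ 2 ≤ ρ ^ 2 := by linarith [sq_nonneg (ϖ * y.1 - c), sq_nonneg y.2.1]
  rw [abs_le] at hX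
  have hul : u₀ ≤ y.1 := by rw [hu₀, div_le_iff₀ hϖ]; linarith
  have huu : y.1 ≤ u₁ := by rw [hu₁, le_div_iff₀ hϖ]; linarith
  have hS := one_le_sqrt_ratioSq (φ := φ) (y := y) hα
  have hm : δ ≤ 4 * α⁻¹ * y.1 / Real.sqrt (ratioSq α φ y) := by
    have : 4 * α⁻¹ * y.1 / Real.sqrt (ratioSq α φ y) =
      y.2.1 ^ 2 / 2 + (y.2.2 * Real.sin φ) ^ 2 / 2 + ϖ ^ 2 * y.1 ^ 2 / 2 - y.1 - h := by
      rw [← hE]; unfold polarEnergy; ring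
    rw [this, hδ]
    have e : ϖ ^ 2 * y.1 ^ 2 / 2 - y.1 + 1 / (2 * ϖ ^ 2) = (ϖ * y.1 - 1 / ϖ) ^ 2 / 2 := by
      field_simp; ring
    linarith [sq_nonneg (ϖ * y.1 - 1 / ϖ), sq_nonneg y.2.1, sq_nonneg (y.2.2 * Real.sin φ)]
  have hS2 : Real.sqrt (ratioSq α φ y) ≤ 4 * α⁻¹ * u₁ / δ := by
    rw [le_div_iff₀ hδp]
    rw [le_div_iff₀ (by linarith)] at hm
    have : 4 * α⁻¹ * y.1 ≤ 4 * α⁻¹ * u₁ := by gcongr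
    linarith
  have hc : (y.2.2 * Real.cos φ) ^ 2 ≤ B := by
    rw [hB, le_div_iff₀ (by positivity)]
    have h1 : ratioSq α φ y ≤ (4 * α⁻¹ * u₁ / δ) ^ 2 := by
      rw [← Real.sq_sqrt (zero_le_one.trans (one_le_ratioSq (φ := φ) (y := y) hα))]
      gcongr
    unfold ratioSq at h1
    have h2 : (y.2.2 * Real.cos φ) ^ 2 * ((1 + 2 * α) * u₀ ^ 2)
        ≤ (1 + 2 * α) * (y.1 * (y.2.2 * Real.cos φ)) ^ 2 := by
      rw [mul_pow y.1]
      have : u₀ ^ 2 ≤ y.1 ^ 2 := by gcongr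
      have h3 : 0 ≤ (y.2.2 * Real.cos φ) ^ 2 * (1 + 2 * α) := by positivity
      nlinarith
    linarith
  have hR : y.2.2 ^ 2 ≤ ρ ^ 2 + B := by
    have := Real.sin_sq_add_cos_sq φ
    have e : y.2.2 ^ 2 = (y.2.2 * Real.sin φ) ^ 2 + (y.2.2 * Real.cos φ) ^ 2 := by
      linear_combination (-y.2.2 ^ 2) * this
    linarith
  have hR' : |y.2.2| ≤ ρ ^ 2 + B + 1 := by
    have := sq_abs y.2.2
    linarith [abs_nonneg y.2.2, sq_nonneg (|y.2.2| - 1), sq_nonneg y.2.2]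
  have hinv : 0 < u₀⁻¹ := inv_pos.mpr hu₀p
  have hρ2 := sq_nonneg ρ
  refine ⟨?_, by linarith, by linarith, by linarith⟩
  refine lt_of_lt_of_le ?_ hul
  rw [inv_lt_comm₀ (by linarith) hu₀p]
  linarith

end bounds
theorem fderiv_hamiltonian {ϖ α : ℝ} (hα : 0 < α) {x : Phase} (hx : 0 < rad x) (v : Phase) :
    fderiv ℝ (hamiltonian ϖ α) x v = pr x * pr v + pz x * pz v
      + potentialDr ϖ α (rad x) (height x) * rad v
      + potentialDz α (rad x) (height x) * height v := by
  have hd : HasFDerivAt (hamiltonian ϖ α) (fderiv ℝ (hamiltonian ϖ α) x) x :=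
    ((contDiffAt_hamiltonian hα hx).differentiableAt one_ne_zero).hasFDerivAt
  obtain ⟨a, b, r, z⟩ := x
  obtain ⟨v₁, v₂, v₃, v₄⟩ := v
  set L := fderiv ℝ (hamiltonian ϖ α) (a, b, r, z)
  have c : ∀ (s s' : ℝ), HasDerivAt (fun _ : ℝ => s') 0 s := fun s s' => hasDerivAt_const s s'
  have l1 : L (1, 0, 0, 0) = a := by
    have h1 : HasDerivAt (fun s => ((s, b, r, z) : Phase)) (1, 0, 0, 0) a :=
      (hasDerivAt_id a).prodMk ((c _ _).prodMk ((c _ _).prodMk (c _ _)))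
    refine (hd.comp_hasDerivAt a h1).unique ?_
    have := (((hasDerivAt_pow 2 a).add_const (b ^ 2)).div_const 2).add_const (potential ϖ α r z)
    exact this.congr_deriv (by norm_num)
  have l2 : L (0, 1, 0, 0) = b := by
    have h1 : HasDerivAt (fun s => ((a, s, r, z) : Phase)) (0, 1, 0, 0) b :=
      (c _ _).prodMk ((hasDerivAt_id b).prodMk ((c _ _).prodMk (c _ _)))
    refine (hd.comp_hasDerivAt b h1).unique ?_
    have := (((hasDerivAt_pow 2 b).const_add (a ^ 2)).div_const 2).add_const (potential ϖ α r z)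
    exact this.congr_deriv (by norm_num)
  have l3 : L (0, 0, 1, 0) = potentialDr ϖ α r z := by
    have h1 : HasDerivAt (fun s => ((a, b, s, z) : Phase)) (0, 0, 1, 0) r :=
      (c _ _).prodMk ((c _ _).prodMk ((hasDerivAt_id r).prodMk (c _ _)))
    refine (hd.comp_hasDerivAt r h1).unique ?_
    exact (hasDerivAt_potential_r hα hx z).const_add ((a ^ 2 + b ^ 2) / 2)
  have l4 : L (0, 0, 0, 1) = potentialDz α r z := by
    have h1 : HasDerivAt (fun s => ((a, b, r, s) : Phase)) (0, 0, 0, 1) z :=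
      (c _ _).prodMk ((c _ _).prodMk ((c _ _).prodMk (hasDerivAt_id z)))
    refine (hd.comp_hasDerivAt z h1).unique ?_
    exact (hasDerivAt_potential_z hα hx z).const_add ((a ^ 2 + b ^ 2) / 2)
  have hv : ((v₁, v₂, v₃, v₄) : Phase) = v₁ • (1, 0, 0, 0) + v₂ • (0, 1, 0, 0)
      + v₃ • (0, 0, 1, 0) + v₄ • (0, 0, 0, 1) := by simp
  have hL := congrArg L hv
  simp only [map_add, map_smul, l1, l2, l3, l4, smul_eq_mul] at hL
  rw [hL]
  ring

theorem hasDerivAt_polarEnergy {ϖ α φ : ℝ} (hα : 0 < α) {y : ℝ → State} (hu : 0 < (y φ).1)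
    (hy : HasDerivAt y (polarField ϖ α φ (y φ)) φ) :
    HasDerivAt (fun φ => polarEnergy ϖ α φ (y φ)) 0 φ := by
  have hx : 0 < rad (phys φ (y φ)) := inv_pos.mpr hu
  have h1 := hasDerivAt_phys hα hu hy
  have h2 := ((contDiffAt_hamiltonian (ϖ := ϖ) hα hx).differentiableAt
    one_ne_zero).hasFDerivAt.comp_hasDerivAt φ h1
  have h3 : (fun φ => polarEnergy ϖ α φ (y φ)) =ᶠ[𝓝 φ]
      (hamiltonian ϖ α ∘ fun φ => phys φ (y φ)) := by
    have : ∀ᶠ s in 𝓝 φ, 0 < (y s).1 :=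
      (continuous_fst.continuousAt.comp hy.continuousAt).eventually_const_lt hu
    filter_upwards [this] with s hs
    exact (hamiltonian_phys hα hs).symm
  refine (h2.congr_of_eventuallyEq h3).congr_deriv ?_
  rw [map_smul, fderiv_hamiltonian hα hx]
  simp only [hamiltonianField, smul_eq_mul]
  ring

/-! ### Solutions parametrized by the phase -/

/-- A solution of Hamilton's equations on the energy surface, parametrized by the phase. -/
def IsSol (ϖ α h : ℝ) (y : ℝ → State) : Prop :=
  ∀ φ, 0 < (y φ).1 ∧ polarEnergy ϖ α φ (y φ) = h ∧ HasDerivAt y (polarField ϖ α φ (y φ)) φ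

theorem IsSol.continuous {ϖ α h : ℝ} {y : ℝ → State} (hy : IsSol ϖ α h y) : Continuous y :=
  continuous_iff_continuousAt.mpr fun φ => (hy φ).2.2.continuousAt

/-- The box in which the solutions on the energy surface stay. -/
def box (M : ℝ) : Set State := Icc (M⁻¹, -M, -M) (M, M, M)

theorem mem_box {M : ℝ} {y : State} :
    y ∈ box M ↔ (M⁻¹ ≤ y.1 ∧ y.1 ≤ M) ∧ (-M ≤ y.2.1 ∧ y.2.1 ≤ M) ∧ (-M ≤ y.2.2 ∧ y.2.2 ≤ M) := by
  simp only [box, mem_Icc, Prod.le_def]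
  tauto

/-- The nearest point of the box. -/
noncomputable def clampBox (M : ℝ) (y : State) : State :=
  (max M⁻¹ (min M y.1), max (-M) (min M y.2.1), max (-M) (min M y.2.2))

theorem clampBox_mem {M : ℝ} (hM : 1 < M) (y : State) : clampBox M y ∈ box M := by
  have h1 : M⁻¹ ≤ M := (inv_lt_one_of_one_lt₀ hM).le.trans hM.le
  have h2 : -M ≤ M := by linarith
  simp [mem_box, clampBox, h1, h2]

theorem clampBox_eq {M : ℝ} {y : State} (hy : y ∈ box M) : clampBox M y = y := by
  obtain ⟨⟨h1, h2⟩, ⟨h3, h4⟩, h5, h6⟩ := mem_box.mp hy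
  simp [clampBox, *]

theorem lipschitzWith_clampBox (M : ℝ) : LipschitzWith 1 (clampBox M) := by
  have h : ∀ c, LipschitzWith 1 (fun s : ℝ => max c (min M s)) := fun c =>
    (LipschitzWith.id.const_min M).const_max c
  have h1 := (h M⁻¹).comp (LipschitzWith.prod_fst (α := ℝ) (β := ℝ × ℝ))
  have h2 := (h (-M)).comp ((LipschitzWith.prod_fst (α := ℝ) (β := ℝ)).comp
    (LipschitzWith.prod_snd (α := ℝ) (β := ℝ × ℝ)))
  have h3 := (h (-M)).comp ((LipschitzWith.prod_snd (α := ℝ) (β := ℝ)).comp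
    (LipschitzWith.prod_snd (α := ℝ) (β := ℝ × ℝ)))
  simpa [clampBox] using! h1.prodMk (h2.prodMk h3)

section congr
variable {ϖ α φ φ' a b : ℝ}

theorem ratioSq_congr (hb : b ^ 2 = 1) (hc : Real.cos φ' = b * Real.cos φ) (y : State) : ratioSq α φ' y = ratioSq α φ y := by
  unfold ratioSq
  rw [hc]
  linear_combination ((1 + 2 * α) * (y.1 * (y.2.2 * Real.cos φ)) ^ 2) * hb

theorem stiffness_congr (hb : b ^ 2 = 1) (hc : Real.cos φ' = b * Real.cos φ) (y : State) : stiffness α φ' y = stiffness α φ y := by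
  unfold stiffness
  rw [ratioSq_congr hb hc]

theorem phaseSpeed_congr (ha : a ^ 2 = 1) (hb : b ^ 2 = 1)
    (hs : Real.sin φ' = a * Real.sin φ) (hc : Real.cos φ' = b * Real.cos φ) (y : State) : phaseSpeed α φ' y = phaseSpeed α φ y := by
  unfold phaseSpeed
  rw [stiffness_congr hb hc, hs, hc]
  linear_combination Real.sin φ ^ 2 * ha + stiffness α φ y * Real.cos φ ^ 2 * hb

theorem polarEnergy_congr (ha : a ^ 2 = 1) (hb : b ^ 2 = 1)
    (hs : Real.sin φ' = a * Real.sin φ) (hc : Real.cos φ' = b * Real.cos φ) (y : State) : polarEnergy ϖ α φ' y = polarEnergy ϖ α φ y := by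
  unfold polarEnergy
  rw [ratioSq_congr hb hc, hs]
  linear_combination (y.2.2 * Real.sin φ) ^ 2 / 2 * ha

/-- The signs a, b cover all phase symmetries at once: φ ↦ φ + kπ has a = b, and φ ↦ kπ - φ has a =
-b. Only the R-component notices the difference. -/
theorem polarField_congr (ha : a ^ 2 = 1) (hb : b ^ 2 = 1)
    (hs : Real.sin φ' = a * Real.sin φ) (hc : Real.cos φ' = b * Real.cos φ) (y : State) : polarField ϖ α φ' y =
    ((polarField ϖ α φ y).1, (polarField ϖ α φ y).2.1, a * b * (polarField ϖ α φ y).2.2) := by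
  unfold polarField
  rw [ratioSq_congr hb hc, phaseSpeed_congr ha hb hs hc, stiffness_congr hb hc, hs, hc]
  simp only [Prod.mk.injEq, true_and]
  ring

end congr

/-- By 2π-periodicity the constants of one compact phase interval serve for all phases. The inverse
phase speed is included because it governs the elapsed time. -/
theorem exists_lipschitz_polarField (ϖ : ℝ) {α M : ℝ} (hα : 0 < α) (hM : 1 < M) :
    ∃ K L : NNReal, ∀ φ,
      LipschitzOnWith K (fun y => (polarField ϖ α φ y, (phaseSpeed α φ y)⁻¹)) (box M) ∧
      ∀ y ∈ box M, ‖(polarField ϖ α φ y, (phaseSpeed α φ y)⁻¹)‖ ≤ L := by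
  set F : ℝ × State → State × ℝ := fun q => (polarField ϖ α q.1 q.2, (phaseSpeed α q.1 q.2)⁻¹)
  set C : Set (ℝ × State) := Icc (-Real.pi) Real.pi ×ˢ box M
  have hCc : IsCompact C := isCompact_Icc.prod isCompact_Icc
  have hCx : Convex ℝ C := (convex_Icc _ _).prod (convex_Icc _ _)
  have hpos : ∀ y ∈ box M, 0 < y.1 := fun y hy =>
    (inv_pos.mpr (by linarith)).trans_le (mem_box.mp hy).1.1
  have hF : ContDiffOn ℝ 1 F C := fun q hq =>
    (contDiffAt_polarField hα (hpos _ hq.2)).contDiffWithinAt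
  obtain ⟨K, hK⟩ := hF.exists_lipschitzOnWith one_ne_zero hCx hCc
  obtain ⟨L, hL⟩ := hCc.exists_bound_of_continuousOn hF.continuousOn
  refine ⟨K, L.toNNReal, fun φ => ?_⟩
  obtain ⟨φ', hφ', hs, hc⟩ : ∃ φ' ∈ Icc (-Real.pi) Real.pi,
      Real.sin φ = 1 * Real.sin φ' ∧ Real.cos φ = 1 * Real.cos φ' := by
    refine ⟨toIocMod Real.two_pi_pos (-Real.pi) φ, ?_, ?_, ?_⟩
    · have := toIocMod_mem_Ioc Real.two_pi_pos (-Real.pi) φ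
      exact ⟨this.1.le, by linarith [this.2]⟩
    · rw [toIocMod, one_mul, Real.sin_periodic.sub_zsmul_eq]
    · rw [toIocMod, one_mul, Real.cos_periodic.sub_zsmul_eq]
  have hFe : ∀ y, (polarField ϖ α φ y, (phaseSpeed α φ y)⁻¹) = F (φ', y) := by
    intro y
    simp only [F]
    rw [polarField_congr (by norm_num) (by norm_num) hs hc,
      phaseSpeed_congr (by norm_num) (by norm_num) hs hc]
    simp
  simp only [hFe]
  refine ⟨?_, fun y hy => (hL _ ⟨hφ', hy⟩).trans (Real.le_coe_toNNReal L)⟩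
  refine LipschitzOnWith.of_dist_le_mul fun y hy z hz => ?_
  have := hK.dist_le_mul (φ', y) ⟨hφ', hy⟩ (φ', z) ⟨hφ', hz⟩
  simpa [Prod.dist_eq] using this

theorem continuous_polarEnergy {ϖ α : ℝ} (hα : 0 < α) :
    Continuous fun q : ℝ × State => polarEnergy ϖ α q.1 q.2 := by
  have h0 : ∀ q : ℝ × State, Real.sqrt (ratioSq α q.1 q.2) ≠ 0 := fun q =>
    (zero_lt_one.trans_le (one_le_sqrt_ratioSq hα)).ne'
  have h1 : Continuous fun q : ℝ × State => ratioSq α q.1 q.2 := by unfold ratioSq; fun_prop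
  unfold polarEnergy
  exact Continuous.sub (by fun_prop) (Continuous.div (by fun_prop) (by fun_prop) h0)

theorem continuousAt_polarField {ϖ α : ℝ} (hα : 0 < α) {q : ℝ × State} (hq : 0 < q.2.1) :
    ContinuousAt (fun q : ℝ × State => polarField ϖ α q.1 q.2) q :=
  (contDiffAt_polarField hα hq).continuousAt.fst

theorem continuousAt_inv_phaseSpeed {α : ℝ} (hα : 0 < α) {q : ℝ × State} (hq : 0 < q.2.1) :
    ContinuousAt (fun q : ℝ × State => (phaseSpeed α q.1 q.2)⁻¹) q :=
  (contDiffAt_polarField (ϖ := 0) hα hq).continuousAt.snd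

section solutions
variable {ϖ α h : ℝ}

theorem Admissible.exists_box (H : Admissible ϖ α h) :
    ∃ M : ℝ, 1 < M ∧ ∀ (φ : ℝ) (y : State), 0 < y.1 → polarEnergy ϖ α φ y = h →
      y ∈ interior (box M) := by
  obtain ⟨M, hM, hb⟩ := H.exists_bound
  refine ⟨M, hM, fun φ y hu hE => ?_⟩
  obtain ⟨h1, h2, h3, h4⟩ := hb φ y hu hE
  rw [abs_lt] at h3 h4
  rw [box, ← Icc_prod_Icc, ← Icc_prod_Icc, interior_prod_eq, interior_prod_eq, interior_Icc,
    interior_Icc]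
  exact ⟨⟨h1, h2⟩, h3, h4⟩

/-- Precomposing the field with the retraction onto the box makes it globally Lipschitz and bounded.
The set of phases at which the solution is in the box with energy h is clopen: energy is conserved
wherever the retraction is inactive, and points of energy h lie in the interior of the box. -/
theorem Admissible.exists_sol (H : Admissible ϖ α h) {φ₀ : ℝ} {y₀ : State} (hu : 0 < y₀.1)
    (hE : polarEnergy ϖ α φ₀ y₀ = h) : ∃ y, IsSol ϖ α h y ∧ y φ₀ = y₀ := by
  have hα := H.α_pos
  obtain ⟨M, hM, hb⟩ := H.exists_box
  obtain ⟨K, L, hKL⟩ := exists_lipschitz_polarField ϖ hα hM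
  have hpos : ∀ y ∈ box M, 0 < y.1 := fun y hy =>
    (inv_pos.mpr (by linarith)).trans_le (mem_box.mp hy).1.1
  have hex : ∃ y : ℝ → State, y φ₀ = y₀ ∧
      ∀ φ, HasDerivAt y (polarField ϖ α φ (clampBox M (y φ))) φ := by
    refine exists_global_solution (f := fun φ y => polarField ϖ α φ (clampBox M y))
      (K := K) (L := L) (fun φ => ?_) (fun x => ?_) (fun φ x => ?_) φ₀ y₀
    · have h1 : LipschitzOnWith K (polarField ϖ α φ) (box M) := by
        simpa using! LipschitzWith.prod_fst.comp_lipschitzOnWith (hKL φ).1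
      have h2 := h1.comp (s := univ) (lipschitzWith_clampBox M).lipschitzOnWith
        (fun x _ => clampBox_mem hM x)
      simpa using! lipschitzOnWith_univ.mp h2
    · refine continuous_iff_continuousAt.mpr fun φ => ?_
      exact ContinuousAt.comp (f := fun φ => (φ, clampBox M x))
        (continuousAt_polarField hα (hpos _ (clampBox_mem hM x))) (by fun_prop)
    · exact (norm_fst_le _).trans ((hKL φ).2 _ (clampBox_mem hM x))
  obtain ⟨y, hy0, hy⟩ := hex
  have hyc : Continuous y := continuous_iff_continuousAt.mpr fun φ => (hy φ).continuousAt
  set J : Set ℝ := {φ | y φ ∈ box M ∧ polarEnergy ϖ α φ (y φ) = h} with hJ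
  have hclosed : IsClosed J := by
    refine (isClosed_Icc.preimage hyc).inter ?_
    exact isClosed_eq ((continuous_polarEnergy hα).comp (continuous_id.prodMk hyc))
      continuous_const
  have hopen : IsOpen J := by
    rw [isOpen_iff_mem_nhds]
    rintro φ ⟨hφ1, hφ2⟩
    have hint := hb φ (y φ) (hpos _ hφ1) hφ2
    have hev : ∀ᶠ s in 𝓝 φ, y s ∈ interior (box M) :=
      hyc.continuousAt.eventually (isOpen_interior.mem_nhds hint)
    obtain ⟨ε, hε, hball⟩ := Metric.eventually_nhds_iff_ball.mp hev
    filter_upwards [Metric.ball_mem_nhds φ hε] with s hs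
    refine ⟨interior_subset (hball s hs), ?_⟩
    have hd : ∀ t ∈ Metric.ball φ ε, HasDerivAt (fun φ => polarEnergy ϖ α φ (y φ)) 0 t := by
      intro t ht
      have hmem := interior_subset (hball t ht)
      refine hasDerivAt_polarEnergy hα (hpos _ hmem) ?_
      simpa only [clampBox_eq hmem] using hy t
    rw [← hφ2]
    exact Metric.isOpen_ball.is_const_of_deriv_eq_zero (convex_ball φ ε).isPreconnected
      (fun t ht => (hd t ht).differentiableAt.differentiableWithinAt) (fun t ht => (hd t ht).deriv) hs
      (Metric.mem_ball_self hε)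
  have hne : J.Nonempty := ⟨φ₀, by
    refine ⟨?_, ?_⟩
    · rw [hy0]; exact interior_subset (hb φ₀ y₀ hu hE)
    · rw [hy0, hE]⟩
  have huniv := IsClopen.eq_univ ⟨hclosed, hopen⟩ hne
  refine ⟨y, fun φ => ?_, hy0⟩
  obtain ⟨h1, h2⟩ : φ ∈ J := huniv ▸ mem_univ φ
  exact ⟨hpos _ h1, h2, by simpa only [clampBox_eq h1] using hy φ⟩

theorem Admissible.exists_gronwall (H : Admissible ϖ α h) :
    ∃ K : NNReal, ∀ y₁ y₂, IsSol ϖ α h y₁ → IsSol ϖ α h y₂ → ∀ φ₀ φ, φ₀ ≤ φ →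
      dist (y₁ φ) (y₂ φ) ≤ dist (y₁ φ₀) (y₂ φ₀) * Real.exp (K * (φ - φ₀)) := by
  obtain ⟨M, hM, hb⟩ := H.exists_box
  obtain ⟨K, L, hKL⟩ := exists_lipschitz_polarField ϖ H.α_pos hM
  refine ⟨K, fun y₁ y₂ h₁ h₂ φ₀ φ hφ => ?_⟩
  refine dist_le_of_trajectories_ODE_of_mem (v := polarField ϖ α) (s := fun _ => box M)
    (a := φ₀) (b := φ) (fun φ _ => ?_)
    h₁.continuous.continuousOn (fun t _ => (h₁ t).2.2.hasDerivWithinAt)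
    (fun t _ => interior_subset (hb t _ (h₁ t).1 (h₁ t).2.1))
    h₂.continuous.continuousOn (fun t _ => (h₂ t).2.2.hasDerivWithinAt)
    (fun t _ => interior_subset (hb t _ (h₂ t).1 (h₂ t).2.1)) le_rfl φ ⟨hφ, le_rfl⟩
  simpa using! LipschitzWith.prod_fst.comp_lipschitzOnWith (hKL φ).1

theorem IsSol.unique (H : Admissible ϖ α h) {y₁ y₂ : ℝ → State} (h₁ : IsSol ϖ α h y₁)
    (h₂ : IsSol ϖ α h y₂) {φ₀ : ℝ} (heq : y₁ φ₀ = y₂ φ₀) : y₁ = y₂ := by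
  obtain ⟨M, hM, hb⟩ := H.exists_box
  obtain ⟨K, L, hKL⟩ := exists_lipschitz_polarField ϖ H.α_pos hM
  refine ODE_solution_unique_univ (v := polarField ϖ α) (s := fun _ => box M) (K := K) (fun φ => ?_)
    (fun t => ⟨(h₁ t).2.2, interior_subset (hb t _ (h₁ t).1 (h₁ t).2.1)⟩)
    (fun t => ⟨(h₂ t).2.2, interior_subset (hb t _ (h₂ t).1 (h₂ t).2.1)⟩) heq
  simpa using! LipschitzWith.prod_fst.comp_lipschitzOnWith (hKL φ).1

theorem sq_cos_int_mul_pi (k : ℤ) : Real.cos (k * Real.pi) ^ 2 = 1 := by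
  have := Real.sin_sq_add_cos_sq (k * Real.pi)
  rw [Real.sin_int_mul_pi] at this
  linarith

/-- For odd k this is the mirror symmetry (z, p_z) ↦ (-z, -p_z), which adds π to the phase. -/
theorem IsSol.shift {y : ℝ → State} (hy : IsSol ϖ α h y) (k : ℤ) :
    IsSol ϖ α h fun φ => y (φ + k * Real.pi) := by
  intro φ
  have ha := sq_cos_int_mul_pi k
  have hs : Real.sin (φ + k * Real.pi) = Real.cos (k * Real.pi) * Real.sin φ := by
    rw [Real.sin_add, Real.sin_int_mul_pi]; ring
  have hc : Real.cos (φ + k * Real.pi) = Real.cos (k * Real.pi) * Real.cos φ := by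
    rw [Real.cos_add, Real.sin_int_mul_pi]; ring
  obtain ⟨h1, h2, h3⟩ := hy (φ + k * Real.pi)
  refine ⟨h1, ?_, ?_⟩
  · rw [← h2, polarEnergy_congr ha ha hs hc]
  · refine (h3.comp_add_const φ (k * Real.pi)).congr_deriv ?_
    rw [polarField_congr ha ha hs hc, ← pow_two, ha, one_mul]

/-- Reversal of the momentum `p_r`. -/
def flip (y : State) : State := (y.1, -y.2.1, y.2.2)

/-- This is time reversal, combined with the mirror symmetry when k is odd. -/
theorem IsSol.reflect {y : ℝ → State} (hy : IsSol ϖ α h y) (k : ℤ) :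
    IsSol ϖ α h fun φ => flip (y (k * Real.pi - φ)) := by
  intro φ
  have ha := sq_cos_int_mul_pi k
  have hs : Real.sin (k * Real.pi - φ) = -Real.cos (k * Real.pi) * Real.sin φ := by
    rw [Real.sin_sub, Real.sin_int_mul_pi]; ring
  have hc : Real.cos (k * Real.pi - φ) = Real.cos (k * Real.pi) * Real.cos φ := by
    rw [Real.cos_sub, Real.sin_int_mul_pi]; ring
  have ha' : (-Real.cos (k * Real.pi)) ^ 2 = 1 := by rw [neg_sq, ha]
  obtain ⟨h1, h2, h3⟩ := hy (k * Real.pi - φ)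
  have hr : ∀ ψ y, ratioSq α ψ (flip y) = ratioSq α ψ y := fun ψ y => rfl
  have hk : ∀ ψ y, stiffness α ψ (flip y) = stiffness α ψ y := fun ψ y => rfl
  have hg : ∀ ψ y, phaseSpeed α ψ (flip y) = phaseSpeed α ψ y := fun ψ y => rfl
  have hE : ∀ ψ y, polarEnergy ϖ α ψ (flip y) = polarEnergy ϖ α ψ y := fun ψ y => by
    unfold polarEnergy
    rw [hr]
    simp [flip]
  refine ⟨h1, ?_, ?_⟩
  · rw [hE, ← h2, polarEnergy_congr ha' ha hs hc]
  · have h4 : HasDerivAt (fun φ => y (k * Real.pi - φ)) _ φ := h3.comp_const_sub (k * Real.pi) φ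
    have h41 : HasDerivAt (fun φ => (y (k * Real.pi - φ)).1) _ φ := h4.fst
    have h42 : HasDerivAt (fun φ => (y (k * Real.pi - φ)).2.1) _ φ := h4.snd.fst
    have h43 : HasDerivAt (fun φ => (y (k * Real.pi - φ)).2.2) _ φ := h4.snd.snd
    have h5 := h41.prodMk (h42.neg.prodMk h43)
    refine h5.congr_deriv ?_
    rw [polarField_congr ha' ha hs hc, show -Real.cos (k * Real.pi) * Real.cos (k * Real.pi) = -1 by
      linarith]
    unfold polarField
    rw [hr, hk, hg]
    simp [flip]
    ring

end solutions
-- Passing between phase and time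
section clock
variable {ϖ α h : ℝ}

theorem IsSol.continuous_inv_phaseSpeed (hα : 0 < α) {y : ℝ → State} (hy : IsSol ϖ α h y) :
    Continuous fun φ => (phaseSpeed α φ (y φ))⁻¹ :=
  continuous_iff_continuousAt.mpr fun φ =>
    ContinuousAt.comp (f := fun φ => (φ, y φ)) (continuousAt_inv_phaseSpeed hα (hy φ).1)
      (continuousAt_id.prodMk hy.continuous.continuousAt)

theorem IsSol.continuous_phaseSpeed (hα : 0 < α) {y : ℝ → State} (hy : IsSol ϖ α h y) :
    Continuous fun φ => phaseSpeed α φ (y φ) := by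
  have h1 := (hy.continuous_inv_phaseSpeed hα).inv₀
    fun φ => (inv_pos.mpr (phaseSpeed_pos hα (hy φ).1)).ne'
  exact h1.congr fun φ => by simp

theorem IsSol.continuous_stiffness (hα : 0 < α) {y : ℝ → State} (hy : IsSol ϖ α h y) :
    Continuous fun φ => stiffness α φ (y φ) := by
  have hc := hy.continuous
  have h1 : Continuous fun φ => ratioSq α φ (y φ) := by unfold ratioSq; fun_prop
  have h0 : ∀ φ, Real.sqrt (ratioSq α φ (y φ)) ^ 3 ≠ 0 := fun φ =>
    pow_ne_zero _ (zero_lt_one.trans_le (one_le_sqrt_ratioSq hα)).ne'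
  unfold stiffness
  exact Continuous.div (by fun_prop) (by fun_prop) h0

/-- R solves a homogeneous linear equation along each solution. Hence its sign is preserved, and the
Euler orbit R = 0 is invariant. -/
theorem IsSol.radius_eq (hα : 0 < α) {y : ℝ → State} (hy : IsSol ϖ α h y) (φ₀ φ : ℝ) :
    ∃ c > 0, (y φ).2.2 = (y φ₀).2.2 * c := by
  have hc : Continuous fun φ => Real.sin φ * Real.cos φ * (stiffness α φ (y φ) - 1) *
      (phaseSpeed α φ (y φ))⁻¹ := by
    have h1 := hy.continuous_stiffness hα
    have h2 := hy.continuous_inv_phaseSpeed hα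
    fun_prop
  have hd : ∀ t, HasDerivAt (fun φ => (y φ).2.2) (Real.sin t * Real.cos t *
      (stiffness α t (y t) - 1) * (phaseSpeed α t (y t))⁻¹ * (y t).2.2) t := by
    intro t
    have h1 : HasDerivAt (fun φ => (y φ).2.2) _ t := (hy t).2.2.snd.snd
    refine h1.congr_deriv ?_
    simp only [polarField]
    ring
  exact ⟨_, Real.exp_pos _, eq_mul_exp_of_hasDerivAt_mul hc hd φ₀ φ⟩

theorem IsSol.radius_pos (hα : 0 < α) {y : ℝ → State} (hy : IsSol ϖ α h y) {φ₀ : ℝ}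
    (h0 : 0 < (y φ₀).2.2) (φ : ℝ) : 0 < (y φ).2.2 := by
  obtain ⟨c, hc, he⟩ := hy.radius_eq hα φ₀ φ
  rw [he]; positivity

theorem IsSol.radius_nonneg (hα : 0 < α) {y : ℝ → State} (hy : IsSol ϖ α h y) {φ₀ : ℝ}
    (h0 : 0 ≤ (y φ₀).2.2) (φ : ℝ) : 0 ≤ (y φ).2.2 := by
  obtain ⟨c, hc, he⟩ := hy.radius_eq hα φ₀ φ
  rw [he]; positivity

theorem IsSol.radius_zero (hα : 0 < α) {y : ℝ → State} (hy : IsSol ϖ α h y) {φ₀ : ℝ}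
    (h0 : (y φ₀).2.2 = 0) (φ : ℝ) : (y φ).2.2 = 0 := by
  obtain ⟨c, hc, he⟩ := hy.radius_eq hα φ₀ φ
  rw [he, h0, zero_mul]

theorem Admissible.phaseSpeed_bounds (H : Admissible ϖ α h) :
    ∃ c > 0, ∃ C > 0, ∀ φ y, 0 < y.1 → polarEnergy ϖ α φ y = h →
      c ≤ (phaseSpeed α φ y)⁻¹ ∧ (phaseSpeed α φ y)⁻¹ ≤ C := by
  have hα := H.α_pos
  obtain ⟨M, hM, hb⟩ := H.exists_box
  obtain ⟨K, L, hKL⟩ := exists_lipschitz_polarField ϖ hα hM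
  have hM0 : 0 < M := by linarith
  refine ⟨(1 + 4 * α⁻¹ * (1 + 2 * α) * M ^ 3)⁻¹, by positivity, L + 1, by positivity,
    fun φ y hu hE => ?_⟩
  have hmem := interior_subset (hb φ y hu hE)
  constructor
  · refine inv_anti₀ (phaseSpeed_pos hα hu) ?_
    have hk : stiffness α φ y ≤ 4 * α⁻¹ * (1 + 2 * α) * M ^ 3 := by
      unfold stiffness
      have h1 := one_le_sqrt_ratioSq (φ := φ) (y := y) hα
      have h2 : 1 ≤ Real.sqrt (ratioSq α φ y) ^ 3 := one_le_pow₀ h1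
      have h3 : y.1 ≤ M := (mem_box.mp hmem).1.2
      calc _ ≤ 4 * α⁻¹ * (1 + 2 * α) * y.1 ^ 3 := div_le_self (by positivity) h2
        _ ≤ _ := by gcongr
    have hk0 := stiffness_pos (φ := φ) hα hu
    unfold phaseSpeed
    have hs : Real.sin φ ^ 2 ≤ 1 := Real.sin_sq_le_one φ
    have hc : Real.cos φ ^ 2 ≤ 1 := Real.cos_sq_le_one φ
    nlinarith
  · have h1 := (norm_snd_le _).trans ((hKL φ).2 y hmem)
    rw [Real.norm_of_nonneg (inv_pos.mpr (phaseSpeed_pos hα hu)).le] at h1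
    linarith

/-- The time as a function of the phase along a solution. -/
theorem IsSol.exists_clock (H : Admissible ϖ α h) {y : ℝ → State} (hy : IsSol ϖ α h y) (φ₀ : ℝ) :
    ∃ τ : ℝ ≃o ℝ, τ φ₀ = 0 ∧ (∀ φ, HasDerivAt τ (phaseSpeed α φ (y φ))⁻¹ φ) ∧
      ∀ t, HasDerivAt τ.symm (phaseSpeed α (τ.symm t) (y (τ.symm t))) t := by
  have hα := H.α_pos
  have hcont := hy.continuous_inv_phaseSpeed hα
  obtain ⟨c, hc, C, -, hb⟩ := H.phaseSpeed_bounds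
  set τ : ℝ → ℝ := fun φ => ∫ s in φ₀..φ, (phaseSpeed α s (y s))⁻¹
  have hτ : ∀ φ, HasDerivAt τ (phaseSpeed α φ (y φ))⁻¹ φ := fun φ =>
    intervalIntegral.integral_hasDerivAt_right (hcont.intervalIntegrable _ _)
      (hcont.stronglyMeasurableAtFilter _ _) hcont.continuousAt
  have hτc : Continuous τ := continuous_iff_continuousAt.mpr fun φ => (hτ φ).continuousAt
  have hmono : StrictMono τ := strictMono_of_deriv_pos fun φ => by
    rw [(hτ φ).deriv]; exact inv_pos.mpr (phaseSpeed_pos hα (hy φ).1)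
  have hmono2 : Monotone fun φ => τ φ - c * φ := by
    refine monotone_of_deriv_nonneg (fun φ => ?_) (fun φ => ?_)
    · exact ((hτ φ).sub ((hasDerivAt_id φ).const_mul c)).differentiableAt
    · have := ((hτ φ).sub ((hasDerivAt_id φ).const_mul c)).deriv
      have h2 := (hb φ (y φ) (hy φ).1 (hy φ).2.1).1
      calc (0 : ℝ) ≤ _ := by rw [mul_one]; exact sub_nonneg.mpr h2
        _ = _ := this.symm
  have h0 : τ φ₀ = 0 := intervalIntegral.integral_same
  have htop : Tendsto τ atTop atTop := by
    refine tendsto_atTop_mono' atTop (f₁ := fun φ => c * φ - c * φ₀) ?_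
      (tendsto_atTop_add_const_right _ _ (tendsto_id.const_mul_atTop hc))
    filter_upwards [eventually_ge_atTop φ₀] with φ hφ
    have := hmono2 hφ
    simp only [h0] at this
    linarith
  have hbot : Tendsto τ atBot atBot := by
    refine tendsto_atBot_mono' atBot (f₁ := fun φ => c * φ - c * φ₀) ?_
      (tendsto_atBot_add_const_right _ _ (tendsto_id.const_mul_atBot hc))
    filter_upwards [eventually_le_atBot φ₀] with φ hφ
    have := hmono2 hφ
    simp only [h0] at this
    linarith
  have hsurj : Function.Surjective τ := hτc.surjective htop hbot
  set e := StrictMono.orderIsoOfSurjective τ hmono hsurj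
  have he : ∀ φ, e φ = τ φ := fun φ => rfl
  refine ⟨e, h0, hτ, fun t => ?_⟩
  have := HasDerivAt.of_local_left_inverse (f := τ) (g := e.symm) (a := t)
    e.symm.continuous.continuousAt (hτ (e.symm t))
    (inv_pos.mpr (phaseSpeed_pos hα (hy _).1)).ne'
    (Eventually.of_forall fun s => e.apply_symm_apply s)
  simpa using this

theorem IsSol.isTrajectory (H : Admissible ϖ α h) {y : ℝ → State} (hy : IsSol ϖ α h y)
    {τ : ℝ ≃o ℝ} (hτ : ∀ t, HasDerivAt τ.symm (phaseSpeed α (τ.symm t) (y (τ.symm t))) t) :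
    IsTrajectory ϖ α h fun t => phys (τ.symm t) (y (τ.symm t)) := by
  intro t
  obtain ⟨h1, h2, h3⟩ := hy (τ.symm t)
  refine ⟨phys_mem_energySurface H.α_pos h1 h2, ?_⟩
  have h4 := (hasDerivAt_phys H.α_pos h1 h3).scomp t (hτ t)
  refine h4.congr_deriv ?_
  rw [smul_smul, mul_inv_cancel₀ (phaseSpeed_pos H.α_pos h1).ne', one_smul]

end clock

theorem IsTrajectory.unique {ϖ α h : ℝ} (hα : 0 < α) {x₁ x₂ : ℝ → Phase}
    (h₁ : IsTrajectory ϖ α h x₁) (h₂ : IsTrajectory ϖ α h x₂) {a b : ℝ} (hab : x₁ a = x₂ b)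
    (t : ℝ) : x₁ (a + t) = x₂ (b + t) := by
  set f : ℝ → Phase := fun t => x₁ (a + t)
  set g : ℝ → Phase := fun t => x₂ (b + t)
  have hf : ∀ t, HasDerivAt f (hamiltonianField ϖ α (f t)) t := fun t =>
    (h₁ (a + t)).2.comp_const_add a t
  have hg : ∀ t, HasDerivAt g (hamiltonianField ϖ α (g t)) t := fun t =>
    (h₂ (b + t)).2.comp_const_add b t
  have hfc : Continuous f := continuous_iff_continuousAt.mpr fun t => (hf t).continuousAt
  have hgc : Continuous g := continuous_iff_continuousAt.mpr fun t => (hg t).continuousAt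
  have hopen : IsOpen {t | f t = g t} := by
    rw [isOpen_iff_mem_nhds]
    intro t ht
    have hpos : 0 < rad (f t) := (h₁ (a + t)).1.1
    obtain ⟨K, s, hs, hL⟩ := (contDiffAt_hamiltonianField (ϖ := ϖ) hα hpos).exists_lipschitzOnWith
    refine ODE_solution_unique_of_eventually (v := fun _ => hamiltonianField ϖ α)
      (s := fun _ => s) (K := K) (Eventually.of_forall fun _ => hL) ?_ ?_ ht
    · filter_upwards [hfc.continuousAt.eventually_mem hs] with t ht using ⟨hf t, ht⟩
    · have hs' : s ∈ 𝓝 (g t) := by rwa [← show f t = g t from ht]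
      filter_upwards [hgc.continuousAt.eventually_mem hs'] with t ht using ⟨hg t, ht⟩
  have huniv := IsClopen.eq_univ ⟨isClosed_eq hfc hgc, hopen⟩ ⟨0, by simpa [f, g] using hab⟩
  exact (huniv ▸ mem_univ t : t ∈ {t | f t = g t})

/-- The orbit of a solution in phase space. -/
def orbitOf (y : ℝ → State) : Set Phase := range fun φ => phys φ (y φ)

theorem range_phys_clock (y : ℝ → State) (τ : ℝ ≃o ℝ) :
    range (fun t => phys (τ.symm t) (y (τ.symm t))) = orbitOf y :=
  τ.symm.surjective.range_comp fun φ => phys φ (y φ)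

/-- Kinetic and potential part both grow with R, and sin φ and cos φ do not vanish together, so one
of them grows strictly. This monotonicity makes (u, p) coordinates on every page. -/
theorem polarEnergy_lt {ϖ α φ : ℝ} (hα : 0 < α) {u p R R' : ℝ} (hu : 0 < u) (hR : 0 ≤ R)
    (hRR : R < R') : polarEnergy ϖ α φ (u, p, R) < polarEnergy ϖ α φ (u, p, R') := by
  have hsq : R ^ 2 < R' ^ 2 := by gcongr
  have h1 := one_le_sqrt_ratioSq (φ := φ) (y := (u, p, R)) hα
  have h2 := one_le_sqrt_ratioSq (φ := φ) (y := (u, p, R')) hα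
  have hq : ratioSq α φ (u, p, R) ≤ ratioSq α φ (u, p, R') := by
    simp only [ratioSq, mul_pow]; gcongr
  have h3 : 4 * α⁻¹ * u / Real.sqrt (ratioSq α φ (u, p, R'))
      ≤ 4 * α⁻¹ * u / Real.sqrt (ratioSq α φ (u, p, R)) := by
    gcongr
  have h4 : R ^ 2 * Real.sin φ ^ 2 ≤ R' ^ 2 * Real.sin φ ^ 2 := by gcongr
  simp only [polarEnergy, mul_pow]
  rcases eq_or_ne (Real.sin φ) 0 with hs | hs
  · have hc : 0 < Real.cos φ ^ 2 := by
      have := Real.sin_sq_add_cos_sq φ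
      rw [hs] at this; linarith
    have hq' : ratioSq α φ (u, p, R) < ratioSq α φ (u, p, R') := by
      simp only [ratioSq, mul_pow]; gcongr
    have : 4 * α⁻¹ * u / Real.sqrt (ratioSq α φ (u, p, R'))
        < 4 * α⁻¹ * u / Real.sqrt (ratioSq α φ (u, p, R)) := by
      have := Real.sqrt_lt_sqrt (zero_le_one.trans (one_le_ratioSq hα)) hq'
      gcongr
    linarith
  · have : R ^ 2 * Real.sin φ ^ 2 < R' ^ 2 * Real.sin φ ^ 2 := by gcongr
    linarith

theorem eq_of_polarEnergy_eq {ϖ α φ : ℝ} (hα : 0 < α) {y y' : State} (hu : 0 < y.1)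
    (h1 : y.1 = y'.1) (h2 : y.2.1 = y'.2.1) (hR : 0 ≤ y.2.2) (hR' : 0 ≤ y'.2.2)
    (hE : polarEnergy ϖ α φ y = polarEnergy ϖ α φ y') : y = y' := by
  obtain ⟨u, p, R⟩ := y
  obtain ⟨u', p', R'⟩ := y'
  simp only at h1 h2 hR hR' hu
  subst h1 h2
  rcases lt_trichotomy R R' with h | h | h
  · exact absurd hE (polarEnergy_lt hα hu hR h).ne
  · rw [h]
  · exact absurd hE.symm (polarEnergy_lt hα hu hR' h).ne

theorem phys_eq_phys {φ φ' : ℝ} {y y' : State} (hR : 0 < y.2.2) (hR' : 0 < y'.2.2)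
    (he : phys φ y = phys φ' y') : y = y' ∧ ∃ n : ℤ, φ' = φ + n * (2 * Real.pi) := by
  obtain ⟨u, p, R⟩ := y
  obtain ⟨u', p', R'⟩ := y'
  simp only [phys, Prod.mk.injEq, neg_inj, inv_inj] at he hR hR'
  obtain ⟨h1, h2, h3, h4⟩ := he
  have e1 := Real.sin_sq_add_cos_sq φ
  have e2 := Real.sin_sq_add_cos_sq φ'
  have hRR : R = R' := by
    refine (sq_eq_sq₀ hR.le hR'.le).mp ?_
    calc R ^ 2 = (R * Real.sin φ) ^ 2 + (R * Real.cos φ) ^ 2 := by linear_combination (-R ^ 2) * e1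
      _ = R' ^ 2 := by rw [h2, h4]; linear_combination R' ^ 2 * e2
  subst hRR h1 h3
  refine ⟨rfl, ?_⟩
  have hs := mul_left_cancel₀ hR.ne' h2
  have hc := mul_left_cancel₀ hR.ne' h4
  have : Real.cos (φ' - φ) = 1 := by rw [Real.cos_sub, ← hc, ← hs]; linarith
  obtain ⟨n, hn⟩ := (Real.cos_eq_one_iff _).mp this
  exact ⟨n, by linarith⟩

theorem footPoint_phys (φ : ℝ) (y : State) : footPoint (phys φ y) = (y.1⁻¹, y.2.2 * Real.cos φ) :=
  rfl

theorem footPoint_mem_zeroVelocityCurve_iff {ϖ α h : ℝ} {x : Phase}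
    (hx : x ∈ energySurface ϖ α h) :
    footPoint x ∈ zeroVelocityCurve ϖ α h ↔ pr x = 0 ∧ pz x = 0 := by
  obtain ⟨h1, h2⟩ := hx
  simp only [footPoint, zeroVelocityCurve, mem_ofPred_eq, h1, true_and]
  unfold hamiltonian at h2
  constructor
  · intro h3
    have h4 : pr x ^ 2 + pz x ^ 2 = 0 := by linarith
    constructor
    · nlinarith [sq_nonneg (pr x), sq_nonneg (pz x)]
    · nlinarith [sq_nonneg (pr x), sq_nonneg (pz x)]
  · rintro ⟨h3, h4⟩
    rw [h3, h4] at h2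
    linarith

theorem footPoint_phys_mem_iff {ϖ α h φ : ℝ} (hα : 0 < α) {y : State} (hu : 0 < y.1)
    (hE : polarEnergy ϖ α φ y = h) (hR : 0 < y.2.2) :
    footPoint (phys φ y) ∈ zeroVelocityCurve ϖ α h ↔
      y.2.1 = 0 ∧ ∃ n : ℤ, φ = n * Real.pi := by
  rw [footPoint_mem_zeroVelocityCurve_iff (phys_mem_energySurface hα hu hE)]
  simp only [phys, pr, pz, neg_eq_zero, mul_eq_zero, hR.ne', false_or]
  rw [Real.sin_eq_zero_iff]
  simp only [eq_comm]

/-! ### Reversing symmetries and periodicity -/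

section symmetry
variable {ϖ α h : ℝ}

theorem flip_eq_self {y : State} (hy : y.2.1 = 0) : flip y = y := by
  obtain ⟨u, p, R⟩ := y
  simp only at hy
  simp [flip, hy]

theorem flip_flip (y : State) : flip (flip y) = y := by simp [flip]

/-- The phase kπ/2 is fixed by φ ↦ kπ - φ, and p = 0 is fixed by the flip, so the solution and its
reversal agree there and uniqueness applies. -/
theorem IsSol.reflect_eq (H : Admissible ϖ α h) {y : ℝ → State} (hy : IsSol ϖ α h y) {k : ℤ}
    (hk : (y (k * (Real.pi / 2))).2.1 = 0) (φ : ℝ) : y (k * Real.pi - φ) = flip (y φ) := by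
  have h1 := (hy.reflect k).unique H hy (φ₀ := k * (Real.pi / 2)) (by
    rw [show k * Real.pi - k * (Real.pi / 2) = k * (Real.pi / 2) by ring, flip_eq_self hk])
  have h2 := congrFun h1 φ
  rw [← h2, flip_flip]

theorem IsSol.shift_eq (H : Admissible ϖ α h) {y : ℝ → State} (hy : IsSol ϖ α h y) {k : ℤ}
    {c : ℝ} (hk : y (c + k * Real.pi) = y c) (φ : ℝ) : y (φ + k * Real.pi) = y φ :=
  congrFun ((hy.shift k).unique H hy (φ₀ := c) hk) φ

/-- The composition of the reflections about kπ/2 and lπ/2 is the translation by (l - k)π. -/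
theorem IsSol.shift_two_eq (H : Admissible ϖ α h) {y : ℝ → State} (hy : IsSol ϖ α h y) {k l : ℤ}
    (hk : (y (k * (Real.pi / 2))).2.1 = 0) (hl : (y (l * (Real.pi / 2))).2.1 = 0) (φ : ℝ) :
    y (φ + (l - k : ℤ) * Real.pi) = y φ := by
  have h1 := hy.reflect_eq H hk φ
  have h2 := hy.reflect_eq H hl (k * Real.pi - φ)
  rw [h1, flip_flip] at h2
  rw [← h2]
  congr 1
  push_cast
  ring

end symmetry
-- From the given brake orbit to a reference solution
/-- The solution with phase as time that underlies a `z`-symmetric simple brake orbit. -/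
structure IsReference (ϖ α h : ℝ) (y : ℝ → State) : Prop where
  isSol : IsSol ϖ α h y
  radius_pos : ∀ φ, 0 < (y φ).2.2
  shift : ∀ φ, y (φ + Real.pi) = y φ
  reflect : ∀ φ, y (-φ) = flip (y φ)

theorem cos_int_mul_pi_eq (n : ℤ) : Real.cos (n * Real.pi) = if Even n then 1 else -1 := by
  rw [Real.cos_int_mul_pi]
  split_ifs with h
  · exact h.neg_one_zpow
  · exact (Int.not_even_iff_odd.mp h).neg_one_zpow

theorem IsReference.shift_int {ϖ α h : ℝ} {y : ℝ → State} (hy : IsReference ϖ α h y) (k : ℤ)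
    (φ : ℝ) : y (φ + k * Real.pi) = y φ := by
  have hp : Function.Periodic y Real.pi := hy.shift
  simpa using hp.int_mul k φ

theorem IsReference.momentum_eq_zero {ϖ α h : ℝ} {y : ℝ → State} (hy : IsReference ϖ α h y)
    (k : ℤ) : (y (k * (Real.pi / 2))).2.1 = 0 := by
  have h1 := hy.reflect (k * (Real.pi / 2))
  have h2 := hy.shift_int k (-(k * (Real.pi / 2)))
  rw [h1, show -(k * (Real.pi / 2)) + k * Real.pi = k * (Real.pi / 2) by ring] at h2
  have h3 := congrArg (fun z : State => z.2.1) h2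
  simp only [flip] at h3
  linarith

/-- A trajectory through a brake point off the Euler orbit is the orbit of a solution which starts
with momentum zero at phase `0` or `π`. -/
theorem exists_sol_of_brake {ϖ α h : ℝ} (H : Admissible ϖ α h) {x : ℝ → Phase} {a : ℝ}
    (hx : IsTrajectory ϖ α h x) (hbr : footPoint (x a) ∈ zeroVelocityCurve ϖ α h)
    (hne : x a ∉ eulerOrbit ϖ α h) :
    ∃ (m : ℤ) (y : ℝ → State) (τ : ℝ ≃o ℝ), IsSol ϖ α h y ∧ (∀ φ, 0 < (y φ).2.2) ∧
      (y (m * Real.pi)).2.1 = 0 ∧ τ (m * Real.pi) = 0 ∧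
      (∀ φ, HasDerivAt τ (phaseSpeed α φ (y φ))⁻¹ φ) ∧
      ∀ t, x (a + t) = phys (τ.symm t) (y (τ.symm t)) := by
  have hα := H.α_pos
  have hmem := (hx a).1
  obtain ⟨hp, hq⟩ := (footPoint_mem_zeroVelocityCurve_iff hmem).mp hbr
  have hz : height (x a) ≠ 0 := fun hz => hne ⟨hmem, hq, hz⟩
  obtain ⟨m, hm⟩ : ∃ m : ℤ, |height (x a)| * Real.cos (m * Real.pi) = height (x a) := by
    rcases hz.lt_or_gt with h | h
    · exact ⟨1, by simp [abs_of_neg h]⟩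
    · exact ⟨0, by simp [abs_of_pos h]⟩
  set y₀ : State := ((rad (x a))⁻¹, 0, |height (x a)|) with hy₀
  have hu : 0 < y₀.1 := inv_pos.mpr hmem.1
  have hphys : phys (m * Real.pi) y₀ = x a := by
    have : x a = (pr (x a), pz (x a), rad (x a), height (x a)) := rfl
    rw [this, hp, hq]
    simp [phys, hy₀, hm, Real.sin_int_mul_pi]
  have hE : polarEnergy ϖ α (m * Real.pi) y₀ = h := by
    rw [← hamiltonian_phys hα hu, hphys]; exact hmem.2
  obtain ⟨y, hy, hy0⟩ := H.exists_sol hu hE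
  obtain ⟨τ, hτ0, hτ1, hτ2⟩ := hy.exists_clock H (m * Real.pi)
  have hRp : 0 < (y (m * Real.pi)).2.2 := by rw [hy0]; exact abs_pos.mpr hz
  refine ⟨m, y, τ, hy, hy.radius_pos hα hRp, by rw [hy0], hτ0, hτ1, fun t => ?_⟩
  have htr := hy.isTrajectory H hτ2
  have hsy : τ.symm 0 = m * Real.pi := by rw [← hτ0, τ.symm_apply_apply]
  have := hx.unique hα htr (a := a) (b := 0) (by rw [hsy, hy0, hphys]) t
  simpa using this

/-- Let mπ and (m + k)π be consecutive brake phases. Reflections about them generate all brake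
phases. Mirror symmetry of the projection produces a brake phase of opposite parity with the same
state, which forces period kπ; a value k > 1 would make the projection cross itself on z = 0. So k =
1. -/
theorem exists_reference {ϖ α h : ℝ} (H : Admissible ϖ α h) {ζ : Set Phase}
    (hsub : ζ ⊆ energySurface ϖ α h \ eulerOrbit ϖ α h) (hsymm : IsZSymmetric ζ)
    (hsimple : IsSimpleBrakeOrbit ϖ α h ζ) :
    ∃ y, IsReference ϖ α h y ∧ orbitOf y = ζ := by
  have hα := H.α_pos
  obtain ⟨-, x, a, b, ⟨hx, hrange, hab, hfa, hfb, hint⟩, hinj⟩ := hsimple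
  have hpi := Real.pi_pos
  obtain ⟨m, y, τ, hy, hR, hpm, hτ0, -, hxy⟩ :=
    exists_sol_of_brake H hx hfa (hsub (hrange ▸ mem_range_self a)).2
  have horb : orbitOf y = ζ := by
    rw [← range_phys_clock y τ, ← hrange]
    ext w
    constructor
    · rintro ⟨t, rfl⟩
      exact ⟨a + t, hxy t⟩
    · rintro ⟨t, rfl⟩
      exact ⟨t - a, by simp only [← hxy, add_sub_cancel]⟩
  have hxφ : ∀ φ, x (a + τ φ) = phys φ (y φ) := fun φ => by rw [hxy, τ.symm_apply_apply]
  have hbrake : ∀ φ, footPoint (phys φ (y φ)) ∈ zeroVelocityCurve ϖ α h ↔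
      (y φ).2.1 = 0 ∧ ∃ n : ℤ, φ = n * Real.pi := fun φ =>
    footPoint_phys_mem_iff hα (hy φ).1 (hy φ).2.1 (hR φ)
  -- the phase at the second brake point
  obtain ⟨k, hk0, hτk, hpk⟩ : ∃ k : ℤ, 0 < k ∧ τ ((m + k : ℤ) * Real.pi) = b - a ∧
      (y ((m + k : ℤ) * Real.pi)).2.1 = 0 := by
    have h1 := hxφ (τ.symm (b - a))
    rw [τ.apply_symm_apply, add_sub_cancel] at h1
    rw [h1, hbrake] at hfb
    obtain ⟨h2, n, hn⟩ := hfb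
    have h3 : (m : ℝ) * Real.pi < n * Real.pi := by
      rw [← hn, ← τ.lt_iff_lt, hτ0, τ.apply_symm_apply]; linarith
    have h4 : m < n := by exact_mod_cast lt_of_mul_lt_mul_right h3 hpi.le
    refine ⟨n - m, by omega, ?_, ?_⟩
    · rw [add_sub_cancel, ← hn, τ.apply_symm_apply]
    · rw [add_sub_cancel, ← hn]; exact h2
  have hnone : ∀ i : ℤ, 0 < i → i < k → (y ((m + i : ℤ) * Real.pi)).2.1 ≠ 0 := by
    intro i hi hik hp
    have h1 : (m : ℝ) * Real.pi < (m + i : ℤ) * Real.pi := by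
      gcongr; omega
    have h2 : ((m + i : ℤ) : ℝ) * Real.pi < (m + k : ℤ) * Real.pi := by
      gcongr
    have h3 := τ.lt_iff_lt.mpr h1
    have h4 := τ.lt_iff_lt.mpr h2
    rw [hτ0] at h3
    rw [hτk] at h4
    refine hint (a + τ ((m + i : ℤ) * Real.pi)) ⟨by linarith, by linarith⟩ ?_
    rw [hxφ, hbrake]
    exact ⟨hp, _, rfl⟩
  -- reflections at the two brake points
  have hrm : ∀ φ, y ((2 * m : ℤ) * Real.pi - φ) = flip (y φ) := by
    apply hy.reflect_eq H
    rw [← hpm]; congr 3; push_cast; ring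
  have hper : ∀ φ, y (φ + (2 * k : ℤ) * Real.pi) = y φ := by
    intro φ
    have := hy.shift_two_eq H (k := 2 * m) (l := 2 * (m + k))
      (by rw [← hpm]; congr 3; push_cast; ring) (by rw [← hpk]; congr 3; push_cast; ring) φ
    rw [← this]; congr 2; push_cast; ring
  have hper' : ∀ (n : ℤ) φ, y (φ + n * ((2 * k : ℤ) * Real.pi)) = y φ := by
    intro n φ
    have hp : Function.Periodic y ((2 * k : ℤ) * Real.pi) := hper
    exact hp.int_mul n φ
  -- Modulo the period 2k only the residues 0 and k can be brake phases: residues below k are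
  -- excluded by consecutiveness, and those above k are reflected below k.
  have hdvd : ∀ l : ℤ, (y ((m + l : ℤ) * Real.pi)).2.1 = 0 → l % (2 * k) = 0 ∨ l % (2 * k) = k := by
    intro l hl
    have h0 : 0 ≤ l % (2 * k) := Int.emod_nonneg _ (by omega)
    have h1 : l % (2 * k) < 2 * k := Int.emod_lt_of_pos _ (by omega)
    have h2 : (y ((m + l % (2 * k) : ℤ) * Real.pi)).2.1 = 0 := by
      rw [← hl, ← hper' (l / (2 * k)) ((m + l % (2 * k) : ℤ) * Real.pi)]
      congr 3
      have := Int.emod_add_mul_ediv l (2 * k)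
      have h3 : ((m + l : ℤ) : ℝ) = (m + l % (2 * k) + l / (2 * k) * (2 * k) : ℤ) := by
        congr 1; linarith
      rw [h3]; push_cast; ring
    by_contra! hcon
    rcases lt_or_gt_of_ne hcon.2 with hlt | hgt
    · exact hnone _ (by omega) hlt h2
    · refine hnone (2 * k - l % (2 * k)) (by omega) (by omega) ?_
      have h3 := hrm ((m + l % (2 * k) : ℤ) * Real.pi)
      have h4 := hper ((2 * m : ℤ) * Real.pi - (m + l % (2 * k) : ℤ) * Real.pi)
      rw [h3] at h4
      have h5 : (2 * m : ℤ) * Real.pi - (m + l % (2 * k) : ℤ) * Real.pi + (2 * k : ℤ) * Real.pi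
        = (m + (2 * k - l % (2 * k)) : ℤ) * Real.pi := by push_cast; ring
      rw [← h5, h4]
      exact neg_eq_zero.mpr h2
  -- the mirror image of the first brake point
  have hmirror : ∃ l : ℤ, (y ((m + l : ℤ) * Real.pi)) = y (m * Real.pi) ∧ Odd l ∧
      (l % (2 * k) = 0 ∨ l % (2 * k) = k) := by
    have h1 : footPoint (phys (m * Real.pi) (y (m * Real.pi))) ∈ footPoint '' ζ := by
      rw [← horb]; exact mem_image_of_mem _ (mem_range_self _)
    have h2 : ((y (m * Real.pi)).1⁻¹, -((y (m * Real.pi)).2.2 * Real.cos (m * Real.pi)))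
        ∈ footPoint '' ζ := by
      rw [← hsymm]; exact ⟨_, h1, rfl⟩
    rw [← horb] at h2
    obtain ⟨_, ⟨φ, rfl⟩, hφ⟩ := h2
    have h3 : footPoint (phys φ (y φ)) ∈ zeroVelocityCurve ϖ α h := by
      dsimp only at hφ
      rw [hφ]
      have h4 := (hbrake (m * Real.pi)).mpr ⟨hpm, m, rfl⟩
      rw [footPoint_phys] at h4
      obtain ⟨h5, h6⟩ := h4
      refine ⟨h5, ?_⟩
      rw [← h6]
      simp [potential]
    obtain ⟨h4, n, hn⟩ := (hbrake φ).mp h3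
    subst hn
    obtain ⟨h5, h6⟩ := Prod.mk.inj hφ
    have hu := inv_inj.mp h5
    refine ⟨n - m, ?_⟩
    rw [add_sub_cancel]
    have hc1 := cos_int_mul_pi_eq m
    have hc2 := cos_int_mul_pi_eq n
    have hR1 := hR (n * Real.pi)
    have hR2 := hR (m * Real.pi)
    have hRe : (y (n * Real.pi)).2.2 = (y (m * Real.pi)).2.2 ∧ Odd (n - m) := by
      simp only [phys, height] at h6
      rw [hc1, hc2] at h6
      rw [Int.odd_sub]
      split_ifs at h6 with he1 he2 he2
      · linarith
      · exact ⟨by linarith, by simp [he1, he2, ← Int.not_even_iff_odd]⟩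
      · exact ⟨by linarith, by simp [he1, he2, ← Int.not_even_iff_odd]⟩
      · linarith
    refine ⟨?_, hRe.2, hdvd _ (by rw [add_sub_cancel]; exact h4)⟩
    exact Prod.ext hu (Prod.ext (h4.trans hpm.symm) hRe.1)
  obtain ⟨l, hl1, hl2, hl3⟩ := hmirror
  -- A multiple of 2k is even, whereas l is odd.
  have hlk : l % (2 * k) = k := by
    rcases hl3 with h0 | h0
    · obtain ⟨c, hc⟩ := Int.dvd_of_emod_eq_zero h0
      exact absurd hl2 (by rw [hc, Int.not_odd_iff_even]; exact ⟨k * c, by ring⟩)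
    · exact h0
  have hperk : ∀ φ, y (φ + k * Real.pi) = y φ := by
    refine hy.shift_eq H (c := m * Real.pi) ?_
    rw [← hl1, ← hper' (l / (2 * k)) (m * Real.pi + k * Real.pi)]
    congr 1
    have := Int.emod_add_mul_ediv l (2 * k)
    rw [hlk] at this
    have h3 : ((m + l : ℤ) : ℝ) = (m + k + l / (2 * k) * (2 * k) : ℤ) := by
      congr 1; linarith
    rw [h3]; push_cast; ring
  -- If k ≥ 2, the quarter-turn phases just after the first and just before the second brake point
  -- are distinct. Both have z = 0, and reflection together with the period kπ gives them the same
  -- r, so the projected arc is not injective.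
  have hk1 : k = 1 := by
    by_contra hne
    have hk2 : (2 : ℝ) ≤ k := by exact_mod_cast (show (2 : ℤ) ≤ k by omega)
    set φ₁ := (m : ℝ) * Real.pi + Real.pi / 2 with hφ₁
    set φ₂ := (m : ℝ) * Real.pi + k * Real.pi - Real.pi / 2 with hφ₂
    have h12 : φ₁ < φ₂ := by nlinarith
    have e2 : y φ₂ = flip (y φ₁) := by
      rw [← hrm φ₁, ← hperk ((2 * m : ℤ) * Real.pi - φ₁)]
      congr 1
      push_cast; ring
    have hc1 : Real.cos φ₁ = 0 := by
      rw [hφ₁, Real.cos_add_pi_div_two, Real.sin_int_mul_pi, neg_zero]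
    have hc2 : Real.cos φ₂ = 0 := by
      rw [hφ₂, show (m : ℝ) * Real.pi + k * Real.pi - Real.pi / 2 =
        ((m + k : ℤ) : ℝ) * Real.pi - Real.pi / 2 by push_cast; ring, Real.cos_sub_pi_div_two,
        Real.sin_int_mul_pi]
    have hmemI : ∀ φ, (m : ℝ) * Real.pi ≤ φ → φ ≤ m * Real.pi + k * Real.pi →
        a + τ φ ∈ Icc a b := by
      intro φ h1 h2
      have h3 := τ.monotone h1
      have h4 := τ.monotone h2
      rw [hτ0] at h3
      rw [show (m : ℝ) * Real.pi + k * Real.pi = ((m + k : ℤ) : ℝ) * Real.pi by push_cast; ring,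
        hτk] at h4
      exact ⟨by linarith, by linarith⟩
    have h5 : a + τ φ₁ = a + τ φ₂ := by
      refine hinj (hmemI φ₁ (by linarith) (by nlinarith)) (hmemI φ₂ (by nlinarith) (by linarith)) ?_
      simp only [hxφ, footPoint_phys, e2, hc1, hc2]
      simp [flip]
    exact h12.ne (τ.injective (by linarith))
  subst hk1
  have hshift : ∀ φ, y (φ + Real.pi) = y φ := fun φ => by simpa using hperk φ
  refine ⟨y, ⟨hy, hR, hshift, fun φ => ?_⟩, horb⟩
  rw [← hrm φ]
  have hp : Function.Periodic y Real.pi := hshift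
  have := hp.int_mul (2 * m) (-φ)
  rw [← this]
  congr 1
  push_cast; ring

/-! ### The angle by which one solution turns around another on the pages -/

/-- Turned back by θ, both components of the curve solve the same equation f' = l f. The second
starts at zero and stays zero, and the first stays positive. The explicit integral is what later
gives continuous dependence of the argument on the solution. -/
theorem isArgOn_integral {f₁ f₂ d₁ d₂ : ℝ → ℝ} (hf₁ : ∀ t, HasDerivAt f₁ (d₁ t) t)
    (hf₂ : ∀ t, HasDerivAt f₂ (d₂ t) t) (hd₁ : Continuous d₁) (hd₂ : Continuous d₂)
    (hne : ∀ t, f₁ t ^ 2 + f₂ t ^ 2 ≠ 0) {t₀ : ℝ} (h₁ : 0 < f₁ t₀) (h₂ : f₂ t₀ = 0) :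
    IsArgOn f₁ f₂ (fun t => ∫ s in t₀..t, (f₁ s * d₂ s - f₂ s * d₁ s) / (f₁ s ^ 2 + f₂ s ^ 2))
      univ := by
  have hc₁ : Continuous f₁ := continuous_iff_continuousAt.mpr fun t => (hf₁ t).continuousAt
  have hc₂ : Continuous f₂ := continuous_iff_continuousAt.mpr fun t => (hf₂ t).continuousAt
  set q : ℝ → ℝ := fun s => (f₁ s * d₂ s - f₂ s * d₁ s) / (f₁ s ^ 2 + f₂ s ^ 2) with hq
  set l : ℝ → ℝ := fun s => (f₁ s * d₁ s + f₂ s * d₂ s) / (f₁ s ^ 2 + f₂ s ^ 2) with hl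
  have hqc : Continuous q := Continuous.div (by fun_prop) (by fun_prop) hne
  have hlc : Continuous l := Continuous.div (by fun_prop) (by fun_prop) hne
  set θ : ℝ → ℝ := fun t => ∫ s in t₀..t, q s with hθ
  have hθd : ∀ t, HasDerivAt θ (q t) t := fun t =>
    intervalIntegral.integral_hasDerivAt_right (hqc.intervalIntegrable _ _)
      (hqc.stronglyMeasurableAtFilter _ _) hqc.continuousAt
  have hθ0 : θ t₀ = 0 := intervalIntegral.integral_same
  have hA : ∀ t, HasDerivAt (fun t => f₁ t * Real.cos (θ t) + f₂ t * Real.sin (θ t))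
      (l t * (f₁ t * Real.cos (θ t) + f₂ t * Real.sin (θ t))) t := by
    intro t
    refine (((hf₁ t).mul (hθd t).cos).add ((hf₂ t).mul (hθd t).sin)).congr_deriv ?_
    have := hne t
    simp only [hq, hl]
    field_simp
    ring
  have hB : ∀ t, HasDerivAt (fun t => f₂ t * Real.cos (θ t) - f₁ t * Real.sin (θ t))
      (l t * (f₂ t * Real.cos (θ t) - f₁ t * Real.sin (θ t))) t := by
    intro t
    refine (((hf₂ t).mul (hθd t).cos).sub ((hf₁ t).mul (hθd t).sin)).congr_deriv ?_
    have := hne t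
    simp only [hq, hl]
    field_simp
    ring
  refine ⟨(continuous_iff_continuousAt.mpr fun t => (hθd t).continuousAt).continuousOn,
    fun t _ => ⟨f₁ t * Real.cos (θ t) + f₂ t * Real.sin (θ t), ?_, ?_, ?_⟩⟩
  · have := eq_mul_exp_of_hasDerivAt_mul hlc hA t₀ t
    simp only [hθ0, Real.cos_zero, Real.sin_zero, mul_one, mul_zero, add_zero] at this
    rw [this]
    have := Real.exp_pos (∫ s in t₀..t, l s)
    positivity
  all_goals
    have := eq_mul_exp_of_hasDerivAt_mul hlc hB t₀ t
    simp only [hθ0, Real.cos_zero, Real.sin_zero, h₂, mul_zero, zero_mul, sub_zero] at this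
    have hcs := Real.sin_sq_add_cos_sq (θ t)
  · linear_combination (-Real.sin (θ t)) * this + (-f₁ t) * hcs
  · linear_combination (Real.cos (θ t)) * this + (-f₂ t) * hcs

section initial
variable {ϖ α h : ℝ}

/-- On the pages of phase `0` and `π / 2`, the coordinate `R` as a function of `(u, p)`. -/
theorem Admissible.exists_initialRadius (H : Admissible ϖ α h) {c : ℤ} (hc : c = 0 ∨ c = 1) :
    ∃ ρ : ℝ × ℝ → ℝ,
      (∀ q : ℝ × ℝ, 0 < q.1 → (ϖ * q.1 - centre ϖ α) ^ 2 + q.2 ^ 2 ≤ discRadius ϖ α h ^ 2 →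
        0 ≤ ρ q ∧ polarEnergy ϖ α (c * (Real.pi / 2)) (q.1, q.2, ρ q) = h) ∧
      (∀ q : ℝ × ℝ, 0 < q.1 → ContinuousAt ρ q) ∧
      (∀ q : ℝ × ℝ, 0 < q.1 → (ϖ * q.1 - centre ϖ α) ^ 2 + q.2 ^ 2 < discRadius ϖ α h ^ 2 →
        DifferentiableAt ℝ ρ q) := by
  have hϖ := H.ϖ_pos
  have hα := H.α_pos
  have hsq := H.discRadius_sq
  rcases hc with rfl | rfl
  -- At phase 0 the energy equation reads 4u/α = m √(1 + (1 + 2α)u²R²). Its solution is R² = ν, and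
  -- m > 0 follows from ϖ²|h| > 1/2. On the disc ν ≥ 0, with strict inequality inside, where the
  -- square root is differentiable.
  · set m : ℝ × ℝ → ℝ := fun q => q.2 ^ 2 / 2 + ϖ ^ 2 * q.1 ^ 2 / 2 - q.1 - h with hm
    have hmpos : ∀ q, 0 < m q := by
      intro q
      have hδ : 0 < -h - 1 / (2 * ϖ ^ 2) := by
        rw [sub_pos, div_lt_iff₀ (by positivity)]
        linarith [H.low]
      have e : ϖ ^ 2 * q.1 ^ 2 / 2 - q.1 + 1 / (2 * ϖ ^ 2) = (ϖ * q.1 - 1 / ϖ) ^ 2 / 2 := by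
        field_simp; ring
      have := sq_nonneg (ϖ * q.1 - 1 / ϖ)
      have := sq_nonneg q.2
      simp only [hm]
      linarith
    have hkm : ∀ q : ℝ × ℝ, 4 * α⁻¹ * q.1 - m q =
        (discRadius ϖ α h ^ 2 - ((ϖ * q.1 - centre ϖ α) ^ 2 + q.2 ^ 2)) / 2 := by
      intro q
      rw [hsq]
      simp only [hm, centre]
      field_simp
      ring
    set ν : ℝ × ℝ → ℝ := fun q => ((4 * α⁻¹ * q.1 / m q) ^ 2 - 1) / ((1 + 2 * α) * q.1 ^ 2) with hν
    have hνc : ∀ q : ℝ × ℝ, 0 < q.1 → DifferentiableAt ℝ ν q := by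
      intro q hq
      have h1 : m q ≠ 0 := (hmpos q).ne'
      have h2 : (1 + 2 * α) * q.1 ^ 2 ≠ 0 := by positivity
      have h3 : DifferentiableAt ℝ m q := by simp only [hm]; fun_prop
      simp only [hν]
      fun_prop (disch := assumption)
    refine ⟨fun q => Real.sqrt (ν q), fun q hq hd => ⟨Real.sqrt_nonneg _, ?_⟩,
      fun q hq => (hνc q hq).continuousAt.sqrt, fun q hq hd => (hνc q hq).sqrt ?_⟩
    · have hmq := hmpos q
      have h1 : 1 ≤ 4 * α⁻¹ * q.1 / m q := by
        rw [le_div_iff₀ hmq]; linarith [hkm q]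
      have hν0 : 0 ≤ ν q := by
        have : 0 ≤ (4 * α⁻¹ * q.1 / m q) ^ 2 - 1 := by nlinarith
        simp only [hν]
        positivity
      have hr : ratioSq α ((0 : ℤ) * (Real.pi / 2)) (q.1, q.2, Real.sqrt (ν q)) =
          (4 * α⁻¹ * q.1 / m q) ^ 2 := by
        simp only [ratioSq, Int.cast_zero, zero_mul, Real.cos_zero, mul_one, mul_pow,
          Real.sq_sqrt hν0]
        simp only [hν]
        field_simp
        ring
      have hs : Real.sqrt (ratioSq α ((0 : ℤ) * (Real.pi / 2)) (q.1, q.2, Real.sqrt (ν q))) =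
          4 * α⁻¹ * q.1 / m q := by
        rw [hr, Real.sqrt_sq (by linarith)]
      simp only [polarEnergy, hs]
      have h2 : 4 * α⁻¹ * q.1 / (4 * α⁻¹ * q.1 / m q) = m q := by
        field_simp
      rw [h2]
      simp [hm]
    · have hmq := hmpos q
      have h1 : 1 < 4 * α⁻¹ * q.1 / m q := by
        rw [lt_div_iff₀ hmq]; linarith [hkm q]
      have : 0 < (4 * α⁻¹ * q.1 / m q) ^ 2 - 1 := by nlinarith
      have : 0 < ν q := by simp only [hν]; positivity
      exact this.ne'
  · set ν : ℝ × ℝ → ℝ := fun q =>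
      discRadius ϖ α h ^ 2 - ((ϖ * q.1 - centre ϖ α) ^ 2 + q.2 ^ 2) with hν
    have hνc : Differentiable ℝ ν := by simp only [hν]; fun_prop
    refine ⟨fun q => Real.sqrt (ν q), fun q hq hd => ⟨Real.sqrt_nonneg _, ?_⟩,
      fun q hq => (hνc q).continuousAt.sqrt, fun q hq hd => (hνc q).sqrt ?_⟩
    · have hν0 : 0 ≤ ν q := by simp only [hν]; linarith
      have h2 := two_mul_polarEnergy (α := α) (φ := (1 : ℤ) * (Real.pi / 2))
        (y := (q.1, q.2, Real.sqrt (ν q))) hϖ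
      have h3 : ratioSq α ((1 : ℤ) * (Real.pi / 2)) (q.1, q.2, Real.sqrt (ν q)) = 1 := by
        simp [ratioSq]
      rw [h3] at h2
      simp only [Int.cast_one, one_mul, Real.sin_pi_div_two, mul_one, Real.sq_sqrt hν0,
        Real.sqrt_one] at h2
      simp only [hν, Int.cast_one, one_mul] at h2 ⊢
      rw [hsq] at h2 ⊢
      linarith
    · have : 0 < ν q := by simp only [hν]; linarith
      exact this.ne'

end initial

/-- The first component of the position of `y` relative to `z`, on the page of phase `φ`. -/
noncomputable def pageOne (z y : ℝ → State) (φ : ℝ) : ℝ := (z φ).1⁻¹ - (y φ).1⁻¹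

/-- The second component of the position of `y` relative to `z`, on the page of phase `φ`. -/
noncomputable def pageTwo (z y : ℝ → State) (φ : ℝ) : ℝ := (y φ).2.1 - (z φ).2.1

section page
variable {ϖ α h : ℝ} {y z : ℝ → State}

/-- On a page (u, p) determines the point of the energy surface, so two solutions that meet there
coincide. -/
theorem IsSol.page_ne_zero (H : Admissible ϖ α h) (hz : IsSol ϖ α h z) (hy : IsSol ϖ α h y)
    (hzR : ∀ φ, 0 ≤ (z φ).2.2) (hyR : ∀ φ, 0 ≤ (y φ).2.2) (hne : y ≠ z) (φ : ℝ) :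
    pageOne z y φ ^ 2 + pageTwo z y φ ^ 2 ≠ 0 := by
  intro h0
  have h1 : pageOne z y φ = 0 := by
    nlinarith [sq_nonneg (pageOne z y φ), sq_nonneg (pageTwo z y φ)]
  have h2 : pageTwo z y φ = 0 := by
    nlinarith [sq_nonneg (pageOne z y φ), sq_nonneg (pageTwo z y φ)]
  unfold pageOne at h1
  unfold pageTwo at h2
  have h3 : (y φ).1 = (z φ).1 := inv_inj.mp (by linarith)
  refine hne (hy.unique H hz (φ₀ := φ) ?_)
  exact eq_of_polarEnergy_eq H.α_pos (hy φ).1 h3 (by linarith) (hyR φ) (hzR φ)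
    ((hy φ).2.1.trans (hz φ).2.1.symm)

/-- The derivative of `pageOne`. -/
noncomputable def pageOneDeriv (ϖ α φ : ℝ) (z y : State) : ℝ :=
  (polarField ϖ α φ y).1 / y.1 ^ 2 - (polarField ϖ α φ z).1 / z.1 ^ 2

/-- The derivative of `pageTwo`. -/
noncomputable def pageTwoDeriv (ϖ α φ : ℝ) (z y : State) : ℝ :=
  (polarField ϖ α φ y).2.1 - (polarField ϖ α φ z).2.1

theorem IsSol.hasDerivAt_pageOne (hz : IsSol ϖ α h z) (hy : IsSol ϖ α h y) (φ : ℝ) :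
    HasDerivAt (pageOne z y) (pageOneDeriv ϖ α φ (z φ) (y φ)) φ := by
  have h1 : HasDerivAt (fun φ => (z φ).1) _ φ := (hz φ).2.2.fst
  have h2 : HasDerivAt (fun φ => (y φ).1) _ φ := (hy φ).2.2.fst
  refine ((h1.inv (hz φ).1.ne').sub (h2.inv (hy φ).1.ne')).congr_deriv ?_
  simp only [pageOneDeriv]
  ring

theorem IsSol.hasDerivAt_pageTwo (hz : IsSol ϖ α h z) (hy : IsSol ϖ α h y) (φ : ℝ) :
    HasDerivAt (pageTwo z y) (pageTwoDeriv ϖ α φ (z φ) (y φ)) φ := by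
  have h1 : HasDerivAt (fun φ => (z φ).2.1) _ φ := (hz φ).2.2.snd.fst
  have h2 : HasDerivAt (fun φ => (y φ).2.1) _ φ := (hy φ).2.2.snd.fst
  exact h2.sub h1

theorem continuousAt_pageDeriv {X : Type*} [TopologicalSpace X] (hα : 0 < α) {f : X → ℝ}
    {g k : X → State} {x : X} (hf : ContinuousAt f x) (hg : ContinuousAt g x)
    (hk : ContinuousAt k x) (hg0 : 0 < (g x).1) (hk0 : 0 < (k x).1) :
    ContinuousAt (fun x => pageOneDeriv ϖ α (f x) (g x) (k x)) x ∧
      ContinuousAt (fun x => pageTwoDeriv ϖ α (f x) (g x) (k x)) x := by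
  have h1 : ContinuousAt (fun x => polarField ϖ α (f x) (g x)) x :=
    ContinuousAt.comp (f := fun x => (f x, g x)) (continuousAt_polarField hα hg0) (hf.prodMk hg)
  have h2 : ContinuousAt (fun x => polarField ϖ α (f x) (k x)) x :=
    ContinuousAt.comp (f := fun x => (f x, k x)) (continuousAt_polarField hα hk0) (hf.prodMk hk)
  have h3 : (g x).1 ^ 2 ≠ 0 := by positivity
  have h4 : (k x).1 ^ 2 ≠ 0 := by positivity
  exact ⟨(h2.fst.div (hk.fst.pow 2) h4).sub (h1.fst.div (hg.fst.pow 2) h3),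
    h2.snd.fst.sub h1.snd.fst⟩

/-- The derivative of the argument of `(pageOne, pageTwo)`. -/
noncomputable def pageArgDeriv (ϖ α φ : ℝ) (z y : State) : ℝ :=
  ((z.1⁻¹ - y.1⁻¹) * pageTwoDeriv ϖ α φ z y - (y.2.1 - z.2.1) * pageOneDeriv ϖ α φ z y) /
    ((z.1⁻¹ - y.1⁻¹) ^ 2 + (y.2.1 - z.2.1) ^ 2)

/-- The argument of `(pageOne, pageTwo)` that vanishes at `φ₀`. -/
noncomputable def pageArg (ϖ α φ₀ : ℝ) (z y : ℝ → State) (φ : ℝ) : ℝ :=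
  ∫ s in φ₀..φ, pageArgDeriv ϖ α s (z s) (y s)

theorem pageArg_self (ϖ α φ₀ : ℝ) (z y : ℝ → State) : pageArg ϖ α φ₀ z y φ₀ = 0 :=
  intervalIntegral.integral_same

theorem isArgOn_pageArg (H : Admissible ϖ α h) (hz : IsSol ϖ α h z) (hy : IsSol ϖ α h y)
    (hzR : ∀ φ, 0 ≤ (z φ).2.2) (hyR : ∀ φ, 0 ≤ (y φ).2.2) {φ₀ : ℝ} (h₁ : (z φ₀).1 < (y φ₀).1)
    (h₂ : (y φ₀).2.1 = (z φ₀).2.1) :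
    IsArgOn (pageOne z y) (pageTwo z y) (pageArg ϖ α φ₀ z y) univ := by
  have hne : y ≠ z := by rintro rfl; exact lt_irrefl _ h₁
  have hc := fun φ => continuousAt_pageDeriv (ϖ := ϖ) H.α_pos (continuousAt_id (x := φ))
    hz.continuous.continuousAt hy.continuous.continuousAt (hz φ).1 (hy φ).1
  refine isArgOn_integral (fun φ => hz.hasDerivAt_pageOne hy φ) (fun φ => hz.hasDerivAt_pageTwo hy φ)
    (continuous_iff_continuousAt.mpr fun φ => (hc φ).1)
    (continuous_iff_continuousAt.mpr fun φ => (hc φ).2)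
    (hz.page_ne_zero H hy hzR hyR hne) ?_ ?_
  · have := (hz φ₀).1
    unfold pageOne
    rw [sub_pos]
    gcongr
  · unfold pageTwo
    rw [h₂, sub_self]

theorem continuous_pageArg (H : Admissible ϖ α h) (hz : IsSol ϖ α h z) (hzR : ∀ φ, 0 ≤ (z φ).2.2)
    {S : Type*} [TopologicalSpace S] {Y : S → ℝ → State} (hY : ∀ s, IsSol ϖ α h (Y s))
    (hYR : ∀ s φ, 0 ≤ (Y s φ).2.2) (hne : ∀ s, Y s ≠ z) {φ₀ φ₁ : ℝ} (hφ : φ₀ ≤ φ₁)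
    (hc : Continuous fun s => Y s φ₀) : Continuous fun s => pageArg ϖ α φ₀ z (Y s) φ₁ := by
  obtain ⟨K, hK⟩ := H.exists_gronwall
  -- The Gronwall estimate runs only forward in phase. Truncating by `max φ₀` makes the family
  -- continuous on all of S × ℝ and changes nothing on [φ₀, φ₁].
  have hYc : Continuous fun q : S × ℝ => Y q.1 (max φ₀ q.2) := by
    refine continuous_iff_continuousAt.mpr fun ⟨s', φ'⟩ => ?_
    rw [ContinuousAt, tendsto_iff_dist_tendsto_zero]
    have hb : Continuous fun q : S × ℝ => dist (Y q.1 φ₀) (Y s' φ₀) *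
        Real.exp (K * (max φ₀ q.2 - φ₀)) + dist (Y s' (max φ₀ q.2)) (Y s' (max φ₀ φ')) := by
      have h1 : Continuous fun q : S × ℝ => Y q.1 φ₀ := hc.comp continuous_fst
      have h2 : Continuous fun q : S × ℝ => Y s' (max φ₀ q.2) :=
        (hY s').continuous.comp (by fun_prop)
      exact ((h1.dist continuous_const).mul (by fun_prop)).add (h2.dist continuous_const)
    have hb0 := hb.tendsto (s', φ')
    simp only [dist_self, zero_mul, add_zero] at hb0
    refine squeeze_zero (fun _ => dist_nonneg) (fun q => ?_) hb0
    refine (dist_triangle _ (Y s' (max φ₀ q.2)) _).trans ?_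
    gcongr
    exact hK _ _ (hY q.1) (hY s') φ₀ _ (le_max_left _ _)
  have hF : Continuous (Function.uncurry fun (s : S) (φ : ℝ) =>
      pageArgDeriv ϖ α (max φ₀ φ) (z (max φ₀ φ)) (Y s (max φ₀ φ))) := by
    refine continuous_iff_continuousAt.mpr fun q => ?_
    have hm : ContinuousAt (fun q : S × ℝ => max φ₀ q.2) q := by fun_prop
    have hzc : ContinuousAt (fun q : S × ℝ => z (max φ₀ q.2)) q :=
      hz.continuous.continuousAt.comp' hm
    have hyc := hYc.continuousAt (x := q)
    have hd := continuousAt_pageDeriv (ϖ := ϖ) H.α_pos hm hzc hyc (hz _).1 (hY q.1 _).1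
    have h1 := (hz (max φ₀ q.2)).1.ne'
    have h2 := (hY q.1 (max φ₀ q.2)).1.ne'
    have e1 := (hzc.fst.inv₀ h1).sub (hyc.fst.inv₀ h2)
    have e2 := hyc.snd.fst.sub hzc.snd.fst
    exact ((e1.mul hd.2).sub (e2.mul hd.1)).div ((e1.pow 2).add (e2.pow 2))
      (hz.page_ne_zero H (hY q.1) hzR (hYR q.1) (hne q.1) (max φ₀ q.2))
  have := intervalIntegral.continuous_parametric_intervalIntegral_of_continuous'
    (μ := MeasureTheory.volume) hF φ₀ φ₁
  refine this.congr fun s => ?_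
  unfold pageArg
  refine intervalIntegral.integral_congr fun φ hφ' => ?_
  rw [uIcc_of_le hφ] at hφ'
  simp only [max_eq_right hφ'.1]

end page

theorem add_int_mul_of_add {f : ℝ → ℝ} {T c : ℝ} (hT : T ≠ 0) (h : ∀ t, f (t + T) = f t + c)
    (n : ℤ) (t : ℝ) : f (t + n * T) = f t + n * c := by
  have hp : Function.Periodic (fun t => f t - c / T * t) T := by
    intro t
    simp only [h]
    field_simp
    ring
  have := hp.int_mul n t
  have e : c / T * (t + n * T) = c / T * t + n * c := by field_simp
  linarith

/-! ### Arithmetic of the symmetric phases -/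

section divisibility
variable {ϖ α h : ℝ} {y z : ℝ → State} {ψ : ℝ → ℝ} {c : ℤ}

/-- Reflection about cπ/2 preserves the difference of the r and reverses the difference of the p, so
it conjugates the curve in the page and makes its argument odd. -/
theorem pageArg_reflect (H : Admissible ϖ α h) (hz : IsReference ϖ α h z) (hy : IsSol ϖ α h y)
    (hψ : IsArgOn (pageOne z y) (pageTwo z y) ψ univ) (hψ0 : ψ (c * (Real.pi / 2)) = 0)
    (hp0 : (y (c * (Real.pi / 2))).2.1 = 0) (φ : ℝ) : ψ (c * Real.pi - φ) = -ψ φ := by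
  have hcψ := continuousOn_univ.mp hψ.1
  have h1 : IsArgOn (pageOne z y) (pageTwo z y) (fun φ => -ψ (c * Real.pi - φ)) univ := by
    refine ⟨by fun_prop, fun φ _ => ?_⟩
    obtain ⟨ρ, hρ, e1, e2⟩ := hψ.2 (c * Real.pi - φ) trivial
    have hy' := hy.reflect_eq H hp0 φ
    have hz' := hz.isSol.reflect_eq H (hz.momentum_eq_zero c) φ
    refine ⟨ρ, hρ, ?_, ?_⟩
    · rw [Real.cos_neg, ← e1]
      simp only [pageOne, hy', hz', flip]
    · rw [Real.sin_neg, mul_neg, ← e2]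
      simp only [pageTwo, hy', hz', flip]
      ring
  have h2 := h1.eq_of_eq hψ (a := c * (Real.pi / 2))
    (by rw [show (c : ℝ) * Real.pi - c * (Real.pi / 2) = c * (Real.pi / 2) by ring, hψ0, neg_zero]) φ
  linarith

theorem exists_pageArg_eq (hz : IsReference ϖ α h z)
    (hψ : IsArgOn (pageOne z y) (pageTwo z y) ψ univ) {i : ℤ}
    (hp : (y (i * (Real.pi / 2))).2.1 = 0) : ∃ m : ℤ, ψ (i * (Real.pi / 2)) = m * Real.pi := by
  obtain ⟨ρ, hρ, -, e2⟩ := hψ.2 (i * (Real.pi / 2)) trivial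
  rw [pageTwo, hp, hz.momentum_eq_zero, sub_zero, eq_comm, mul_eq_zero] at e2
  obtain ⟨m, hm⟩ := Real.sin_eq_zero_iff.mp (e2.resolve_left hρ.ne')
  exact ⟨m, hm.symm⟩

/-- By reflection the angle mπ gained between two symmetric phases is gained a second time, which
gives 2πm over a whole period iπ. -/
theorem pageArg_shift (H : Admissible ϖ α h) (hz : IsReference ϖ α h z) (hy : IsSol ϖ α h y)
    (hψ : IsArgOn (pageOne z y) (pageTwo z y) ψ univ) (hψ0 : ψ (c * (Real.pi / 2)) = 0)
    (hp0 : (y (c * (Real.pi / 2))).2.1 = 0) {i m : ℤ}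
    (hp : (y ((c + i : ℤ) * (Real.pi / 2))).2.1 = 0)
    (hm : ψ ((c + i : ℤ) * (Real.pi / 2)) = m * Real.pi) (φ : ℝ) :
    ψ (φ + i * Real.pi) = ψ φ + m * (2 * Real.pi) := by
  have hcψ := continuousOn_univ.mp hψ.1
  have hy' : ∀ φ, y (φ + i * Real.pi) = y φ := fun φ => by
    have := hy.shift_two_eq H hp0 hp φ
    rwa [add_sub_cancel_left] at this
  have h1 : IsArgOn (pageOne z y) (pageTwo z y)
      (fun φ => ψ (φ + i * Real.pi) - m * (2 * Real.pi)) univ := by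
    refine ⟨by fun_prop, fun φ _ => ?_⟩
    obtain ⟨ρ, hρ, e1, e2⟩ := hψ.2 (φ + i * Real.pi) trivial
    have hz' := hz.shift_int i φ
    refine ⟨ρ, hρ, ?_, ?_⟩
    · rw [Real.cos_sub_int_mul_two_pi, ← e1]
      simp only [pageOne, hy', hz']
    · rw [Real.sin_sub_int_mul_two_pi, ← e2]
      simp only [pageTwo, hy', hz']
  -- The base point is the mirror image of (c + i)π/2. There ψ = -mπ, and adding iπ leads to (c +
  -- i)π/2, where ψ = mπ.
  have h2 := h1.eq_of_eq hψ (a := (c : ℝ) * Real.pi - (c + i : ℤ) * (Real.pi / 2)) (by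
    rw [pageArg_reflect H hz hy hψ hψ0 hp0, hm]
    have : (c : ℝ) * Real.pi - (c + i : ℤ) * (Real.pi / 2) + i * Real.pi =
      (c + i : ℤ) * (Real.pi / 2) := by push_cast; ring
    rw [this, hm]
    ring) φ
  linarith

/-- All phases at which the orbit is symmetric have the same rotation. -/
theorem mul_eq_mul_of_symmetric (H : Admissible ϖ α h) (hz : IsReference ϖ α h z)
    (hy : IsSol ϖ α h y) (hψ : IsArgOn (pageOne z y) (pageTwo z y) ψ univ)
    (hψ0 : ψ (c * (Real.pi / 2)) = 0) (hp0 : (y (c * (Real.pi / 2))).2.1 = 0) {i m i' m' : ℤ}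
    (hp : (y ((c + i : ℤ) * (Real.pi / 2))).2.1 = 0)
    (hm : ψ ((c + i : ℤ) * (Real.pi / 2)) = m * Real.pi)
    (hp' : (y ((c + i' : ℤ) * (Real.pi / 2))).2.1 = 0)
    (hm' : ψ ((c + i' : ℤ) * (Real.pi / 2)) = m' * Real.pi) : m' * i = m * i' := by
  have key : ∀ {i m : ℤ}, (y ((c + i : ℤ) * (Real.pi / 2))).2.1 = 0 →
      ψ ((c + i : ℤ) * (Real.pi / 2)) = m * Real.pi →
      ∀ n : ℤ, ψ (0 + n * (i * Real.pi)) = ψ 0 + n * (m * (2 * Real.pi)) := by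
    intro i m hp hm n
    rcases eq_or_ne i 0 with rfl | hi
    · rw [add_zero, hψ0] at hm
      have : (m : ℝ) = 0 := by
        rcases mul_eq_zero.mp hm.symm with h | h
        · exact h
        · exact absurd h Real.pi_ne_zero
      simp [this]
    · exact add_int_mul_of_add (mul_ne_zero (by exact_mod_cast hi) Real.pi_ne_zero)
        (pageArg_shift H hz hy hψ hψ0 hp0 hp hm) n 0
  -- The increment of ψ over the phase i i' π is computed as i' periods iπ and as i periods i'π.
  have h1 := key hp hm i'
  have h2 := key hp' hm' i
  rw [show (0 : ℝ) + i * (i' * Real.pi) = 0 + i' * (i * Real.pi) by ring, h1] at h2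
  have h3 : ((m' * i : ℤ) : ℝ) * (2 * Real.pi) = ((m * i' : ℤ) : ℝ) * (2 * Real.pi) := by
    push_cast; linarith
  exact_mod_cast mul_right_cancel₀ Real.two_pi_pos.ne' h3

end divisibility
-- Shooting between the reference orbit and the Euler orbit
section shooting
variable {ϖ α h : ℝ} {z : ℝ → State} {c : ℤ}

theorem Admissible.disc_lt (H : Admissible ϖ α h) {φ : ℝ} {y : State} (hu : 0 < y.1)
    (hR : 0 < y.2.2) (hE : polarEnergy ϖ α φ y = h) :
    (ϖ * y.1 - centre ϖ α) ^ 2 + y.2.1 ^ 2 < discRadius ϖ α h ^ 2 := by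
  have h1 : polarEnergy ϖ α φ (y.1, y.2.1, 0) < h := by
    rw [← hE]; exact polarEnergy_lt H.α_pos hu le_rfl hR
  have h2 := two_mul_polarEnergy (α := α) (φ := φ) (y := (y.1, y.2.1, 0)) H.ϖ_pos
  have h3 : ratioSq α φ (y.1, y.2.1, 0) = 1 := by simp [ratioSq]
  rw [h3] at h2
  simp only [Real.sqrt_one, zero_mul, div_one, sub_self, mul_zero, add_zero, ne_eq,
    OfNat.ofNat_ne_zero, not_false_eq_true, zero_pow] at h2
  rw [H.discRadius_sq]
  linarith

theorem Admissible.disc_eq (H : Admissible ϖ α h) {φ : ℝ} {y : State}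
    (hR : y.2.2 = 0) (hE : polarEnergy ϖ α φ y = h) :
    (ϖ * y.1 - centre ϖ α) ^ 2 + y.2.1 ^ 2 = discRadius ϖ α h ^ 2 := by
  have h2 := two_mul_polarEnergy (α := α) (φ := φ) (y := y) H.ϖ_pos
  have h3 : ratioSq α φ y = 1 := by simp [ratioSq, hR]
  rw [h3, hR] at h2
  simp only [Real.sqrt_one, zero_mul, div_one, sub_self, mul_zero, add_zero, ne_eq,
    OfNat.ofNat_ne_zero, not_false_eq_true, zero_pow] at h2
  rw [H.discRadius_sq]
  linarith

/-- The largest value of `u = 1 / r` on the Euler orbit. -/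
noncomputable def maxInvRadius (ϖ α h : ℝ) : ℝ := (centre ϖ α + discRadius ϖ α h) / ϖ

theorem IsReference.lt_maxInvRadius (H : Admissible ϖ α h) (hz : IsReference ϖ α h z) (φ : ℝ) :
    (z φ).1 < maxInvRadius ϖ α h := by
  have h1 := H.disc_lt (hz.isSol φ).1 (hz.radius_pos φ) (hz.isSol φ).2.1
  have h2 : ϖ * (z φ).1 - centre ϖ α < discRadius ϖ α h :=
    lt_of_pow_lt_pow_left₀ 2 H.discRadius_pos.le (by linarith [sq_nonneg (z φ).2.1])
  rw [maxInvRadius, lt_div_iff₀ H.ϖ_pos]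
  linarith

/-- Intermediate value theorem for the rotation of the orbits that start on a symmetry line, between
the reference orbit and the Euler orbit. -/
theorem exists_sol_pageArg_eq (H : Admissible ϖ α h) (hz : IsReference ϖ α h z)
    (hc : c = 0 ∨ c = 1) {N s₁ A t : ℝ} {yb : ℝ → State} (hN : c * (Real.pi / 2) ≤ N)
    (hs₁ : (z (c * (Real.pi / 2))).1 < s₁) (hyb : IsSol ϖ α h yb)
    (hyb0 : yb (c * (Real.pi / 2)) = (maxInvRadius ϖ α h, 0, 0))
    (hnear : (A < t ∧ (∀ y, IsSol ϖ α h y → (∀ φ, 0 ≤ (y φ).2.2) →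
        (y (c * (Real.pi / 2))).2.1 = 0 → (z (c * (Real.pi / 2))).1 < (y (c * (Real.pi / 2))).1 →
        (y (c * (Real.pi / 2))).1 < s₁ → pageArg ϖ α (c * (Real.pi / 2)) z y N ≤ A) ∧
        t < pageArg ϖ α (c * (Real.pi / 2)) z yb N) ∨
      (t < A ∧ (∀ y, IsSol ϖ α h y → (∀ φ, 0 ≤ (y φ).2.2) →
        (y (c * (Real.pi / 2))).2.1 = 0 → (z (c * (Real.pi / 2))).1 < (y (c * (Real.pi / 2))).1 →
        (y (c * (Real.pi / 2))).1 < s₁ → A ≤ pageArg ϖ α (c * (Real.pi / 2)) z y N) ∧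
        pageArg ϖ α (c * (Real.pi / 2)) z yb N < t)) :
    ∃ y, IsSol ϖ α h y ∧ (∀ φ, 0 < (y φ).2.2) ∧ (y (c * (Real.pi / 2))).2.1 = 0 ∧
      (z (c * (Real.pi / 2))).1 < (y (c * (Real.pi / 2))).1 ∧
      pageArg ϖ α (c * (Real.pi / 2)) z y N = t := by
  have hϖ := H.ϖ_pos
  set φ₀ : ℝ := c * (Real.pi / 2) with hφ₀
  set u₁ := maxInvRadius ϖ α h with hu₁
  set uz := (z φ₀).1 with huz
  have huz0 : 0 < uz := (hz.isSol φ₀).1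
  have hzu : uz < u₁ := hz.lt_maxInvRadius H φ₀
  obtain ⟨ρ, hρ, hρc, -⟩ := H.exists_initialRadius hc
  obtain ⟨s', hs'1, hs'2⟩ := exists_between (lt_min hs₁ hzu)
  have hs's : s' < s₁ := hs'2.trans_le (min_le_left _ _)
  have hs'u : s' < u₁ := hs'2.trans_le (min_le_right _ _)
  have hdz := H.disc_lt (hz.isSol φ₀).1 (hz.radius_pos φ₀) (hz.isSol φ₀).2.1
  have hρ0 := H.discRadius_pos
  have hXz : -discRadius ϖ α h < ϖ * uz - centre ϖ α :=
    (abs_lt.mp (abs_lt_of_sq_lt_sq (by linarith [sq_nonneg (z φ₀).2.1]) hρ0.le)).1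
  have hu₁e : ϖ * u₁ = centre ϖ α + discRadius ϖ α h := by
    rw [hu₁, maxInvRadius]; field_simp
  have hpos : ∀ s : Icc s' u₁, 0 < s.1 := fun s => huz0.trans (hs'1.trans_le s.2.1)
  have hdisc : ∀ s : Icc s' u₁, (ϖ * s.1 - centre ϖ α) ^ 2 + (0 : ℝ) ^ 2 ≤ discRadius ϖ α h ^ 2 := by
    intro s
    have h1 : ϖ * uz ≤ ϖ * s.1 := by have := hs'1.le.trans s.2.1; gcongr
    have h2 : ϖ * s.1 ≤ ϖ * u₁ := by have := s.2.2; gcongr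
    rw [zero_pow two_ne_zero, add_zero]
    exact sq_le_sq' (by linarith) (by linarith)
  have hY : ∀ s : Icc s' u₁, ∃ y, IsSol ϖ α h y ∧ y φ₀ = (s.1, 0, ρ (s.1, 0)) := fun s =>
    H.exists_sol (hpos s) (hρ (s.1, 0) (hpos s) (hdisc s)).2
  choose Y hYs hY0 using hY
  have hYR : ∀ s φ, 0 ≤ (Y s φ).2.2 := fun s φ =>
    (hYs s).radius_nonneg H.α_pos (φ₀ := φ₀)
      (by rw [hY0]; exact (hρ (s.1, 0) (hpos s) (hdisc s)).1) φ
  have hne : ∀ s, Y s ≠ z := fun s he => by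
    have h1 := congrArg Prod.fst (hY0 s)
    rw [he] at h1
    simp only [← huz] at h1
    linarith [s.2.1]
  have hcont : Continuous fun s => pageArg ϖ α φ₀ z (Y s) N := by
    refine continuous_pageArg H hz.isSol (fun φ => (hz.radius_pos φ).le) hYs hYR hne hN ?_
    simp only [hY0]
    refine continuous_subtype_val.prodMk (continuous_const.prodMk ?_)
    refine continuous_iff_continuousAt.mpr fun s => ?_
    exact ContinuousAt.comp (f := fun s : Icc s' u₁ => (s.1, (0 : ℝ))) (hρc (s.1, 0) (hpos s))
      (by fun_prop)
  -- A start with R = 0 lies on the boundary circle with p = 0. Of its two points the one with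
  -- smaller u is to the left of the reference, so only the end point u₁ remains.
  have hYb : ∀ s : Icc s' u₁, ρ (s.1, 0) = 0 → Y s = yb := by
    intro s hs
    refine (hYs s).unique H hyb (φ₀ := φ₀) ?_
    have h1 := H.disc_eq (φ := φ₀) (y := Y s φ₀) (by rw [hY0, hs]) (hYs s φ₀).2.1
    simp only [hY0, ne_eq, OfNat.ofNat_ne_zero, not_false_eq_true, zero_pow, add_zero] at h1
    have h2 : ϖ * uz < ϖ * s.1 := by have := hs'1.trans_le s.2.1; gcongr
    have h3 : (ϖ * s.1 - centre ϖ α - discRadius ϖ α h) *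
        (ϖ * s.1 - centre ϖ α + discRadius ϖ α h) = 0 := by linarith
    rcases mul_eq_zero.mp h3 with h4 | h4
    · have : s.1 = u₁ := mul_left_cancel₀ hϖ.ne' (by linarith)
      rw [hY0, hyb0, hs, this]
    · linarith
  have hs'm : Y ⟨s', le_rfl, hs'u.le⟩ φ₀ = _ := hY0 _
  have hu₁m : Y ⟨u₁, hs'u.le, le_rfl⟩ = yb := by
    refine hYb _ ?_
    by_contra hne0
    have hmem := hdisc ⟨u₁, hs'u.le, le_rfl⟩
    have h1 := hρ (u₁, 0) (hpos ⟨u₁, hs'u.le, le_rfl⟩) hmem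
    have h2 := H.disc_lt (y := (u₁, 0, ρ (u₁, 0))) (hpos ⟨u₁, hs'u.le, le_rfl⟩)
      (lt_of_le_of_ne h1.1 (Ne.symm hne0)) h1.2
    simp only at h2
    have h3 : ϖ * u₁ - centre ϖ α = discRadius ϖ α h := by linarith
    rw [h3] at h2
    linarith
  have : PreconnectedSpace (Icc s' u₁) := Subtype.preconnectedSpace isPreconnected_Icc
  have hmem : t ∈ range fun s => pageArg ϖ α φ₀ z (Y s) N := by
    have e1 : (Y ⟨s', le_rfl, hs'u.le⟩ φ₀).2.1 = 0 := by rw [hs'm]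
    have e2 : (Y ⟨s', le_rfl, hs'u.le⟩ φ₀).1 = s' := by rw [hs'm]
    rcases hnear with ⟨h1, h2, h3⟩ | ⟨h1, h2, h3⟩
    · refine mem_range_of_exists_le_of_exists_ge hcont ⟨⟨s', le_rfl, hs'u.le⟩, ?_⟩
        ⟨⟨u₁, hs'u.le, le_rfl⟩, ?_⟩
      · exact (h2 _ (hYs _) (hYR _) e1 (by rw [e2]; exact hs'1) (by rw [e2]; exact hs's)).trans h1.le
      · rw [hu₁m]; exact h3.le
    · refine mem_range_of_exists_le_of_exists_ge hcont ⟨⟨u₁, hs'u.le, le_rfl⟩, ?_⟩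
        ⟨⟨s', le_rfl, hs'u.le⟩, ?_⟩
      · rw [hu₁m]; exact h3.le
      · exact h1.le.trans (h2 _ (hYs _) (hYR _) e1 (by rw [e2]; exact hs'1) (by rw [e2]; exact hs's))
  obtain ⟨s, hs⟩ := hmem
  -- R = 0 would make the solution the Euler orbit, whose angle differs strictly from t.
  have hρs : ρ (s.1, 0) ≠ 0 := by
    intro h0
    simp only [hYb s h0] at hs
    rcases hnear with ⟨h1, h2, h3⟩ | ⟨h1, h2, h3⟩ <;> linarith
  refine ⟨Y s, hYs s, (hYs s).radius_pos H.α_pos (φ₀ := φ₀) ?_, by rw [hY0], ?_, hs⟩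
  · rw [hY0]
    exact lt_of_le_of_ne (hρ (s.1, 0) (hpos s) (hdisc s)).1 (Ne.symm hρs)
  · rw [hY0]; exact hs'1.trans_le s.2.1

/-- If the rotation near the reference orbit differs from the rotation on the Euler orbit, then every
rotation in between is realized by an orbit that starts and ends on a symmetry line. -/
theorem exists_rotation_interval (H : Admissible ϖ α h) (hz : IsReference ϖ α h z)
    (hc : c = 0 ∨ c = 1) {ω₀ ω₁ C : ℝ} {Ψ : ℝ → ℝ} {yb : ℝ → State} (hω : ω₀ ≠ ω₁)
    (hΨ : Tendsto (fun φ => Ψ φ / φ) atTop (𝓝 ω₀))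
    (hnear : ∀ N, c * (Real.pi / 2) ≤ N → ∃ s₁, (z (c * (Real.pi / 2))).1 < s₁ ∧ ∀ y,
      IsSol ϖ α h y → (∀ φ, 0 ≤ (y φ).2.2) → (y (c * (Real.pi / 2))).2.1 = 0 →
      (z (c * (Real.pi / 2))).1 < (y (c * (Real.pi / 2))).1 → (y (c * (Real.pi / 2))).1 < s₁ →
      |pageArg ϖ α (c * (Real.pi / 2)) z y N - Ψ N| ≤ C)
    (hyb : IsSol ϖ α h yb) (hyb0 : yb (c * (Real.pi / 2)) = (maxInvRadius ϖ α h, 0, 0))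
    (hb : Tendsto (fun φ => pageArg ϖ α (c * (Real.pi / 2)) z yb φ / φ) atTop (𝓝 ω₁)) :
    ∃ (lo hi : ℝ) (J : ℕ), lo < hi ∧ ∀ j : ℕ, J ≤ j → ∀ m : ℤ, lo * j < m → m < hi * j →
      ∃ y, IsSol ϖ α h y ∧ (∀ φ, 0 < (y φ).2.2) ∧ (y (c * (Real.pi / 2))).2.1 = 0 ∧
        (z (c * (Real.pi / 2))).1 < (y (c * (Real.pi / 2))).1 ∧
        pageArg ϖ α (c * (Real.pi / 2)) z y ((c + j : ℤ) * (Real.pi / 2)) = m * Real.pi := by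
  have hpi := Real.pi_pos
  have hc0 : (0 : ℝ) ≤ c := by rcases hc with rfl | rfl <;> simp
  set N : ℕ → ℝ := fun j => (c + j : ℤ) * (Real.pi / 2) with hN
  have hNge : ∀ j, c * (Real.pi / 2) ≤ N j := fun j => by
    simp only [hN]; push_cast
    have : (0 : ℝ) ≤ j := Nat.cast_nonneg j
    gcongr; linarith
  have hNtop : Tendsto N atTop atTop := by
    refine tendsto_atTop_mono (fun j => ?_)
      (tendsto_natCast_atTop_atTop.atTop_mul_const (by positivity : 0 < Real.pi / 2))
    simp only [hN]; push_cast
    gcongr; linarith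
  have hratio : Tendsto (fun j => N j / (j * (Real.pi / 2))) atTop (𝓝 1) := by
    have h1 : Tendsto (fun j : ℕ => (c : ℝ) / j + 1) atTop (𝓝 (0 + 1)) :=
      (tendsto_const_div_atTop_nhds_zero_nat (c : ℝ)).add_const 1
    rw [zero_add] at h1
    refine h1.congr' ?_
    filter_upwards [eventually_gt_atTop 0] with j hj
    have : (j : ℝ) ≠ 0 := by exact_mod_cast hj.ne'
    simp only [hN]; push_cast
    field_simp
  have scale : ∀ {f : ℝ → ℝ} {ω : ℝ}, Tendsto (fun φ => f φ / φ) atTop (𝓝 ω) →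
      Tendsto (fun j => f (N j) / (j * (Real.pi / 2))) atTop (𝓝 ω) := by
    intro f ω hf
    have h1 := (hf.comp hNtop).mul hratio
    rw [mul_one] at h1
    refine h1.congr' ?_
    filter_upwards [hNtop.eventually_gt_atTop 0] with j hj
    simp only [Function.comp]
    field_simp
  have hconst : Tendsto (fun j : ℕ => C / (j * (Real.pi / 2))) atTop (𝓝 0) :=
    tendsto_const_nhds.div_atTop
      (tendsto_natCast_atTop_atTop.atTop_mul_const (by positivity : 0 < Real.pi / 2))
  have hA := scale hΨ
  have hB := scale hb
  rcases lt_or_gt_of_ne hω with hlt | hgt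
  · obtain ⟨a, ha0, ha1⟩ := exists_between hlt
    obtain ⟨b, hb0, hb1⟩ := exists_between ha1
    have hA' := hA.add hconst
    rw [add_zero] at hA'
    obtain ⟨J, hJ⟩ := eventually_atTop.mp
      ((hA'.eventually_lt_const ha0).and ((hB.eventually_const_lt hb1).and (eventually_gt_atTop 0)))
    -- An angle mπ gained over j quarter turns, a phase jπ/2, is a rate 2m/j; hence the halves. The
    -- bounded error C is negligible against jπ/2.
    refine ⟨a / 2, b / 2, J, by linarith, fun j hj m hm1 hm2 => ?_⟩
    obtain ⟨h1, h2, h3⟩ := hJ j hj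
    have hj0 : (0 : ℝ) < j := by exact_mod_cast h3
    rw [← add_div, div_lt_iff₀ (by positivity)] at h1
    rw [lt_div_iff₀ (by positivity)] at h2
    obtain ⟨s₁, hs₁, hs⟩ := hnear (N j) (hNge j)
    refine exists_sol_pageArg_eq H hz hc (A := Ψ (N j) + C) (hNge j) hs₁ hyb hyb0
      (Or.inl ⟨?_, fun y e1 e2 e3 e4 e5 => ?_, ?_⟩)
    · have : a / 2 * j * Real.pi < m * Real.pi := by gcongr
      linarith
    · have := (abs_le.mp (hs y e1 e2 e3 e4 e5)).2
      linarith
    · have : m * Real.pi < b / 2 * j * Real.pi := by gcongr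
      linarith
  · obtain ⟨a, ha0, ha1⟩ := exists_between hgt
    obtain ⟨b, hb0, hb1⟩ := exists_between ha1
    have hA' := hA.sub hconst
    rw [sub_zero] at hA'
    obtain ⟨J, hJ⟩ := eventually_atTop.mp
      ((hA'.eventually_const_lt hb1).and ((hB.eventually_lt_const ha0).and (eventually_gt_atTop 0)))
    refine ⟨a / 2, b / 2, J, by linarith, fun j hj m hm1 hm2 => ?_⟩
    obtain ⟨h1, h2, h3⟩ := hJ j hj
    have hj0 : (0 : ℝ) < j := by exact_mod_cast h3
    rw [← sub_div, lt_div_iff₀ (by positivity)] at h1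
    rw [div_lt_iff₀ (by positivity)] at h2
    obtain ⟨s₁, hs₁, hs⟩ := hnear (N j) (hNge j)
    refine exists_sol_pageArg_eq H hz hc (A := Ψ (N j) - C) (hNge j) hs₁ hyb hyb0
      (Or.inr ⟨?_, fun y e1 e2 e3 e4 e5 => ?_, ?_⟩)
    · have : m * Real.pi < b / 2 * j * Real.pi := by gcongr
      linarith
    · have := (abs_le.mp (hs y e1 e2 e3 e4 e5)).1
      linarith
    · have : a / 2 * j * Real.pi < m * Real.pi := by gcongr
      linarith

end shooting

/-! ### Orbits obtained by shooting and their types -/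

/-- A solution whose symmetric phases are the phases `(c + i) π / 2` with `j ∣ i`, and which makes
`m` half turns around the reference orbit in `j` quarter turns of the phase. -/
structure IsShot (ϖ α h : ℝ) (c : ℤ) (j : ℕ) (m : ℤ) (y : ℝ → State) : Prop where
  isSol : IsSol ϖ α h y
  radius_pos : ∀ φ, 0 < (y φ).2.2
  start : (y (c * (Real.pi / 2))).2.1 = 0
  target : (y ((c + j : ℤ) * (Real.pi / 2))).2.1 = 0
  dvd : ∀ i : ℤ, (y ((c + i : ℤ) * (Real.pi / 2))).2.1 = 0 → (j : ℤ) ∣ i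
  even : ∀ i : ℤ, y ((c + 2 * i : ℤ) * (Real.pi / 2)) = y (c * (Real.pi / 2)) →
    ∃ n : ℤ, n * j = m * i

/-- Another symmetric phase at distance i with angle m'π satisfies m'j = mi, so coprimality gives j
∣ i. If the state itself returns after a phase iπ, the difference vector returns as well; hence its
angle is an even multiple of π, which sharpens the relation by a factor 2. -/
theorem isShot_of_pageArg_eq {ϖ α h : ℝ} (H : Admissible ϖ α h) {z y : ℝ → State} {c m : ℤ}
    {j : ℕ} (hz : IsReference ϖ α h z) (hy : IsSol ϖ α h y) (hR : ∀ φ, 0 < (y φ).2.2)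
    (hp : (y (c * (Real.pi / 2))).2.1 = 0)
    (hu : (z (c * (Real.pi / 2))).1 < (y (c * (Real.pi / 2))).1)
    (harg : pageArg ϖ α (c * (Real.pi / 2)) z y ((c + j : ℤ) * (Real.pi / 2)) = m * Real.pi)
    (hcop : IsCoprime (j : ℤ) m) : IsShot ϖ α h c j m y := by
  have hψ := isArgOn_pageArg H hz.isSol hy (fun φ => (hz.radius_pos φ).le) (fun φ => (hR φ).le) hu
    (by rw [hp, hz.momentum_eq_zero])
  have hψ0 := pageArg_self ϖ α (c * (Real.pi / 2)) z y
  have htarget : (y ((c + j : ℤ) * (Real.pi / 2))).2.1 = 0 := by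
    obtain ⟨ρ, hρ, -, e2⟩ := hψ.2 ((c + j : ℤ) * (Real.pi / 2)) trivial
    rw [harg, Real.sin_int_mul_pi, mul_zero, pageTwo, hz.momentum_eq_zero, sub_zero] at e2
    exact e2
  refine ⟨hy, hR, hp, htarget, fun i hi => ?_, fun i hi => ?_⟩
  · obtain ⟨m', hm'⟩ := exists_pageArg_eq hz hψ hi
    have := mul_eq_mul_of_symmetric H hz hy hψ hψ0 hp htarget harg hi hm'
    exact hcop.dvd_of_dvd_mul_left ⟨m', by linarith⟩
  · have hpi : (y ((c + 2 * i : ℤ) * (Real.pi / 2))).2.1 = 0 := by rw [hi, hp]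
    obtain ⟨m', hm'⟩ := exists_pageArg_eq hz hψ hpi
    have hmul := mul_eq_mul_of_symmetric H hz hy hψ hψ0 hp htarget harg hpi hm'
    obtain ⟨ρ, hρ, e1, -⟩ := hψ.2 ((c + 2 * i : ℤ) * (Real.pi / 2)) trivial
    have hzi : z ((c + 2 * i : ℤ) * (Real.pi / 2)) = z (c * (Real.pi / 2)) := by
      rw [← hz.shift_int i (c * (Real.pi / 2))]
      congr 1
      push_cast; ring
    have hpos : 0 < pageOne z y ((c + 2 * i : ℤ) * (Real.pi / 2)) := by
      have := (hz.isSol (c * (Real.pi / 2))).1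
      rw [pageOne, hi, hzi, sub_pos]
      gcongr
    rw [e1, hm', cos_int_mul_pi_eq] at hpos
    split_ifs at hpos with hev
    · obtain ⟨n, rfl⟩ := hev
      exact ⟨n, by linarith⟩
    · linarith

section orbits
variable {ϖ α h : ℝ} {y : ℝ → State}

theorem phys_int_mul_two_pi (φ : ℝ) (n : ℤ) (w : State) :
    phys (φ + n * (2 * Real.pi)) w = phys φ w := by
  simp only [phys, Real.sin_add_int_mul_two_pi, Real.cos_add_int_mul_two_pi]

/-- A trajectory that traces the orbit of a solution. -/
theorem IsSol.exists_trajectory (H : Admissible ϖ α h) (hy : IsSol ϖ α h y) (φ₀ : ℝ) :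
    ∃ τ : ℝ ≃o ℝ, τ φ₀ = 0 ∧
      IsTrajectory ϖ α h (fun t => phys (τ.symm t) (y (τ.symm t))) ∧
      range (fun t => phys (τ.symm t) (y (τ.symm t))) = orbitOf y := by
  obtain ⟨τ, h0, -, h2⟩ := hy.exists_clock H φ₀
  exact ⟨τ, h0, hy.isTrajectory H h2, range_phys_clock y τ⟩

theorem IsSol.isPeriodicOrbit (H : Admissible ϖ α h) (hy : IsSol ϖ α h y) {k l : ℤ} (hkl : k < l)
    (hk : (y (k * (Real.pi / 2))).2.1 = 0) (hl : (y (l * (Real.pi / 2))).2.1 = 0) :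
    IsPeriodicOrbit ϖ α h (orbitOf y) := by
  obtain ⟨τ, h0, htr, hra⟩ := hy.exists_trajectory H 0
  have hpi := Real.pi_pos
  have hlk : (0 : ℝ) < (l - k : ℤ) := by exact_mod_cast sub_pos.mpr hkl
  -- The period (l - k)π of the state is doubled because an odd multiple of π changes the signs of z
  -- and p_z.
  set T := τ ((l - k : ℤ) * (2 * Real.pi)) with hT
  refine ⟨_, T, htr, ?_, fun t => ?_, hra⟩
  · rw [← h0, hT, τ.lt_iff_lt]; positivity
  · have hy2 : y ((l - k : ℤ) * (2 * Real.pi)) = y 0 := by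
      have h1 := hy.shift_two_eq H hk hl 0
      have h2 := hy.shift_two_eq H hk hl (0 + (l - k : ℤ) * Real.pi)
      rw [← h1, ← h2]
      congr 1; ring
    have := htr.unique H.α_pos htr (a := T) (b := 0) (by
      have e0 : τ.symm 0 = 0 := by simpa only [h0] using τ.symm_apply_apply 0
      simp only [e0, hT, τ.symm_apply_apply]
      rw [hy2, ← phys_int_mul_two_pi 0 (l - k) (y 0), zero_add]) t
    rw [zero_add, add_comm] at this
    exact this

theorem IsSol.footPoint_mem_iff (H : Admissible ϖ α h) (hy : IsSol ϖ α h y)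
    (hR : ∀ φ, 0 < (y φ).2.2) (φ : ℝ) :
    footPoint (phys φ (y φ)) ∈ zeroVelocityCurve ϖ α h ↔
      (y φ).2.1 = 0 ∧ ∃ n : ℤ, φ = n * Real.pi :=
  footPoint_phys_mem_iff H.α_pos (hy φ).1 (hy φ).2.1 (hR φ)

/-- For odd l the reflection φ ↦ lπ - φ keeps u and R and changes the sign of cos φ. -/
theorem IsSol.isZSymmetric (H : Admissible ϖ α h) (hy : IsSol ϖ α h y) {l : ℤ} (hl : Odd l)
    (hp : (y (l * (Real.pi / 2))).2.1 = 0) : IsZSymmetric (orbitOf y) := by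
  have hsub : (fun q : ℝ × ℝ => (q.1, -q.2)) '' (footPoint '' orbitOf y) ⊆
      footPoint '' orbitOf y := by
    rintro _ ⟨_, ⟨_, ⟨φ, rfl⟩, rfl⟩, rfl⟩
    refine ⟨_, ⟨l * Real.pi - φ, rfl⟩, ?_⟩
    have hc := cos_int_mul_pi_eq l
    rw [if_neg (Int.not_even_iff_odd.mpr hl)] at hc
    simp only [footPoint_phys, hy.reflect_eq H hp, flip, Real.cos_sub, hc, Real.sin_int_mul_pi]
    simp
  refine hsub.antisymm fun q hq => ⟨(q.1, -q.2), hsub ⟨q, hq, rfl⟩, by simp⟩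

end orbits

section shots
variable {ϖ α h : ℝ} {c : ℤ} {j : ℕ} {m : ℤ} {y : ℝ → State}

theorem IsShot.isPeriodicOrbit (H : Admissible ϖ α h) (hj : 0 < j) (hy : IsShot ϖ α h c j m y) :
    IsPeriodicOrbit ϖ α h (orbitOf y) :=
  hy.isSol.isPeriodicOrbit H (by omega) hy.start hy.target

theorem IsShot.isBrakeOrbit (H : Admissible ϖ α h) (hj : 0 < j) (hy : IsShot ϖ α h 0 j m y) :
    IsBrakeOrbit ϖ α h (orbitOf y) := by
  refine ⟨hy.isPeriodicOrbit H hj, footPoint (phys 0 (y 0)), mem_image_of_mem _ ⟨0, rfl⟩, ?_⟩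
  rw [hy.isSol.footPoint_mem_iff H hy.radius_pos]
  exact ⟨by simpa using hy.start, 0, by simp⟩

/-- Solutions with the same orbit differ by a phase translation by a multiple of 2π. The start and
the target of the second are then symmetric phases of the first, and j divides their difference j'.
So j is an invariant of the orbit. -/
theorem IsShot.dvd_of_orbitOf_eq (H : Admissible ϖ α h) {j' : ℕ} {m' : ℤ} {y' : ℝ → State}
    (hy : IsShot ϖ α h c j m y) (hy' : IsShot ϖ α h c j' m' y') (he : orbitOf y = orbitOf y') :
    (j : ℤ) ∣ j' := by
  have h1 : phys (c * (Real.pi / 2)) (y' (c * (Real.pi / 2))) ∈ orbitOf y := by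
    rw [he]; exact ⟨_, rfl⟩
  obtain ⟨φ, hφ⟩ := h1
  obtain ⟨h2, n, hn⟩ := phys_eq_phys (hy.radius_pos _) (hy'.radius_pos _) hφ
  have h3 : (fun φ => y (φ + (-2 * n : ℤ) * Real.pi)) = y' := by
    refine (hy.isSol.shift (-2 * n)).unique H hy'.isSol (φ₀ := c * (Real.pi / 2)) ?_
    rw [← h2, hn]
    congr 1; push_cast; ring
  have h4 : (j : ℤ) ∣ -4 * n := by
    refine hy.dvd _ ?_
    rw [← hy'.start, ← h3]
    congr 3; push_cast; ring
  have h5 : (j : ℤ) ∣ -4 * n + j' := by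
    refine hy.dvd _ ?_
    rw [← hy'.target, ← h3]
    congr 3; push_cast; ring
  exact (Int.dvd_add_right h4).mp h5

theorem IsShot.exists_isBrakeArc (H : Admissible ϖ α h) {k : ℕ} (hk : 0 < k)
    (hy : IsShot ϖ α h 0 (2 * k) m y) :
    ∃ (x : ℝ → Phase) (b : ℝ), IsBrakeArc ϖ α h (orbitOf y) x 0 b ∧
      footPoint (x 0) ∈ zeroVelocityCurve ϖ α h ∩ {q | 0 < q.2} ∧
      footPoint (x b) ∈ zeroVelocityCurve ϖ α h ∧
      (footPoint (x b)).2 = (y (k * Real.pi)).2.2 * Real.cos (k * Real.pi) := by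
  have hpi := Real.pi_pos
  obtain ⟨τ, h0, htr, hra⟩ := hy.isSol.exists_trajectory H 0
  have hk0 : (0 : ℝ) < k := by exact_mod_cast hk
  have e0 : τ.symm 0 = 0 := by simpa only [h0] using τ.symm_apply_apply 0
  have hz := hy.isSol.footPoint_mem_iff H hy.radius_pos
  have hstart : (y 0).2.1 = 0 := by simpa using hy.start
  have htarget : (y (k * Real.pi)).2.1 = 0 := by
    rw [← hy.target]; congr 3; push_cast; ring
  have hm0 : footPoint (phys 0 (y 0)) ∈ zeroVelocityCurve ϖ α h :=
    (hz 0).mpr ⟨hstart, 0, by simp⟩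
  have hmk : footPoint (phys (k * Real.pi) (y (k * Real.pi))) ∈ zeroVelocityCurve ϖ α h :=
    (hz _).mpr ⟨htarget, k, by simp⟩
  refine ⟨_, τ (k * Real.pi), ⟨htr, hra, ?_, ?_, ?_, fun t ht hmem => ?_⟩, ⟨?_, ?_⟩, ?_, ?_⟩
  · rw [← h0, τ.lt_iff_lt]; positivity
  · simpa only [e0] using hm0
  · simpa only [τ.symm_apply_apply] using hmk
  · obtain ⟨hp, n, hn⟩ := (hz _).mp hmem
    have ht' : t = τ (n * Real.pi) := by rw [← hn, τ.apply_symm_apply]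
    rw [ht', ← h0, mem_Ioo, τ.lt_iff_lt, τ.lt_iff_lt] at ht
    have hn0 : 0 < n := by
      have := pos_of_mul_pos_left ht.1 hpi.le
      exact_mod_cast this
    have hnk : n < k := by
      have := lt_of_mul_lt_mul_right ht.2 hpi.le
      exact_mod_cast this
    rw [hn] at hp
    have hd := hy.dvd (2 * n) (by rw [← hp]; congr 3; push_cast; ring)
    have := Int.le_of_dvd (by omega) hd
    push_cast at this
    omega
  · simpa only [e0] using hm0
  · have := hy.radius_pos 0
    simpa [e0, footPoint_phys] using this
  · simpa only [τ.symm_apply_apply] using hmk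
  · simp only [τ.symm_apply_apply, footPoint_phys]

/-- The brake points have phases 0 and kπ, so the parity of k decides whether their heights have
opposite signs. -/
theorem IsShot.isTypeI (H : Admissible ϖ α h) {k : ℕ} (hk : Odd k)
    (hy : IsShot ϖ α h 0 (2 * k) m y) : IsTypeIBrakeOrbit ϖ α h (orbitOf y) := by
  have hk0 : 0 < k := hk.pos
  obtain ⟨x, b, harc, h1, h2, h3⟩ := hy.exists_isBrakeArc H hk0
  refine ⟨hy.isBrakeOrbit H (by omega), x, 0, b, harc, Or.inl ⟨⟨h1.1, (show 0 < (footPoint (x 0)).2 from h1.2).le⟩, h2, ?_⟩⟩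
  have hR := hy.radius_pos (k * Real.pi)
  have hc := cos_int_mul_pi_eq k
  rw [if_neg (by simpa using hk)] at hc
  simp only [Int.cast_natCast] at hc
  rw [hc] at h3
  show (footPoint (x b)).2 ≤ 0
  linarith

theorem IsShot.isTypeII (H : Admissible ϖ α h) {k : ℕ} (hk0 : 0 < k) (hk : Even k)
    (hy : IsShot ϖ α h 0 (2 * k) m y) : IsTypeIIBrakeOrbit ϖ α h (orbitOf y) := by
  obtain ⟨x, b, harc, h1, h2, h3⟩ := hy.exists_isBrakeArc H hk0
  refine ⟨hy.isBrakeOrbit H (by omega), x, 0, b, harc, Or.inl ⟨⟨h1.1, (show 0 < (footPoint (x 0)).2 from h1.2).le⟩, h2, ?_⟩⟩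
  have hR := hy.radius_pos (k * Real.pi)
  have hc := cos_int_mul_pi_eq k
  rw [if_pos (by simpa using hk)] at hc
  simp only [Int.cast_natCast] at hc
  rw [hc] at h3
  show 0 ≤ (footPoint (x b)).2
  linarith

/-- Symmetry would place the mirror image of the first brake point at an odd phase nπ with the same
state. The field `even` then makes the odd number mn a multiple of 2k. -/
theorem IsShot.not_isZSymmetric (H : Admissible ϖ α h) {k : ℕ} (hm : Odd m)
    (hy : IsShot ϖ α h 0 (2 * k) m y) : ¬ IsZSymmetric (orbitOf y) := by
  intro hsym
  have hstart : (y 0).2.1 = 0 := by simpa using hy.start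
  have h1 : ((y 0).1⁻¹, -(y 0).2.2) ∈ footPoint '' orbitOf y := by
    rw [← hsym]
    exact ⟨_, ⟨_, ⟨0, rfl⟩, rfl⟩, by simp [footPoint_phys]⟩
  obtain ⟨_, ⟨φ, rfl⟩, hφ⟩ := h1
  have hz := hy.isSol.footPoint_mem_iff H hy.radius_pos
  have h2 : footPoint (phys φ (y φ)) ∈ zeroVelocityCurve ϖ α h := by
    dsimp only at hφ
    rw [hφ]
    have h3 := (hz 0).mpr ⟨hstart, 0, by simp⟩
    rw [footPoint_phys] at h3
    obtain ⟨h4, h5⟩ := h3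
    refine ⟨h4, ?_⟩
    rw [← h5]
    simp [potential]
  obtain ⟨hp, n, hn⟩ := (hz φ).mp h2
  obtain ⟨h4, h5⟩ := Prod.mk.inj hφ
  subst hn
  have hc := cos_int_mul_pi_eq n
  have hR1 := hy.radius_pos (n * Real.pi)
  have hR2 := hy.radius_pos 0
  simp only [phys, height, rad] at h5 h4
  rw [hc] at h5
  split_ifs at h5 with hev
  · linarith
  · have hn' := Int.not_even_iff_odd.mp hev
    have heq : y (n * Real.pi) = y 0 :=
      Prod.ext (inv_inj.mp h4) (Prod.ext (hp.trans hstart.symm) (by linarith))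
    obtain ⟨i, hi⟩ := hy.even n (by
      rw [show ((0 + 2 * n : ℤ) : ℝ) * (Real.pi / 2) = n * Real.pi by push_cast; ring, heq]
      simp)
    have hodd : Odd (m * n) := hm.mul hn'
    rw [← hi] at hodd
    have heven : Even (i * (2 * k : ℕ) : ℤ) := ⟨i * k, by push_cast; ring⟩
    exact Int.not_even_iff_odd.mpr hodd heven

theorem IsShot.isZSymmetric (H : Admissible ϖ α h) (hj : Odd j)
    (hy : IsShot ϖ α h 0 j m y) : IsZSymmetric (orbitOf y) :=
  hy.isSol.isZSymmetric H (l := 0 + j) (by simpa using hj) hy.target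

theorem IsShot.isZSymmetric_of_one (H : Admissible ϖ α h) (hy : IsShot ϖ α h 1 j m y) :
    IsZSymmetric (orbitOf y) :=
  hy.isSol.isZSymmetric H odd_one hy.start

/-- A brake phase nπ is 2n - 1 quarter turns away from the start π/2, and an even j cannot divide
this odd number. -/
theorem IsShot.not_isBrakeOrbit (H : Admissible ϖ α h) (hj : Even j)
    (hy : IsShot ϖ α h 1 j m y) : ¬ IsBrakeOrbit ϖ α h (orbitOf y) := by
  rintro ⟨-, _, ⟨_, ⟨φ, rfl⟩, rfl⟩, hmem⟩
  obtain ⟨hp, n, hn⟩ := (hy.isSol.footPoint_mem_iff H hy.radius_pos φ).mp hmem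
  subst hn
  have hd := hy.dvd (2 * n - 1) (by rw [← hp]; congr 3; push_cast; ring)
  have h2 : (2 : ℤ) ∣ 2 * n - 1 := dvd_trans (by exact_mod_cast hj.two_dvd) hd
  omega

/-- A set that contains the orbits of shots with infinitely many different periods is infinite. -/
theorem infinite_of_isShot (H : Admissible ϖ α h) {S : Set (Set Phase)} {Q : Set ℕ}
    (hQ : Q.Infinite)
    (hS : ∀ j ∈ Q, ∃ m y, IsShot ϖ α h c j m y ∧ orbitOf y ∈ S) : S.Infinite := by
  choose! m y hy hyS using hS
  refine Set.infinite_of_injOn_mapsTo (f := fun j => orbitOf (y j)) (fun j hj j' hj' he => ?_)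
    (fun j hj => hyS j hj) hQ
  have h1 := (hy j hj).dvd_of_orbitOf_eq H (hy j' hj') he
  have h2 := (hy j' hj').dvd_of_orbitOf_eq H (hy j hj) he.symm
  exact Nat.dvd_antisymm (by exact_mod_cast h1) (by exact_mod_cast h2)

/-- A window longer than 4 contains two consecutive odd integers. They differ by 2 < q, so q does
not divide both. -/
theorem exists_odd_isCoprime {lo hi : ℝ} {q e : ℕ} (hq : q.Prime) (hq2 : 2 < q)
    (hlen : 4 < (hi - lo) * (2 ^ e * q : ℕ)) :
    ∃ m : ℤ, lo * (2 ^ e * q : ℕ) < m ∧ m < hi * (2 ^ e * q : ℕ) ∧ Odd m ∧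
      IsCoprime ((2 ^ e * q : ℕ) : ℤ) m := by
  set j := 2 ^ e * q
  have hodd : ∃ n : ℤ, Odd n ∧ lo * j < n ∧ n ≤ lo * j + 2 := by
    have h1 := Int.lt_floor_add_one (lo * j)
    have h2 := Int.floor_le (lo * j)
    rcases Int.even_or_odd (⌊lo * j⌋ + 1) with hev | hod
    · exact ⟨⌊lo * j⌋ + 1 + 1, hev.add_one, by push_cast; linarith, by push_cast; linarith⟩
    · exact ⟨⌊lo * j⌋ + 1, hod, by push_cast; linarith, by push_cast; linarith⟩
  obtain ⟨n, hn, hn1, hn2⟩ := hodd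
  have hcop : ∀ n : ℤ, Odd n → ¬ (q : ℤ) ∣ n → IsCoprime (j : ℤ) n := by
    intro n hn hqn
    have h1 : IsCoprime (2 : ℤ) n := by
      obtain ⟨k, hk⟩ := hn
      exact ⟨-k, 1, by rw [hk]; ring⟩
    have h2 : IsCoprime (q : ℤ) n :=
      (Nat.prime_iff_prime_int.mp hq).irreducible.coprime_iff_not_dvd.mpr hqn
    simp only [j]
    push_cast
    exact (h1.pow_left).mul_left h2
  by_cases hqn : (q : ℤ) ∣ n
  · refine ⟨n + 2, by push_cast; linarith, by push_cast; nlinarith, hn.add_even even_two,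
      hcop _ (hn.add_even even_two) fun hd => ?_⟩
    have h3 : (q : ℤ) ∣ 2 := (Int.dvd_add_right hqn).mp hd
    have := Int.le_of_dvd (by norm_num) h3
    omega
  · exact ⟨n, hn1, by nlinarith, hn, hcop _ hn hqn⟩

end shots
-- The linearized flow and the rotation number in terms of the phase
/-- The mixed second derivative of the potential. -/
noncomputable def potentialDrz (α r z : ℝ) : ℝ :=
  -(3 * (4 * α⁻¹) * (1 + 2 * α) * r * z / Real.sqrt (r ^ 2 + (1 + 2 * α) * z ^ 2) ^ 5)

/-- The second derivative of the potential in the direction of `z`. -/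
noncomputable def potentialDzz (α r z : ℝ) : ℝ :=
  4 * α⁻¹ * (1 + 2 * α) / Real.sqrt (r ^ 2 + (1 + 2 * α) * z ^ 2) ^ 3
    - 3 * (4 * α⁻¹) * (1 + 2 * α) ^ 2 * z ^ 2 / Real.sqrt (r ^ 2 + (1 + 2 * α) * z ^ 2) ^ 5

theorem hasDerivAt_potentialDr_z {ϖ α r : ℝ} (hα : 0 < α) (hr : 0 < r) (z : ℝ) :
    HasDerivAt (fun s => potentialDr ϖ α r s) (potentialDrz α r z) z := by
  have hpos : 0 < r ^ 2 + (1 + 2 * α) * z ^ 2 := by positivity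
  have hs : 0 < Real.sqrt (r ^ 2 + (1 + 2 * α) * z ^ 2) := Real.sqrt_pos.mpr hpos
  have h1 : HasDerivAt (fun s : ℝ => r ^ 2 + (1 + 2 * α) * s ^ 2) ((1 + 2 * α) * (2 * z)) z := by
    simpa using ((hasDerivAt_pow 2 z).const_mul (1 + 2 * α)).const_add (r ^ 2)
  have h2 := (h1.sqrt hpos.ne').fun_pow 3
  have h3 := (hasDerivAt_const z (4 * α⁻¹ * r)).fun_div h2 (by positivity)
  refine (h3.const_add (-(ϖ ^ 2 / r ^ 3) + 1 / r ^ 2)).congr_deriv ?_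
  unfold potentialDrz
  field_simp
  ring

theorem hasDerivAt_potentialDz_r {α r : ℝ} (hα : 0 < α) (hr : 0 < r) (z : ℝ) :
    HasDerivAt (fun s => potentialDz α s z) (potentialDrz α r z) r := by
  have hpos : 0 < r ^ 2 + (1 + 2 * α) * z ^ 2 := by positivity
  have hs : 0 < Real.sqrt (r ^ 2 + (1 + 2 * α) * z ^ 2) := Real.sqrt_pos.mpr hpos
  have h1 : HasDerivAt (fun s : ℝ => s ^ 2 + (1 + 2 * α) * z ^ 2) (2 * r) r := by
    simpa using (hasDerivAt_pow 2 r).add_const ((1 + 2 * α) * z ^ 2)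
  have h2 := (h1.sqrt hpos.ne').fun_pow 3
  have h3 := (hasDerivAt_const r (4 * α⁻¹ * (1 + 2 * α) * z)).fun_div h2 (by positivity)
  refine h3.congr_deriv ?_
  unfold potentialDrz
  field_simp
  ring

theorem hasDerivAt_potentialDz_z {α r : ℝ} (hα : 0 < α) (hr : 0 < r) (z : ℝ) :
    HasDerivAt (fun s => potentialDz α r s) (potentialDzz α r z) z := by
  have hpos : 0 < r ^ 2 + (1 + 2 * α) * z ^ 2 := by positivity
  have hs : 0 < Real.sqrt (r ^ 2 + (1 + 2 * α) * z ^ 2) := Real.sqrt_pos.mpr hpos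
  have h1 : HasDerivAt (fun s : ℝ => r ^ 2 + (1 + 2 * α) * s ^ 2) ((1 + 2 * α) * (2 * z)) z := by
    simpa using ((hasDerivAt_pow 2 z).const_mul (1 + 2 * α)).const_add (r ^ 2)
  have h2 := (h1.sqrt hpos.ne').fun_pow 3
  have h3 := ((hasDerivAt_id z).const_mul (4 * α⁻¹ * (1 + 2 * α))).fun_div h2 (by positivity)
  refine h3.congr_deriv ?_
  unfold potentialDzz
  simp only [id]
  field_simp
  ring

/-- Besides the symmetry of the Hessian, only the entries involving z matter later, so ∂²V/∂r² is
left as an unnamed A. -/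
theorem fderiv_hamiltonianField {ϖ α : ℝ} (hα : 0 < α) {x : Phase} (hx : 0 < rad x) :
    ∃ A : ℝ, ∀ v : Phase, fderiv ℝ (hamiltonianField ϖ α) x v =
      (-(A * rad v + potentialDrz α (rad x) (height x) * height v),
        -(potentialDrz α (rad x) (height x) * rad v
          + potentialDzz α (rad x) (height x) * height v), pr v, pz v) := by
  have hd : HasFDerivAt (hamiltonianField ϖ α) (fderiv ℝ (hamiltonianField ϖ α) x) x :=
    ((contDiffAt_hamiltonianField hα hx).differentiableAt one_ne_zero).hasFDerivAt
  obtain ⟨a, b, r, z⟩ := x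
  set L := fderiv ℝ (hamiltonianField ϖ α) (a, b, r, z)
  have c : ∀ (s s' : ℝ), HasDerivAt (fun _ : ℝ => s') 0 s := fun s s' => hasDerivAt_const s s'
  have l1 : L (1, 0, 0, 0) = (0, 0, 1, 0) := by
    have h1 : HasDerivAt (fun s => ((s, b, r, z) : Phase)) (1, 0, 0, 0) a :=
      (hasDerivAt_id a).prodMk ((c _ _).prodMk ((c _ _).prodMk (c _ _)))
    refine (hd.comp_hasDerivAt a h1).unique ?_
    exact (c a (-potentialDr ϖ α r z)).prodMk
      ((c a (-potentialDz α r z)).prodMk ((hasDerivAt_id a).prodMk (c a b)))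
  have l2 : L (0, 1, 0, 0) = (0, 0, 0, 1) := by
    have h1 : HasDerivAt (fun s => ((a, s, r, z) : Phase)) (0, 1, 0, 0) b :=
      (c _ _).prodMk ((hasDerivAt_id b).prodMk ((c _ _).prodMk (c _ _)))
    refine (hd.comp_hasDerivAt b h1).unique ?_
    exact (c b (-potentialDr ϖ α r z)).prodMk
      ((c b (-potentialDz α r z)).prodMk ((c b a).prodMk (hasDerivAt_id b)))
  have l3 : HasDerivAt (fun s => hamiltonianField ϖ α (a, b, s, z)) (L (0, 0, 1, 0)) r := by
    have h1 : HasDerivAt (fun s => ((a, b, s, z) : Phase)) (0, 0, 1, 0) r :=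
      (c _ _).prodMk ((c _ _).prodMk ((hasDerivAt_id r).prodMk (c _ _)))
    exact hd.comp_hasDerivAt r h1
  have l4 : L (0, 0, 0, 1) = (-potentialDrz α r z, -potentialDzz α r z, 0, 0) := by
    have h1 : HasDerivAt (fun s => ((a, b, r, s) : Phase)) (0, 0, 0, 1) z :=
      (c _ _).prodMk ((c _ _).prodMk ((c _ _).prodMk (hasDerivAt_id z)))
    refine (hd.comp_hasDerivAt z h1).unique ?_
    exact (hasDerivAt_potentialDr_z hα hx z).fun_neg.prodMk
      ((hasDerivAt_potentialDz_z hα hx z).fun_neg.prodMk ((c z a).prodMk (c z b)))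
  have e2 : (L (0, 0, 1, 0)).2.1 = -potentialDrz α r z := by
    have h1 : HasDerivAt (fun s => -potentialDz α s z) (L (0, 0, 1, 0)).2.1 r := l3.snd.fst
    exact h1.unique (hasDerivAt_potentialDz_r hα hx z).fun_neg
  have e3 : (L (0, 0, 1, 0)).2.2.1 = 0 := by
    have h1 : HasDerivAt (fun _ => a) (L (0, 0, 1, 0)).2.2.1 r := l3.snd.snd.fst
    exact h1.unique (c _ _)
  have e4 : (L (0, 0, 1, 0)).2.2.2 = 0 := by
    have h1 : HasDerivAt (fun _ => b) (L (0, 0, 1, 0)).2.2.2 r := l3.snd.snd.snd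
    exact h1.unique (c _ _)
  refine ⟨-(L (0, 0, 1, 0)).1, fun v => ?_⟩
  obtain ⟨v₁, v₂, v₃, v₄⟩ := v
  have hv : ((v₁, v₂, v₃, v₄) : Phase) = v₁ • (1, 0, 0, 0) + v₂ • (0, 1, 0, 0)
      + v₃ • (0, 0, 1, 0) + v₄ • (0, 0, 0, 1) := by simp
  have h3 : L (0, 0, 1, 0) = ((L (0, 0, 1, 0)).1, -potentialDrz α r z, 0, 0) := by
    rw [← e2]
    exact Prod.ext rfl (Prod.ext rfl (Prod.ext e3 e4))
  rw [hv, map_add, map_add, map_add, map_smul, map_smul, map_smul, map_smul, l1, l2, h3, l4]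
  simp only [Prod.smul_mk, Prod.mk_add_mk, smul_eq_mul]
  refine Prod.ext ?_ (Prod.ext ?_ (Prod.ext ?_ ?_)) <;> dsimp only <;> ring

theorem tendsto_div_of_abs_sub_le {f g d : ℝ → ℝ} {L C : ℝ} (hd : Tendsto d atTop atTop)
    (hf : Tendsto (fun t => f t / d t) atTop (𝓝 L)) (h : ∀ᶠ t in atTop, |g t - f t| ≤ C) :
    Tendsto (fun t => g t / d t) atTop (𝓝 L) := by
  have h0 : Tendsto (fun t => (g t - f t) / d t) atTop (𝓝 0) := by
    refine squeeze_zero_norm' (a := fun t => C / d t) ?_ (tendsto_const_nhds.div_atTop hd)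
    filter_upwards [h, hd.eventually_gt_atTop 0] with t ht hd0
    rw [norm_div, Real.norm_eq_abs, Real.norm_eq_abs, abs_of_pos hd0]
    gcongr
  refine (hf.add h0).congr (fun t => ?_) |>.trans (by simp)
  rw [← add_div]
  congr 1
  ring

/-- The gain of b over the least period is a constant positive multiple nc. A gain of c already
closes the orbit, so n = 1. The role of b is played by the phase on the reference orbit and by the
angle on the boundary circle on the Euler orbit. -/
theorem add_leastPeriod_eq {X : Type*} {x : ℝ → X} {b : ℝ → ℝ} {T c : ℝ} (hb : Continuous b)
    (hmono : StrictMono b) (htop : Tendsto b atTop atTop) (hc : 0 < c)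
    (h₁ : ∀ s t, x s = x t → ∃ n : ℤ, b t = b s + n * c)
    (h₂ : ∀ t, b t = b 0 + c → Function.Periodic x t)
    (hT : IsLeast {S : ℝ | 0 < S ∧ Function.Periodic x S} T) (t : ℝ) :
    b (t + T) = b t + c := by
  have hconst := continuous_eq_const_of_mem_zmultiples hc
    (d := fun t => b (t + T) - b t) (by fun_prop) (fun t => by
      obtain ⟨n, hn⟩ := h₁ t (t + T) (hT.1.2 t).symm
      exact ⟨n, by linarith⟩) t 0
  simp only [zero_add] at hconst
  obtain ⟨S, hS0, hS⟩ : ∃ S, 0 < S ∧ b S = b 0 + c := by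
    obtain ⟨N, hN⟩ := (htop.eventually_ge_atTop (b 0 + c)).exists
    have h0N : 0 ≤ N := by
      by_contra! h
      have := hmono h
      linarith
    obtain ⟨S, hS, hSe⟩ := intermediate_value_Icc h0N hb.continuousOn
      (show b 0 + c ∈ Icc (b 0) (b N) from ⟨by linarith, hN⟩)
    refine ⟨S, ?_, hSe⟩
    by_contra! h
    have := hmono.monotone h
    linarith
  have hTS : T ≤ S := hT.2 ⟨hS0, h₂ S hS⟩
  obtain ⟨n, hn⟩ := h₁ 0 T (by simpa using (hT.1.2 0).symm)
  have hlo := hmono hT.1.1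
  have hhi := hmono.monotone hTS
  have hn0 : 0 < (n : ℝ) * c := by linarith
  have hn1 : (n : ℝ) * c ≤ 1 * c := by linarith
  have hn1' : n ≤ 1 := by exact_mod_cast le_of_mul_le_mul_right hn1 hc
  have hn0' : 0 < n := by exact_mod_cast pos_of_mul_pos_left hn0 hc.le
  have : n = 1 := by omega
  subst this
  push_cast at hn
  linarith

/-- The rotation number, read off from a solution that has the phase as its time. -/
theorem IsRotationNumber.exists_lift {ϖ α h ρ : ℝ} {O : Set Phase} {y : ℝ → State}
    (H : Admissible ϖ α h) (hρ : IsRotationNumber ϖ α h O ρ) (hy : IsSol ϖ α h y) {φ₀ : ℝ}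
    (hO : phys φ₀ (y φ₀) ∈ O) :
    ∃ (τ : ℝ ≃o ℝ) (v : ℝ → Phase) (T : ℝ) (R θ c : ℝ → ℝ), τ φ₀ = 0 ∧
      (∀ φ, HasDerivAt τ (phaseSpeed α φ (y φ))⁻¹ φ) ∧
      IsTrajectory ϖ α h (fun t => phys (τ.symm t) (y (τ.symm t))) ∧
      IsLeast {S : ℝ | 0 < S ∧
        Function.Periodic (fun t => phys (τ.symm t) (y (τ.symm t))) S} T ∧
      (∀ φ, HasDerivAt v ((phaseSpeed α φ (y φ))⁻¹ •
        fderiv ℝ (hamiltonianField ϖ α) (phys φ (y φ)) (v φ)) φ) ∧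
      Continuous θ ∧
      (∀ φ, 0 < R φ ∧ v φ = (R φ * Real.cos (θ φ)) • frameOne ϖ α (phys φ (y φ))
        + (R φ * Real.sin (θ φ)) • frameTwo ϖ α (phys φ (y φ))
        + c φ • hamiltonianField ϖ α (phys φ (y φ))) ∧
      Tendsto (fun φ => θ φ / τ φ) atTop (𝓝 (ρ * (2 * Real.pi) / T)) := by
  obtain ⟨x, v, T, R, θ, c, hx, hxO, hT, hv, hθ, hR, hlim⟩ := hρ
  rw [← hxO] at hO
  obtain ⟨t₁, ht₁⟩ := hO
  obtain ⟨τ, h0, hτ, hτs⟩ := hy.exists_clock H φ₀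
  have htr := hy.isTrajectory H hτs
  have hxy : ∀ t, x (t + t₁) = phys (τ.symm t) (y (τ.symm t)) := fun t => by
    have h1 := IsTrajectory.unique H.α_pos hx htr (a := t₁) (b := 0)
      (by rw [ht₁, show τ.symm 0 = φ₀ from by rw [← h0, τ.symm_apply_apply]]) t
    rw [add_comm t, h1, zero_add]
  have hxφ : ∀ φ, x (τ φ + t₁) = phys φ (y φ) := fun φ => by
    rw [hxy, τ.symm_apply_apply]
  have hτtop : Tendsto τ atTop atTop := τ.tendsto_atTop
  refine ⟨τ, fun φ => v (τ φ + t₁), T, fun φ => R (τ φ + t₁), fun φ => θ (τ φ + t₁),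
    fun φ => c (τ φ + t₁), h0, hτ, htr, ?_, ?_, ?_, ?_, ?_⟩
  · convert hT using 1
    ext S
    simp only [mem_ofPred_eq, and_congr_right_iff, ← hxy]
    intro _
    refine ⟨fun hp t => ?_, fun hp t => ?_⟩
    · have := hp (t - t₁)
      simp only [sub_add_cancel] at this
      rw [← this]
      congr 1
      ring
    · show x (t + S + t₁) = x (t + t₁)
      rw [← hp (t + t₁)]
      congr 1
      ring
  · intro φ
    have := (hv (τ φ + t₁)).scomp φ ((hτ φ).add_const t₁)
    rw [hxφ] at this
    exact this
  · exact hθ.comp (τ.continuous.add continuous_const)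
  · intro φ
    obtain ⟨h1, h2⟩ := hR (τ φ + t₁)
    rw [hxφ] at h2
    exact ⟨h1, h2⟩
  · have hs : Tendsto (fun φ => τ φ + t₁) atTop atTop := tendsto_atTop_add_const_right _ _ hτtop
    have h1 := hlim.comp hs
    have h2 : Tendsto (fun φ => (τ φ + t₁) / τ φ) atTop (𝓝 1) := by
      refine tendsto_div_of_abs_sub_le (f := τ) (C := |t₁|) hτtop ?_ (by simp)
      refine tendsto_const_nhds.congr' ?_
      filter_upwards [hτtop.eventually_gt_atTop 0] with φ hφ
      rw [div_self hφ.ne']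
    have h3 := ((h1.mul h2).mul_const (2 * Real.pi)).div_const T
    rw [mul_one] at h3
    refine h3.congr' ?_
    filter_upwards [hτtop.eventually_gt_atTop 0, hs.eventually_gt_atTop 0] with φ hφ hφ'
    have := hT.1.1.ne'
    have := Real.pi_ne_zero
    simp only [Function.comp]
    field_simp

/-! ### Rotation along the Euler orbit -/

section euler
variable {ϖ α h : ℝ} {y : ℝ → State}

/-- The phase of the solutions on the Euler orbit. -/
noncomputable def eulerPhase (ϖ α φ₀ : ℝ) (y : ℝ → State) (φ : ℝ) : ℝ :=
  ∫ s in φ₀..φ, ϖ * (y s).1 ^ 2 * (phaseSpeed α s (y s))⁻¹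

theorem hasDerivAt_eulerPhase (hα : 0 < α) (hy : IsSol ϖ α h y) (φ₀ φ : ℝ) :
    HasDerivAt (eulerPhase ϖ α φ₀ y) (ϖ * (y φ).1 ^ 2 * (phaseSpeed α φ (y φ))⁻¹) φ := by
  have hc : Continuous fun s => ϖ * (y s).1 ^ 2 * (phaseSpeed α s (y s))⁻¹ :=
    (continuous_const.mul (hy.continuous.fst.pow 2)).mul (hy.continuous_inv_phaseSpeed hα)
  exact hc.integral_hasStrictDerivAt φ₀ φ |>.hasDerivAt

theorem ratioSq_of_radius {α φ : ℝ} {y : State} (hR : y.2.2 = 0) : ratioSq α φ y = 1 := by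
  simp [ratioSq, hR]

/-- For R = 0 the motion is a planar Kepler problem: (ϖu - centre, p) rotates rigidly, with angular
velocity ϖu² in time. Turning it back by the angle `eulerPhase` leaves a constant vector. -/
theorem euler_eq (H : Admissible ϖ α h) (hy : IsSol ϖ α h y) {φ₀ : ℝ}
    (hy0 : y φ₀ = (maxInvRadius ϖ α h, 0, 0)) (φ : ℝ) :
    ϖ * (y φ).1 - centre ϖ α = discRadius ϖ α h * Real.cos (eulerPhase ϖ α φ₀ y φ) ∧
      (y φ).2.1 = discRadius ϖ α h * Real.sin (eulerPhase ϖ α φ₀ y φ) := by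
  have hϖ := H.ϖ_pos
  set a := eulerPhase ϖ α φ₀ y
  have ha : ∀ φ, HasDerivAt a _ φ := hasDerivAt_eulerPhase H.α_pos hy φ₀
  have hR : ∀ φ, (y φ).2.2 = 0 := hy.radius_zero H.α_pos (by rw [hy0])
  have hX : ∀ φ, HasDerivAt (fun φ => ϖ * (y φ).1 - centre ϖ α)
      (-(ϖ * (y φ).1 ^ 2 * (phaseSpeed α φ (y φ))⁻¹) * (y φ).2.1) φ := fun φ => by
    have h1 : HasDerivAt (fun φ => (y φ).1) _ φ := (hy φ).2.2.fst
    refine ((h1.const_mul ϖ).sub_const _).congr_deriv ?_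
    simp only [polarField]
    ring
  have hP : ∀ φ, HasDerivAt (fun φ => (y φ).2.1)
      (ϖ * (y φ).1 ^ 2 * (phaseSpeed α φ (y φ))⁻¹ * (ϖ * (y φ).1 - centre ϖ α)) φ := fun φ => by
    have h1 : HasDerivAt (fun φ => (y φ).2.1) _ φ := (hy φ).2.2.snd.fst
    refine h1.congr_deriv ?_
    simp only [polarField, ratioSq_of_radius (hR φ), Real.sqrt_one, centre]
    field_simp
    ring
  have hc1 : ∀ φ, HasDerivAt (fun φ => (ϖ * (y φ).1 - centre ϖ α) * Real.cos (a φ)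
      + (y φ).2.1 * Real.sin (a φ)) 0 φ := fun φ => by
    refine (((hX φ).mul (ha φ).cos).add ((hP φ).mul (ha φ).sin)).congr_deriv ?_
    ring
  have hc2 : ∀ φ, HasDerivAt (fun φ => (y φ).2.1 * Real.cos (a φ)
      - (ϖ * (y φ).1 - centre ϖ α) * Real.sin (a φ)) 0 φ := fun φ => by
    refine (((hP φ).mul (ha φ).cos).sub ((hX φ).mul (ha φ).sin)).congr_deriv ?_
    ring
  have e1 := is_const_of_deriv_eq_zero (fun φ => (hc1 φ).differentiableAt)
    (fun φ => (hc1 φ).deriv) φ φ₀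
  have e2 := is_const_of_deriv_eq_zero (fun φ => (hc2 φ).differentiableAt)
    (fun φ => (hc2 φ).deriv) φ φ₀
  have ha0 : a φ₀ = 0 := intervalIntegral.integral_same
  have hm : ϖ * maxInvRadius ϖ α h - centre ϖ α = discRadius ϖ α h := by
    unfold maxInvRadius
    field_simp
    ring
  simp only [hy0, ha0, Real.cos_zero, Real.sin_zero, hm] at e1 e2
  have hcs := Real.sin_sq_add_cos_sq (a φ)
  constructor
  · linear_combination Real.cos (a φ) * e1 - Real.sin (a φ) * e2
      - (ϖ * (y φ).1 - centre ϖ α) * hcs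
  · linear_combination Real.sin (a φ) * e1 + Real.cos (a φ) * e2 - (y φ).2.1 * hcs

/-- The Euler orbit runs on the boundary circle and the reference inside it, so the vector between
them has positive inner product with the outward radius. Replacing the difference of 1/r by that of
r, up to sign, multiplies one component by a positive factor, which adds a drift below π. -/
theorem abs_pageArg_sub_eulerPhase_le (H : Admissible ϖ α h) {z : ℝ → State}
    (hz : IsReference ϖ α h z) (hy : IsSol ϖ α h y) {k : ℤ}
    (hy0 : y (k * (Real.pi / 2)) = (maxInvRadius ϖ α h, 0, 0)) {φ : ℝ}
    (hφ : k * (Real.pi / 2) ≤ φ) :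
    |pageArg ϖ α (k * (Real.pi / 2)) z y φ - eulerPhase ϖ α (k * (Real.pi / 2)) y φ|
      ≤ 2 * Real.pi := by
  have hϖ := H.ϖ_pos
  set φ₀ : ℝ := k * (Real.pi / 2)
  set a := eulerPhase ϖ α φ₀ y
  have hzR : ∀ φ, 0 < (z φ).2.2 := hz.radius_pos
  have hR : ∀ φ, (y φ).2.2 = 0 := hy.radius_zero H.α_pos (by rw [hy0])
  have hac : Continuous a :=
    continuous_iff_continuousAt.mpr fun φ => (hasDerivAt_eulerPhase H.α_pos hy φ₀ φ).continuousAt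
  have harg := isArgOn_pageArg H hz.isSol hy (fun φ => (hzR φ).le) (fun φ => (hR φ).ge)
    (φ₀ := φ₀) (by rw [hy0]; exact hz.lt_maxInvRadius H φ₀)
    (by rw [hy0]; exact (hz.momentum_eq_zero k).symm)
  have hne : y ≠ z := fun h => (hzR 0).ne' (h ▸ hR 0)
  obtain ⟨μ, hμ, hμa⟩ := exists_isArgOn_of_dot_pos (f₁ := fun φ => ϖ * ((y φ).1 - (z φ).1))
    (f₂ := fun φ => (y φ).2.1 - (z φ).2.1) (χ := a) (s := Icc φ₀ φ)
    (continuous_const.mul (hy.continuous.fst.sub hz.isSol.continuous.fst)).continuousOn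
    (hy.continuous.snd.fst.sub hz.isSol.continuous.snd.fst).continuousOn hac.continuousOn
    (fun s _ => by
      obtain ⟨e1, e2⟩ := euler_eq H hy hy0 s
      have h1 := H.disc_lt (hz.isSol s).1 (hzR s) (hz.isSol s).2.1
      have hρ := H.discRadius_pos
      have hcs := Real.sin_sq_add_cos_sq (a s)
      set X := ϖ * (z s).1 - centre ϖ α
      set P := (z s).2.1
      have h2 : X * Real.cos (a s) + P * Real.sin (a s) < discRadius ϖ α h := by
        refine lt_of_pow_lt_pow_left₀ 2 hρ.le (lt_of_le_of_lt ?_ h1)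
        have : X ^ 2 + P ^ 2 - (X * Real.cos (a s) + P * Real.sin (a s)) ^ 2
            = (X * Real.sin (a s) - P * Real.cos (a s)) ^ 2 := by
          linear_combination (-(X ^ 2 + P ^ 2)) * hcs
        linarith [sq_nonneg (X * Real.sin (a s) - P * Real.cos (a s))]
      have h3 : ϖ * ((y s).1 - (z s).1) * Real.cos (a s) + ((y s).2.1 - P) * Real.sin (a s)
          = discRadius ϖ α h - (X * Real.cos (a s) + P * Real.sin (a s)) := by
        linear_combination Real.cos (a s) * e1 + Real.sin (a s) * e2 + discRadius ϖ α h * hcs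
      show 0 < ϖ * ((y s).1 - (z s).1) * Real.cos (a s) + ((y s).2.1 - P) * Real.sin (a s)
      linarith)
  have hd := abs_sub_lt_pi_of_dot_pos (harg.mono (subset_univ (Icc φ₀ φ))) hμ (fun s _ => by
    have h1 := (hy s).1
    have h2 := (hz.isSol s).1
    have h3 := hz.isSol.page_ne_zero H hy (fun φ => (hzR φ).le) (fun φ => (hR φ).ge) hne s
    have e : pageOne z y s = ((y s).1 - (z s).1) * ((y s).1⁻¹ * (z s).1⁻¹) := by
      unfold pageOne
      field_simp
    have e' : (y s).2.1 - (z s).2.1 = pageTwo z y s := rfl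
    rw [e']
    have e'' : pageOne z y s * (ϖ * ((y s).1 - (z s).1))
        = ϖ * ((y s).1 * (z s).1) * pageOne z y s ^ 2 := by
      rw [e]
      field_simp
    rw [e'', ← sq]
    rcases eq_or_ne (pageOne z y s) 0 with h0 | h0
    · rw [h0] at h3 ⊢
      have : pageTwo z y s ≠ 0 := by rintro h4; simp [h4] at h3
      positivity
    · positivity) (right_mem_Icc.mpr hφ)
  have ha0 : a φ₀ = 0 := intervalIntegral.integral_same
  have h1 := hμa φ (right_mem_Icc.mpr hφ)
  have h2 := hμa φ₀ (left_mem_Icc.mpr hφ)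
  rw [pageArg_self] at hd
  rw [ha0] at h2
  rw [abs_lt] at hd h1 h2
  rw [abs_le]
  constructor <;> linarith

theorem tendsto_eulerPhase_div (H : Admissible ϖ α h) (hy : IsSol ϖ α h y) {φ₀ T : ℝ}
    (hy0 : y φ₀ = (maxInvRadius ϖ α h, 0, 0)) {τ : ℝ ≃o ℝ} (hτ0 : τ φ₀ = 0)
    (hx : IsTrajectory ϖ α h (fun t => phys (τ.symm t) (y (τ.symm t))))
    (hT : IsLeast {S : ℝ | 0 < S ∧
        Function.Periodic (fun t => phys (τ.symm t) (y (τ.symm t))) S} T) :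
    Tendsto (fun φ => eulerPhase ϖ α φ₀ y φ / τ φ) atTop (𝓝 (2 * Real.pi / T)) := by
  have hϖ := H.ϖ_pos
  set a := eulerPhase ϖ α φ₀ y
  have hR : ∀ φ, (y φ).2.2 = 0 := hy.radius_zero H.α_pos (by rw [hy0])
  have hac : Continuous a :=
    continuous_iff_continuousAt.mpr fun φ => (hasDerivAt_eulerPhase H.α_pos hy φ₀ φ).continuousAt
  have hmono : StrictMono a := strictMono_of_deriv_pos fun φ => by
    rw [(hasDerivAt_eulerPhase H.α_pos hy φ₀ φ).deriv]
    have := phaseSpeed_pos (φ := φ) H.α_pos (hy φ).1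
    have := (hy φ).1
    positivity
  obtain ⟨c, hc, C, hC, hcC⟩ := H.phaseSpeed_bounds
  obtain ⟨M, hM, hbd⟩ := H.exists_bound
  have htop : Tendsto a atTop atTop := by
    have hm : ∀ φ, φ₀ ≤ φ → ϖ * M⁻¹ ^ 2 * c * (φ - φ₀) ≤ a φ := fun φ hφ => by
      have := Convex.mul_sub_le_image_sub_of_le_deriv (convex_univ : Convex ℝ univ)
        (f := a) (C := ϖ * M⁻¹ ^ 2 * c) hac.continuousOn
        (fun φ _ => (hasDerivAt_eulerPhase H.α_pos hy φ₀ φ).differentiableAt.differentiableWithinAt)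
        (fun φ _ => by
          rw [(hasDerivAt_eulerPhase H.α_pos hy φ₀ φ).deriv]
          have h1 := (hbd φ _ (hy φ).1 (hy φ).2.1).1
          have h2 := (hcC φ _ (hy φ).1 (hy φ).2.1).1
          have : 0 < M⁻¹ := inv_pos.mpr (by linarith)
          gcongr) φ₀ (mem_univ _) φ (mem_univ _) hφ
      have ha0 : a φ₀ = 0 := intervalIntegral.integral_same
      linarith
    have hp : 0 < ϖ * M⁻¹ ^ 2 * c := by
      have : 0 < M⁻¹ := inv_pos.mpr (by linarith)
      positivity
    refine tendsto_atTop_mono' _ ((eventually_ge_atTop φ₀).mono hm) ?_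
    exact (tendsto_atTop_add_const_right _ (-φ₀) tendsto_id).const_mul_atTop hp
  have hsymm0 : τ.symm 0 = φ₀ := by rw [← hτ0, τ.symm_apply_apply]
  have key := add_leastPeriod_eq (b := fun t => a (τ.symm t)) (c := 2 * Real.pi)
    (hac.comp τ.symm.continuous) (hmono.comp τ.symm.strictMono)
    (htop.comp τ.symm.tendsto_atTop) Real.two_pi_pos (fun s t hst => by
      obtain ⟨e1, e2⟩ := euler_eq H hy hy0 (τ.symm s)
      obtain ⟨e3, e4⟩ := euler_eq H hy hy0 (τ.symm t)
      simp only [phys, Prod.mk.injEq] at hst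
      have h1 := inv_injective hst.2.2.1
      have hρ := H.discRadius_pos.ne'
      rw [h1, e3] at e1
      rw [hst.1, e4] at e2
      have h2 := Real.Angle.cos_sin_inj (mul_left_cancel₀ hρ e1) (mul_left_cancel₀ hρ e2)
      obtain ⟨n, hn⟩ := Real.Angle.angle_eq_iff_two_pi_dvd_sub.mp h2
      exact ⟨n, by linarith⟩) (fun t ht => by
      have h1 : y (τ.symm t) = y (τ.symm 0) := by
        obtain ⟨e1, e2⟩ := euler_eq H hy hy0 (τ.symm t)
        obtain ⟨e3, e4⟩ := euler_eq H hy hy0 (τ.symm 0)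
        change a (τ.symm t) = a (τ.symm 0) + 2 * Real.pi at ht
        change _ = _ * Real.cos (a _) at e1
        change _ = _ * Real.sin (a _) at e2
        rw [ht, Real.cos_add_two_pi] at e1
        rw [ht, Real.sin_add_two_pi] at e2
        refine Prod.ext (mul_left_cancel₀ hϖ.ne' (by linarith)) (Prod.ext (by linarith) ?_)
        rw [hR, hR]
      have h2 : phys (τ.symm t) (y (τ.symm t)) = phys (τ.symm 0) (y (τ.symm 0)) := by
        rw [h1]
        simp [phys, hR]
      intro s
      have := IsTrajectory.unique H.α_pos hx hx h2 s
      simpa [add_comm] using this) hT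
  have h1 := tendsto_div_of_add_period (f := fun t => a (τ.symm t))
    (hac.comp τ.symm.continuous) hT.1.1 key
  refine (h1.comp τ.tendsto_atTop).congr fun φ => ?_
  simp only [Function.comp, τ.symm_apply_apply]

theorem potentialDzz_phys {α φ : ℝ} (hα : 0 < α) {y : State} (hu : 0 < y.1) :
    potentialDzz α y.1⁻¹ (y.2.2 * Real.cos φ) = stiffness α φ y * (1 -
      3 * (1 + 2 * α) * (y.1 * (y.2.2 * Real.cos φ)) ^ 2 / Real.sqrt (ratioSq α φ y) ^ 2) := by
  have hs := one_le_sqrt_ratioSq (φ := φ) (y := y) hα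
  simp only [potentialDzz, stiffness, sqrt_phys hu]
  field_simp

/-- Along the Euler orbit the vertical part of v decouples and solves Hill's equation. Expressed in
the frame, its argument μ is within π/2 of a + π/2 - θ. On the other hand (cos φ, -sin φ) is the
direction of another solution of Hill's equation; the determinant of the two keeps its sign or
vanishes identically, so μ + φ stays bounded. Hence θ = a + φ + O(1). -/
theorem abs_rotation_sub_eulerPhase_le (H : Admissible ϖ α h) (hy : IsSol ϖ α h y) {φ₀ : ℝ}
    (hy0 : y φ₀ = (maxInvRadius ϖ α h, 0, 0)) {v : ℝ → Phase} {R θ c : ℝ → ℝ}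
    (hv : ∀ φ, HasDerivAt v ((phaseSpeed α φ (y φ))⁻¹ •
        fderiv ℝ (hamiltonianField ϖ α) (phys φ (y φ)) (v φ)) φ)
    (hθ : Continuous θ)
    (hR : ∀ φ, 0 < R φ ∧ v φ = (R φ * Real.cos (θ φ)) • frameOne ϖ α (phys φ (y φ))
        + (R φ * Real.sin (θ φ)) • frameTwo ϖ α (phys φ (y φ))
        + c φ • hamiltonianField ϖ α (phys φ (y φ))) :
    ∃ C, ∀ φ, φ₀ ≤ φ → |θ φ - (eulerPhase ϖ α φ₀ y φ + φ)| ≤ C := by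
  have hϖ := H.ϖ_pos
  have hα := H.α_pos
  set a := eulerPhase ϖ α φ₀ y
  have hr : ∀ φ, (y φ).2.2 = 0 := hy.radius_zero H.α_pos (by rw [hy0])
  have hac : Continuous a :=
    continuous_iff_continuousAt.mpr fun φ => (hasDerivAt_eulerPhase H.α_pos hy φ₀ φ).continuousAt
  have hvc : Continuous v := continuous_iff_continuousAt.mpr fun φ => (hv φ).continuousAt
  obtain ⟨μ, hμ, hμa⟩ := exists_isArgOn_of_dot_pos (f₁ := fun φ => height (v φ))
    (f₂ := fun φ => pz (v φ)) (χ := fun φ => a φ + Real.pi / 2 - θ φ) (s := univ)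
    hvc.snd.snd.snd.continuousOn hvc.snd.fst.continuousOn
    ((hac.add continuous_const).sub hθ).continuousOn
    (fun s _ => by
      obtain ⟨e1, e2⟩ := euler_eq H hy hy0 s
      change _ = _ * Real.cos (a s) at e1
      change _ = _ * Real.sin (a s) at e2
      obtain ⟨hR0, hvs⟩ := hR s
      have hρ := H.discRadius_pos
      have hu := (hy s).1
      have hcs := Real.sin_sq_add_cos_sq (a s)
      have hDr : potentialDr ϖ α (y s).1⁻¹ ((y s).2.2 * Real.cos s)
          = -(ϖ * (y s).1 ^ 2 * (discRadius ϖ α h * Real.cos (a s))) := by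
        rw [potentialDr_phys hα hu, ratioSq_of_radius (hr s), Real.sqrt_one, ← e1, centre]
        field_simp
        ring
      have hc' : Real.cos (a s + Real.pi / 2 - θ s) = Real.sin (θ s - a s) := by
        rw [← Real.cos_pi_div_two_sub]
        congr 1
        ring
      have hs' : Real.sin (a s + Real.pi / 2 - θ s) = Real.cos (θ s - a s) := by
        rw [← Real.sin_pi_div_two_sub]
        congr 1
        ring
      have hh : height (v s) = R s * (-(discRadius ϖ α h * Real.sin (a s)) * Real.cos (θ s)
          + ϖ * (y s).1 ^ 2 * (discRadius ϖ α h * Real.cos (a s)) * Real.sin (θ s)) := by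
        rw [hvs]
        simp only [height, frameOne, frameTwo, hamiltonianField, phys, rad, pr, pz, Prod.smul_mk,
          Prod.mk_add_mk, smul_eq_mul, hDr, e2]
        rw [hr]
        ring
      have hp : pz (v s) = R s * (ϖ * (y s).1 ^ 2 * (discRadius ϖ α h * Real.cos (a s))
          * Real.cos (θ s) + discRadius ϖ α h * Real.sin (a s) * Real.sin (θ s)) := by
        rw [hvs]
        have hDz : potentialDz α (y s).1⁻¹ ((y s).2.2 * Real.cos s) = 0 := by
          rw [hr, zero_mul]
          simp [potentialDz]
        simp only [height, frameOne, frameTwo, hamiltonianField, phys, rad, pr, pz, Prod.smul_mk,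
          Prod.mk_add_mk, smul_eq_mul, hDr, hDz, e2]
        ring
      show 0 < height (v s) * Real.cos (a s + Real.pi / 2 - θ s)
        + pz (v s) * Real.sin (a s + Real.pi / 2 - θ s)
      have hcθ := Real.sin_sq_add_cos_sq (θ s)
      have e : height (v s) * Real.cos (a s + Real.pi / 2 - θ s)
          + pz (v s) * Real.sin (a s + Real.pi / 2 - θ s)
          = R s * discRadius ϖ α h * (Real.sin (a s) ^ 2
            + ϖ * (y s).1 ^ 2 * Real.cos (a s) ^ 2) := by
        rw [hc', hs', hh, hp, Real.sin_sub, Real.cos_sub]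
        linear_combination (R s * discRadius ϖ α h * (Real.sin (a s) ^ 2
            + ϖ * (y s).1 ^ 2 * Real.cos (a s) ^ 2)) * hcθ
      rw [e]
      have : 0 < Real.sin (a s) ^ 2 + ϖ * (y s).1 ^ 2 * Real.cos (a s) ^ 2 := by
        rcases eq_or_ne (Real.sin (a s)) 0 with h0 | h0
        · rw [h0] at hcs ⊢
          have : Real.cos (a s) ≠ 0 := by rintro h1; simp [h1] at hcs
          positivity
        · positivity
      positivity)
  have hw : ∀ φ, HasDerivAt (fun φ => height (v φ) * Real.sin φ + pz (v φ) * Real.cos φ)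
      (-(Real.sin φ * Real.cos φ * (stiffness α φ (y φ) - 1) * (phaseSpeed α φ (y φ))⁻¹)
        * (height (v φ) * Real.sin φ + pz (v φ) * Real.cos φ)) φ := fun φ => by
    have hu := (hy φ).1
    have hg := phaseSpeed_pos (φ := φ) hα hu
    obtain ⟨A, hA⟩ := fderiv_hamiltonianField (ϖ := ϖ) hα (x := phys φ (y φ)) (inv_pos.mpr hu)
    have h0 := hv φ
    have hz : potentialDrz α (rad (phys φ (y φ))) (height (phys φ (y φ))) = 0 := by
      simp [phys, hr, potentialDrz]
    have hzz : potentialDzz α (rad (phys φ (y φ))) (height (phys φ (y φ)))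
        = stiffness α φ (y φ) := by
      simp only [phys, rad, height]
      rw [potentialDzz_phys hα hu, hr]
      simp
    rw [hA, hz, hzz] at h0
    have h1 : HasDerivAt (fun φ => pz (v φ)) _ φ := h0.snd.fst
    have h2 : HasDerivAt (fun φ => height (v φ)) _ φ := h0.snd.snd.snd
    refine ((h2.mul (Real.hasDerivAt_sin φ)).add (h1.mul (Real.hasDerivAt_cos φ))).congr_deriv ?_
    have hcs := Real.sin_sq_add_cos_sq φ
    have hgd : phaseSpeed α φ (y φ)
      = Real.sin φ ^ 2 + stiffness α φ (y φ) * Real.cos φ ^ 2 := rfl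
    simp only [Prod.smul_mk, smul_eq_mul]
    field_simp
    rw [hgd]
    linear_combination (stiffness α φ (y φ) * height (v φ) * Real.cos φ
      - pz (v φ) * Real.sin φ) * hcs
  have hcont : Continuous fun φ =>
      -(Real.sin φ * Real.cos φ * (stiffness α φ (y φ) - 1) * (phaseSpeed α φ (y φ))⁻¹) := by
    have h1 := hy.continuous_inv_phaseSpeed hα
    have h2 := hy.continuous_stiffness hα
    fun_prop
  have hsol := eq_mul_exp_of_hasDerivAt_mul hcont hw φ₀
  have hsin : ∀ φ, ∃ ϱ > 0, height (v φ) * Real.sin φ + pz (v φ) * Real.cos φ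
      = ϱ * Real.sin (μ φ + φ) := fun φ => by
    obtain ⟨ϱ, h0, h1, h2⟩ := hμ.2 φ (mem_univ _)
    refine ⟨ϱ, h0, ?_⟩
    rw [Real.sin_add]
    linear_combination Real.sin φ * h1 + Real.cos φ * h2
  have hμc : Continuous fun φ => μ φ + φ :=
    (continuousOn_univ.mp hμ.1).add continuous_id
  have hbound : ∀ φ, φ₀ ≤ φ → |(μ φ + φ) - (μ φ₀ + φ₀)| ≤ Real.pi := fun φ hφ => by
    by_cases h0 : height (v φ₀) * Real.sin φ₀ + pz (v φ₀) * Real.cos φ₀ = 0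
    · have hz : ∀ φ, ∃ n : ℤ, μ φ + φ = n * Real.pi := fun φ => by
        have h1 := hsol φ
        rw [h0, zero_mul] at h1
        obtain ⟨ϱ, hϱ, h2⟩ := hsin φ
        rw [h1] at h2
        have h3 : Real.sin (μ φ + φ) = 0 := by
          rcases mul_eq_zero.mp h2.symm with h | h
          · exact absurd h hϱ.ne'
          · exact h
        obtain ⟨n, hn⟩ := Real.sin_eq_zero_iff.mp h3
        exact ⟨n, hn.symm⟩
      have := continuous_eq_const_of_mem_zmultiples Real.pi_pos hμc hz φ φ₀
      rw [this, sub_self, abs_zero]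
      exact Real.pi_pos.le
    · refine (abs_sub_lt_pi_of_sin_ne_zero (d := fun φ => μ φ + φ) (c := 0) (a := φ₀) (b := φ)
        hμc.continuousOn (fun s _ hs => ?_) (right_mem_Icc.mpr hφ)).le
      rw [add_zero] at hs
      obtain ⟨ϱ, hϱ, h2⟩ := hsin s
      rw [hs, mul_zero, hsol s] at h2
      exact h0 ((mul_eq_zero.mp h2).resolve_right (Real.exp_pos _).ne')
  refine ⟨|μ φ₀ + φ₀| + 3 * Real.pi, fun φ hφ => ?_⟩
  have h1 := hbound φ hφ
  have h2 := hμa φ (mem_univ _)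
  have hpi := Real.pi_pos
  rw [abs_le] at h1
  rw [abs_lt] at h2
  have h3 := neg_abs_le (μ φ₀ + φ₀)
  have h4 := le_abs_self (μ φ₀ + φ₀)
  rw [abs_le]
  constructor <;> linarith

theorem phys_mem_eulerOrbit (H : Admissible ϖ α h) (hy : IsSol ϖ α h y) {φ : ℝ}
    (hR : (y φ).2.2 = 0) : phys φ (y φ) ∈ eulerOrbit ϖ α h :=
  ⟨phys_mem_energySurface H.α_pos (hy φ).1 (hy φ).2.1, by simp [phys, hR], by simp [phys, hR]⟩

/-- Per unit of time θ grows at the rate 2πρ/T and a at the rate 2π/T, so θ = a + φ + O(1) leaves (ρ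
- 1)2π/T for φ. This is positive because the phase speed is bounded below. Dividing the rate of a by
that of φ gives 1/(ρ - 1). -/
theorem tendsto_pageArg_euler (H : Admissible ϖ α h) {ρ : ℝ}
    (hρ : IsRotationNumber ϖ α h (eulerOrbit ϖ α h) ρ) {z : ℝ → State}
    (hz : IsReference ϖ α h z) (hy : IsSol ϖ α h y) {k : ℤ}
    (hy0 : y (k * (Real.pi / 2)) = (maxInvRadius ϖ α h, 0, 0)) :
    1 < ρ ∧ Tendsto (fun φ => pageArg ϖ α (k * (Real.pi / 2)) z y φ / φ) atTop
      (𝓝 (1 / (ρ - 1))) := by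
  set φ₀ : ℝ := k * (Real.pi / 2)
  set a := eulerPhase ϖ α φ₀ y
  obtain ⟨τ, v, T, R, θ, c, h0, hτ, hx, hT, hv, hθ, hR, hlim⟩ := hρ.exists_lift H hy (φ₀ := φ₀)
    (phys_mem_eulerOrbit H hy (by rw [hy0]))
  have hT0 := hT.1.1
  have hpi := Real.pi_pos
  have hτtop : Tendsto τ atTop atTop := τ.tendsto_atTop
  have h1 : Tendsto (fun φ => a φ / τ φ) atTop (𝓝 (2 * Real.pi / T)) :=
    tendsto_eulerPhase_div H hy hy0 h0 hx hT
  obtain ⟨C, hC⟩ := abs_rotation_sub_eulerPhase_le H hy hy0 hv hθ hR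
  have h2 : Tendsto (fun φ => (a φ + φ) / τ φ) atTop (𝓝 (ρ * (2 * Real.pi) / T)) := by
    refine tendsto_div_of_abs_sub_le hτtop hlim (C := C) ?_
    filter_upwards [eventually_ge_atTop φ₀] with φ hφ
    rw [abs_sub_comm]
    exact hC φ hφ
  have h3 : Tendsto (fun φ => φ / τ φ) atTop (𝓝 ((ρ - 1) * (2 * Real.pi / T))) := by
    have := h2.sub h1
    refine (this.congr fun φ => ?_).trans (le_of_eq ?_)
    · rw [← sub_div, add_sub_cancel_left]
    · congr 1
      ring
  obtain ⟨c', hc', D, hD, hcD⟩ := H.phaseSpeed_bounds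
  have h4 : D⁻¹ ≤ (ρ - 1) * (2 * Real.pi / T) := by
    have h5 : Tendsto (fun φ => (φ - φ₀) / τ φ) atTop (𝓝 ((ρ - 1) * (2 * Real.pi / T))) :=
      tendsto_div_of_abs_sub_le hτtop h3 (C := |φ₀|) (by simp)
    refine ge_of_tendsto h5 ?_
    filter_upwards [eventually_gt_atTop φ₀] with φ hφ
    have h6 : τ φ - τ φ₀ ≤ D * (φ - φ₀) :=
      Convex.image_sub_le_mul_sub_of_deriv_le (convex_univ : Convex ℝ univ)
        (f := τ) τ.continuous.continuousOn
        (fun φ _ => (hτ φ).differentiableAt.differentiableWithinAt)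
        (fun φ _ => by
          rw [(hτ φ).deriv]
          exact (hcD φ _ (hy φ).1 (hy φ).2.1).2) φ₀ (mem_univ _) φ (mem_univ _) hφ.le
    rw [h0, sub_zero] at h6
    have h7 : 0 < τ φ := by rw [← h0]; exact τ.strictMono hφ
    rw [le_div_iff₀ h7, inv_mul_le_iff₀ hD]
    exact h6
  have hρ1 : 0 < ρ - 1 := by
    have h5 : 0 < (ρ - 1) * (2 * Real.pi / T) := (inv_pos.mpr hD).trans_le h4
    exact pos_of_mul_pos_left h5 (by positivity)
  refine ⟨by linarith, ?_⟩
  have h5 : Tendsto (fun φ => a φ / φ) atTop (𝓝 (1 / (ρ - 1))) := by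
    have := h1.div h3 (by positivity)
    refine (this.congr' ?_).trans (le_of_eq ?_)
    · filter_upwards [hτtop.eventually_gt_atTop 0] with φ hφ
      simp only [Pi.div_apply]
      rw [div_div_div_cancel_right₀ hφ.ne']
    · congr 1
      have := hρ1.ne'
      field_simp
  refine tendsto_div_of_abs_sub_le tendsto_id h5 (C := 2 * Real.pi) ?_
  filter_upwards [eventually_ge_atTop φ₀] with φ hφ
  exact abs_pageArg_sub_eulerPhase_le H hz hy hy0 hφ

end euler
-- Symplectic comparison of nearby solutions
/-- The standard symplectic form. -/
def symp (a b : Phase) : ℝ := pr a * rad b - rad a * pr b + pz a * height b - height a * pz b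

theorem abs_coord_le (a : Phase) :
    |pr a| ≤ ‖a‖ ∧ |pz a| ≤ ‖a‖ ∧ |rad a| ≤ ‖a‖ ∧ |height a| ≤ ‖a‖ := by
  have h1 := norm_snd_le a
  have h2 := norm_snd_le a.2
  have h3 := norm_snd_le a.2.2
  exact ⟨norm_fst_le a, (norm_fst_le a.2).trans h1, (norm_fst_le a.2.2).trans (h2.trans h1),
    h3.trans (h2.trans h1)⟩

theorem abs_symp_le (a b : Phase) : |symp a b| ≤ 4 * (‖a‖ * ‖b‖) := by
  obtain ⟨a1, a2, a3, a4⟩ := abs_coord_le a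
  obtain ⟨b1, b2, b3, b4⟩ := abs_coord_le b
  have h : ∀ {s t : ℝ}, |s| ≤ ‖a‖ → |t| ≤ ‖b‖ → |s * t| ≤ ‖a‖ * ‖b‖ := fun hs ht => by
    rw [abs_mul]
    gcongr
  have e1 := abs_le.mp (h a1 b3)
  have e2 := abs_le.mp (h a3 b1)
  have e3 := abs_le.mp (h a2 b4)
  have e4 := abs_le.mp (h a4 b2)
  rw [symp, abs_le]
  constructor <;> linarith

theorem symp_fderiv {ϖ α : ℝ} (hα : 0 < α) {x : Phase} (hx : 0 < rad x) (a b : Phase) :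
    symp (fderiv ℝ (hamiltonianField ϖ α) x a) b
      + symp a (fderiv ℝ (hamiltonianField ϖ α) x b) = 0 := by
  obtain ⟨A, hA⟩ := fderiv_hamiltonianField (ϖ := ϖ) hα hx
  rw [hA, hA]
  simp only [symp]
  ring

theorem symp_hamiltonianField {ϖ α : ℝ} (hα : 0 < α) {x : Phase} (hx : 0 < rad x) (a : Phase) :
    symp a (hamiltonianField ϖ α x) = fderiv ℝ (hamiltonian ϖ α) x a := by
  rw [fderiv_hamiltonian hα hx]
  simp only [symp, hamiltonianField]
  ring

/-- `δ` solves the linearized flow along `z` on the phases `[φ₀, N]`, up to a multiple of the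
vector field and an error of relative size `η`. -/
def IsVariation (ϖ α : ℝ) (z : ℝ → State) (φ₀ N B η ε : ℝ) (δ : ℝ → Phase) : Prop :=
  ∀ φ ∈ Icc φ₀ N, ∃ (r : ℝ) (e : Phase),
    HasDerivAt δ ((phaseSpeed α φ (z φ))⁻¹ •
      fderiv ℝ (hamiltonianField ϖ α) (phys φ (z φ)) (δ φ)
        + r • hamiltonianField ϖ α (phys φ (z φ)) + e) φ ∧
    |r| ≤ B * ε ∧ ‖e‖ ≤ η * ε ∧ ‖δ φ‖ ≤ B * ε ∧
    |symp (δ φ) (hamiltonianField ϖ α (phys φ (z φ)))| ≤ η * ε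

section variation
variable {ϖ α h φ₀ N B B' η ε ε' : ℝ} {z : ℝ → State} {δ δ' : ℝ → Phase}

theorem IsVariation.mono (hδ : IsVariation ϖ α z φ₀ N B η ε δ) (hε : 0 ≤ ε) (hB : B ≤ B') :
    IsVariation ϖ α z φ₀ N B' η ε δ := fun φ hφ => by
  obtain ⟨r, e, h1, h2, h3, h4, h5⟩ := hδ φ hφ
  have : B * ε ≤ B' * ε := by gcongr
  exact ⟨r, e, h1, h2.trans this, h3, h4.trans this, h5⟩

theorem HasDerivAt.symp {f g : ℝ → Phase} {f' g' : Phase} {t : ℝ} (hf : HasDerivAt f f' t)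
    (hg : HasDerivAt g g' t) :
    HasDerivAt (fun t => symp (f t) (g t)) (symp f' (g t) + symp (f t) g') t := by
  have f1 : HasDerivAt (fun t => pr (f t)) _ t := hf.fst
  have f2 : HasDerivAt (fun t => pz (f t)) _ t := hf.snd.fst
  have f3 : HasDerivAt (fun t => rad (f t)) _ t := hf.snd.snd.fst
  have f4 : HasDerivAt (fun t => height (f t)) _ t := hf.snd.snd.snd
  have g1 : HasDerivAt (fun t => pr (g t)) _ t := hg.fst
  have g2 : HasDerivAt (fun t => pz (g t)) _ t := hg.snd.fst
  have g3 : HasDerivAt (fun t => rad (g t)) _ t := hg.snd.snd.fst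
  have g4 : HasDerivAt (fun t => height (g t)) _ t := hg.snd.snd.snd
  refine ((((f1.mul g3).sub (f3.mul g1)).add (f2.mul g4)).sub (f4.mul g2)).congr_deriv ?_
  simp only [Isosceles.symp, pr, pz, rad, height]
  ring

/-- The linearized field is infinitesimally symplectic and contributes nothing to the derivative.
The multiples of the vector field pair with almost tangent vectors, and the errors are small by
assumption. The four remaining terms add up to 1 + 1 + 4 + 4 = 10 times Bηεε'. -/
theorem IsVariation.abs_symp_sub_le (hα : 0 < α) (hz : ∀ φ, 0 < (z φ).1) (hB : 0 ≤ B)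
    (hη : 0 ≤ η) (hε : 0 ≤ ε) (hε' : 0 ≤ ε')
    (hδ : IsVariation ϖ α z φ₀ N B η ε δ) (hδ' : IsVariation ϖ α z φ₀ N B η ε' δ') {φ : ℝ}
    (hφ : φ ∈ Icc φ₀ N) :
    |symp (δ φ) (δ' φ) - symp (δ φ₀) (δ' φ₀)| ≤ 10 * B * η * (N - φ₀) * (ε * ε') := by
  have hb : ∀ s ∈ Icc φ₀ N, ∃ D, HasDerivAt (fun s => symp (δ s) (δ' s)) D s ∧
      ‖D‖ ≤ 10 * B * η * (ε * ε') := fun s hs => by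
    obtain ⟨r, e, h1, h2, h3, h4, h5⟩ := hδ s hs
    obtain ⟨r', e', h1', h2', h3', h4', h5'⟩ := hδ' s hs
    refine ⟨_, HasDerivAt.symp h1 h1', ?_⟩
    have hs := symp_fderiv (ϖ := ϖ) hα (x := phys s (z s)) (inv_pos.mpr (hz s)) (δ s) (δ' s)
    set g := (phaseSpeed α s (z s))⁻¹
    set X := hamiltonianField ϖ α (phys s (z s))
    set L := fderiv ℝ (hamiltonianField ϖ α) (phys s (z s))
    have e1 : symp (g • L (δ s) + r • X + e) (δ' s) + symp (δ s) (g • L (δ' s) + r' • X + e')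
        = -(r * symp (δ' s) X) + symp e (δ' s) + r' * symp (δ s) X + symp (δ s) e' := by
      simp only [Isosceles.symp, pr, pz, rad, height, Prod.fst_add, Prod.snd_add, Prod.smul_fst,
        Prod.smul_snd, smul_eq_mul] at hs ⊢
      linear_combination g * hs
    rw [e1, Real.norm_eq_abs]
    have b1 : |r * symp (δ' s) X| ≤ (B * ε) * (η * ε') := by rw [abs_mul]; gcongr
    have b2 : |r' * symp (δ s) X| ≤ (B * ε') * (η * ε) := by rw [abs_mul]; gcongr
    have b3 : |symp e (δ' s)| ≤ 4 * ((η * ε) * (B * ε')) := (abs_symp_le _ _).trans (by gcongr)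
    have b4 : |symp (δ s) e'| ≤ 4 * ((B * ε) * (η * ε')) := (abs_symp_le _ _).trans (by gcongr)
    rw [abs_le] at b1 b2 b3 b4 ⊢
    constructor <;> linarith
  have hN : φ₀ ≤ N := hφ.1.trans hφ.2
  choose! D hD hDb using hb
  have := (convex_Icc φ₀ N).norm_image_sub_le_of_norm_hasDerivWithin_le
    (fun s hs => (hD s hs).hasDerivWithinAt) hDb (left_mem_Icc.mpr hN) hφ
  rw [Real.norm_eq_abs, Real.norm_eq_abs, abs_of_nonneg (sub_nonneg.mpr hφ.1)] at this
  refine this.trans ?_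
  have h1 : φ - φ₀ ≤ N - φ₀ := by linarith [hφ.2]
  calc 10 * B * η * (ε * ε') * (φ - φ₀) ≤ 10 * B * η * (ε * ε') * (N - φ₀) := by gcongr
    _ = _ := by ring

theorem dist_phys_le {M : ℝ} (hM : 1 < M) {a b : State} (ha : a ∈ box M) (hb : b ∈ box M)
    (φ : ℝ) : ‖phys φ a - phys φ b‖ ≤ M ^ 2 * ‖a - b‖ := by
  have h1 : |a.1 - b.1| ≤ ‖a - b‖ := norm_fst_le (a - b)
  have h2 : |a.2.1 - b.2.1| ≤ ‖a - b‖ := (norm_fst_le (a - b).2).trans (norm_snd_le (a - b))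
  have h3 : |a.2.2 - b.2.2| ≤ ‖a - b‖ := (norm_snd_le (a - b).2).trans (norm_snd_le (a - b))
  have hM2 : 1 ≤ M ^ 2 := one_le_pow₀ hM.le
  have hle : ‖a - b‖ ≤ M ^ 2 * ‖a - b‖ := le_mul_of_one_le_left (norm_nonneg _) hM2
  obtain ⟨⟨ha1, -⟩, -⟩ := mem_box.mp ha
  obtain ⟨⟨hb1, -⟩, -⟩ := mem_box.mp hb
  have hM0 : 0 < M := by linarith
  have hMi : 0 < M⁻¹ := inv_pos.mpr hM0
  have ha0 : 0 < a.1 := hMi.trans_le ha1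
  have hb0 : 0 < b.1 := hMi.trans_le hb1
  have e : phys φ a - phys φ b = (a.2.1 - b.2.1, -((a.2.2 - b.2.2) * Real.sin φ),
      -((a.1 - b.1) * (a.1⁻¹ * b.1⁻¹)), (a.2.2 - b.2.2) * Real.cos φ) := by
    simp only [phys, Prod.mk_sub_mk, Prod.mk.injEq, true_and]
    refine ⟨by ring, ?_, by ring⟩
    field_simp
    ring
  rw [e]
  have hb' : ∀ {s t : ℝ}, |s| ≤ ‖a - b‖ → |t| ≤ M ^ 2 → |s * t| ≤ M ^ 2 * ‖a - b‖ :=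
    fun hs ht => by
      rw [abs_mul, mul_comm]
      gcongr
  have h4 : |a.1⁻¹ * b.1⁻¹| ≤ M ^ 2 := by
    rw [abs_of_pos (by positivity), sq]
    gcongr
    · exact inv_le_of_inv_le₀ hM0 ha1
    · exact inv_le_of_inv_le₀ hM0 hb1
  refine max_le (h2.trans hle) (max_le ?_ (max_le ?_ ?_))
  · rw [norm_neg]
    exact hb' h3 ((Real.abs_sin_le_one φ).trans hM2)
  · rw [norm_neg]
    exact hb' h1 h4
  · exact hb' h3 ((Real.abs_cos_le_one φ).trans hM2)

/-- Gronwall bounds the difference δ by a multiple of ε. The difference of the phase speeds produces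
the multiple of the vector field, Taylor's formula for the field the error, and Taylor's formula for
H the near tangency, because both solutions have energy h. It matters that B is chosen before η. -/
theorem Admissible.exists_isVariation (H : Admissible ϖ α h) (hz : IsSol ϖ α h z) (φ₀ N : ℝ) :
    ∃ B > 0, ∀ η > 0, ∃ ε₀ > 0, ∀ y, IsSol ϖ α h y → dist (y φ₀) (z φ₀) ≤ ε₀ →
      IsVariation ϖ α z φ₀ N B η (dist (y φ₀) (z φ₀)) fun φ => phys φ (y φ) - phys φ (z φ) := by
  have hα := H.α_pos
  obtain ⟨M, hM, hbox⟩ := H.exists_box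
  have hM0 : 0 < M := by linarith
  obtain ⟨K, L, hKL⟩ := exists_lipschitz_polarField ϖ hα hM
  obtain ⟨K', hK'⟩ := H.exists_gronwall
  set G := Real.exp (K' * (N - φ₀)) with hG
  have hG0 : 0 < G := Real.exp_pos _
  set U : Set Phase := {x | 0 < rad x}
  set C : Set Phase := Icc (-M, -M, M⁻¹, -M) (M, M, M, M)
  have hU : IsOpen U := isOpen_lt continuous_const continuous_snd.snd.fst
  have hCc : IsCompact C := isCompact_Icc
  have hCx : Convex ℝ C := convex_Icc _ _
  have hCU : C ⊆ U := fun x hx => (inv_pos.mpr hM0).trans_le hx.1.2.2.1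
  have hX : ContDiffOn ℝ 1 (hamiltonianField ϖ α) U :=
    fun x hx => (contDiffAt_hamiltonianField hα hx).contDiffWithinAt
  have hH : ContDiffOn ℝ 1 (hamiltonian ϖ α) U :=
    fun x hx => (contDiffAt_hamiltonian hα hx).contDiffWithinAt
  obtain ⟨Lx, hLx⟩ := (hX.mono hCU).exists_lipschitzOnWith one_ne_zero hCx hCc
  have hmem : ∀ y, IsSol ϖ α h y → ∀ φ, y φ ∈ box M := fun y hy φ =>
    interior_subset (hbox φ _ (hy φ).1 (hy φ).2.1)
  have hphys : ∀ a ∈ box M, ∀ φ, phys φ a ∈ C := fun a ha φ => by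
    obtain ⟨⟨h1, h2⟩, ⟨h3, h4⟩, h5⟩ := mem_box.mp ha
    have hR : |a.2.2| ≤ M := abs_le.mpr h5
    have hs : |a.2.2 * Real.sin φ| ≤ M := by
      rw [abs_mul]
      exact (mul_le_of_le_one_right (abs_nonneg _) (Real.abs_sin_le_one φ)).trans hR
    have hc : |a.2.2 * Real.cos φ| ≤ M := by
      rw [abs_mul]
      exact (mul_le_of_le_one_right (abs_nonneg _) (Real.abs_cos_le_one φ)).trans hR
    rw [abs_le] at hs hc
    have ha0 : 0 < a.1 := (inv_pos.mpr hM0).trans_le h1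
    exact ⟨⟨h3, by simp only [phys]; linarith, by simp only [phys]; gcongr, hc.1⟩,
      ⟨h4, by simp only [phys]; linarith, inv_le_of_inv_le₀ hM0 h1, hc.2⟩⟩
  refine ⟨M ^ 2 * G + K * G, by positivity, fun η hη => ?_⟩
  set η₁ := η / (2 * (L + 1) * (M ^ 2 * G)) with hη₁
  have hη₁0 : 0 < η₁ := by positivity
  obtain ⟨ρ₁, hρ₁, hT₁⟩ := exists_uniform_taylor hU hX hCc hCx hCU hη₁0
  obtain ⟨ρ₂, hρ₂, hT₂⟩ := exists_uniform_taylor hU hH hCc hCx hCU hη₁0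
  -- The first threshold keeps δ within the two Taylor moduli. The second makes the product of the
  -- differences of phase speed and field, which is of order ε², at most ηε/2.
  refine ⟨min (min ρ₁ ρ₂ / (M ^ 2 * G)) (η / (2 * (K * G * (Lx * (M ^ 2 * G)) + 1))),
    by positivity, fun y hy hε φ hφ => ?_⟩
  set ε := dist (y φ₀) (z φ₀)
  have hε0 : 0 ≤ ε := dist_nonneg
  have hyz : ‖y φ - z φ‖ ≤ G * ε := by
    rw [← dist_eq_norm, mul_comm]
    refine (hK' y z hy hz φ₀ φ hφ.1).trans ?_
    have h1 : Real.exp (K' * (φ - φ₀)) ≤ G := by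
      rw [hG]
      gcongr
      exact hφ.2
    gcongr
  have hyb := hmem y hy φ
  have hzb := hmem z hz φ
  set δ := phys φ (y φ) - phys φ (z φ) with hδ
  have hδn : ‖δ‖ ≤ M ^ 2 * G * ε := by
    refine (dist_phys_le hM hyb hzb φ).trans ?_
    rw [mul_assoc]
    gcongr
  have hsmall : ‖δ‖ ≤ min ρ₁ ρ₂ := by
    refine hδn.trans ?_
    have := hε.trans (min_le_left _ _)
    rw [le_div_iff₀ (by positivity)] at this
    linarith
  have t1 := hT₁ _ (hphys _ hzb φ) _ (hphys _ hyb φ) (hsmall.trans (min_le_left _ _))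
  have t2 := hT₂ _ (hphys _ hzb φ) _ (hphys _ hyb φ) (hsmall.trans (min_le_right _ _))
  rw [← hδ] at t1 t2
  set X := hamiltonianField ϖ α (phys φ (z φ))
  set Y := hamiltonianField ϖ α (phys φ (y φ))
  set A := fderiv ℝ (hamiltonianField ϖ α) (phys φ (z φ))
  set g := (phaseSpeed α φ (z φ))⁻¹
  set g' := (phaseSpeed α φ (y φ))⁻¹
  have hr : |g' - g| ≤ K * G * ε := by
    have := (hKL φ).1.dist_le_mul _ hyb _ hzb
    rw [Prod.dist_eq, dist_eq_norm (y φ)] at this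
    have h2 : |g' - g| ≤ K * ‖y φ - z φ‖ := (le_max_right _ _).trans this
    refine h2.trans ?_
    rw [mul_assoc]
    gcongr
  have hg : |g| ≤ L := (norm_snd_le (polarField ϖ α φ (z φ), g)).trans ((hKL φ).2 _ hzb)
  have hYX : ‖Y - X‖ ≤ Lx * ‖δ‖ := by
    have := hLx.dist_le_mul _ (hphys _ hyb φ) _ (hphys _ hzb φ)
    rwa [dist_eq_norm, dist_eq_norm] at this
  have hηδ : η₁ * ‖δ‖ ≤ η / (2 * (L + 1)) * ε := by
    calc η₁ * ‖δ‖ ≤ η₁ * (M ^ 2 * G * ε) := by gcongr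
      _ = _ := by rw [hη₁]; field_simp
  refine ⟨g' - g, g • (Y - X - A δ) + (g' - g) • (Y - X), ?_, ?_, ?_, ?_, ?_⟩
  · refine ((hasDerivAt_phys hα (hy φ).1 (hy φ).2.2).sub
      (hasDerivAt_phys hα (hz φ).1 (hz φ).2.2)).congr_deriv ?_
    show g' • Y - g • X = g • A δ + (g' - g) • X + (g • (Y - X - A δ) + (g' - g) • (Y - X))
    module
  · refine hr.trans ?_
    gcongr
    exact le_add_of_nonneg_left (by positivity)
  · have b1 : ‖g • (Y - X - A δ)‖ ≤ η / 2 * ε := by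
      rw [norm_smul, Real.norm_eq_abs]
      calc |g| * ‖Y - X - A δ‖ ≤ (L + 1) * (η / (2 * (L + 1)) * ε) := by
            gcongr
            · linarith
            · exact t1.trans hηδ
        _ = _ := by field_simp
    have b2 : ‖(g' - g) • (Y - X)‖ ≤ η / 2 * ε := by
      rw [norm_smul, Real.norm_eq_abs]
      have h3 := hε.trans (min_le_right _ _)
      rw [le_div_iff₀ (by positivity)] at h3
      have h4 : |g' - g| * ‖Y - X‖ ≤ (K * G * ε) * (Lx * (M ^ 2 * G * ε)) := by
        gcongr
        exact hYX.trans (by gcongr)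
      have h5 : (K * G * (Lx * (M ^ 2 * G))) * ε ≤ η / 2 := by nlinarith
      calc _ ≤ _ := h4
        _ = ((K * G * (Lx * (M ^ 2 * G))) * ε) * ε := by ring
        _ ≤ _ := by gcongr
    exact (norm_add_le _ _).trans (by linarith)
  · refine hδn.trans ?_
    gcongr
    exact le_add_of_nonneg_right (by positivity)
  · rw [symp_hamiltonianField hα (inv_pos.mpr (hz φ).1)]
    rw [hamiltonian_phys hα (hy φ).1, hamiltonian_phys hα (hz φ).1, (hy φ).2.1, (hz φ).2.1,
      sub_self, zero_sub, norm_neg, Real.norm_eq_abs] at t2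
    refine t2.trans (hηδ.trans ?_)
    have : η / (2 * (L + 1)) ≤ η := div_le_self hη.le (by
      have := L.coe_nonneg
      linarith)
    gcongr

end variation
-- The determinant has a constant sign, so f stays on one side of the line through g, in a half
-- plane centred at ν - π/2 or ν + π/2.
theorem exists_isArgOn_of_det_ne_zero {f₁ f₂ g₁ g₂ ν : ℝ → ℝ} {a b : ℝ}
    (hf₁ : ContinuousOn f₁ (Icc a b)) (hf₂ : ContinuousOn f₂ (Icc a b))
    (hg₁ : ContinuousOn g₁ (Icc a b)) (hg₂ : ContinuousOn g₂ (Icc a b))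
    (hg : IsArgOn g₁ g₂ ν (Icc a b)) (h : ∀ x ∈ Icc a b, f₁ x * g₂ x - f₂ x * g₁ x ≠ 0) :
    ∃ (μ : ℝ → ℝ) (s : ℝ), IsArgOn f₁ f₂ μ (Icc a b) ∧
      ∀ x ∈ Icc a b, |μ x - (ν x + s)| < Real.pi / 2 := by
  have hc : ContinuousOn (fun x => f₁ x * g₂ x - f₂ x * g₁ x) (Icc a b) :=
    (hf₁.mul hg₂).sub (hf₂.mul hg₁)
  have hsign : (∀ x ∈ Icc a b, 0 < f₁ x * g₂ x - f₂ x * g₁ x) ∨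
      ∀ x ∈ Icc a b, f₁ x * g₂ x - f₂ x * g₁ x < 0 := by
    by_contra! hcon
    obtain ⟨⟨x, hx, hx0⟩, y, hy, hy0⟩ := hcon
    obtain ⟨w, hw, hw0⟩ := isPreconnected_Icc.intermediate_value hx hy hc ⟨hx0, hy0⟩
    exact h w hw hw0
  rcases hsign with hs | hs
  · obtain ⟨μ, h1, h2⟩ := exists_isArgOn_of_dot_pos (χ := fun x => ν x + -(Real.pi / 2)) hf₁ hf₂
      (hg.1.add continuousOn_const) (fun x hx => by
        obtain ⟨ϱ, hϱ, e1, e2⟩ := hg.2 x hx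
        have h3 := hs x hx
        rw [e1, e2] at h3
        rw [← sub_eq_add_neg, Real.cos_sub_pi_div_two, Real.sin_sub_pi_div_two]
        refine pos_of_mul_pos_right (a := ϱ) ?_ hϱ.le
        linarith)
    exact ⟨μ, _, h1, h2⟩
  · obtain ⟨μ, h1, h2⟩ := exists_isArgOn_of_dot_pos (χ := fun x => ν x + Real.pi / 2) hf₁ hf₂
      (hg.1.add continuousOn_const) (fun x hx => by
        obtain ⟨ϱ, hϱ, e1, e2⟩ := hg.2 x hx
        have h3 := hs x hx
        rw [e1, e2] at h3
        rw [Real.cos_add_pi_div_two, Real.sin_add_pi_div_two]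
        refine pos_of_mul_pos_right (a := ϱ) ?_ hϱ.le
        linarith)
    exact ⟨μ, _, h1, h2⟩

/-! ### Rotation near the reference orbit -/

section reference
variable {ϖ α h : ℝ} {z : ℝ → State}

/-- On a common page the vertical parts of both differences are multiples of (-sin φ, cos φ), so the
symplectic form reduces to the determinant in (r, p_r). -/
theorem symp_phys_sub (z y y' : ℝ → State) (φ : ℝ) :
    symp (phys φ (y φ) - phys φ (z φ)) (phys φ (y' φ) - phys φ (z φ)) =
      pageOne z y φ * pageTwo z y' φ - pageTwo z y φ * pageOne z y' φ := by
  simp only [symp, phys, pageOne, pageTwo, pr, pz, rad, height, Prod.mk_sub_mk]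
  ring

/-- The coefficient of the projection of `v` to the page along the vector field. -/
noncomputable def pageShift (α : ℝ) (z : ℝ → State) (v : ℝ → Phase) (φ : ℝ) : ℝ :=
  (pz (v φ) * Real.cos φ + height (v φ) * Real.sin φ)
    / ((z φ).2.2 * phaseSpeed α φ (z φ))

/-- The first component of the projection of `v` to the page. -/
noncomputable def pageProjOne (α : ℝ) (z : ℝ → State) (v : ℝ → Phase) (φ : ℝ) : ℝ :=
  -(rad (v φ) + pageShift α z v φ * (z φ).2.1)

/-- The second component of the projection of `v` to the page. -/
noncomputable def pageProjTwo (ϖ α : ℝ) (z : ℝ → State) (v : ℝ → Phase) (φ : ℝ) : ℝ :=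
  pr (v φ) - pageShift α z v φ * potentialDr ϖ α (z φ).1⁻¹ ((z φ).2.2 * Real.cos φ)

/-- Adding `pageShift` times the vector field makes v tangent to the page, where the symplectic form
is the determinant up to the product of the remaining normal components, which vanishes. -/
theorem det_pageProj (hα : 0 < α) {φ : ℝ} (hz : 0 < (z φ).1) (hR : 0 < (z φ).2.2)
    (y : ℝ → State) (v : ℝ → Phase) :
    pageOne z y φ * pageProjTwo ϖ α z v φ - pageTwo z y φ * pageProjOne α z v φ =
      symp (phys φ (y φ) - phys φ (z φ)) (v φ) + pageShift α z v φ *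
        symp (phys φ (y φ) - phys φ (z φ)) (hamiltonianField ϖ α (phys φ (z φ))) := by
  have hg := phaseSpeed_pos (φ := φ) hα hz
  have hgd : phaseSpeed α φ (z φ)
      = Real.sin φ ^ 2 + stiffness α φ (z φ) * Real.cos φ ^ 2 := rfl
  have hs : pageShift α z v φ * ((z φ).2.2 * phaseSpeed α φ (z φ))
      = pz (v φ) * Real.cos φ + height (v φ) * Real.sin φ :=
    div_mul_cancel₀ _ (mul_pos hR hg).ne'
  simp only [symp, hamiltonianField, phys, pageOne, pageTwo, pageProjOne, pageProjTwo, pr, pz, rad,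
    height, Prod.mk_sub_mk, potentialDz_phys hα hz] at hs ⊢
  rw [hgd] at hs
  linear_combination (-((y φ).2.2 - (z φ).2.2)) * hs

/-- Multiplied by R times the phase speed, the inner product becomes ϱ times a sum of two squares,
one of them positive. So the page angle of a linearized solution follows θ - φ + π/2 within a
quarter turn: passing from the global frame to the pages subtracts the phase. -/
theorem pageProj_dot_pos (hα : 0 < α) {φ : ℝ} (hz : 0 < (z φ).1) (hR : 0 < (z φ).2.2)
    {v : ℝ → Phase} {ϱ θ c : ℝ} (hϱ : 0 < ϱ)
    (hv : v φ = (ϱ * Real.cos θ) • frameOne ϖ α (phys φ (z φ))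
        + (ϱ * Real.sin θ) • frameTwo ϖ α (phys φ (z φ))
        + c • hamiltonianField ϖ α (phys φ (z φ))) :
    0 < pageProjOne α z v φ * Real.cos (θ - φ + Real.pi / 2)
      + pageProjTwo ϖ α z v φ * Real.sin (θ - φ + Real.pi / 2) := by
  have hg := phaseSpeed_pos (φ := φ) hα hz
  have hgd : phaseSpeed α φ (z φ)
      = Real.sin φ ^ 2 + stiffness α φ (z φ) * Real.cos φ ^ 2 := rfl
  have hs : pageShift α z v φ * ((z φ).2.2 * phaseSpeed α φ (z φ))
      = pz (v φ) * Real.cos φ + height (v φ) * Real.sin φ :=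
    div_mul_cancel₀ _ (mul_pos hR hg).ne'
  rw [Real.cos_add_pi_div_two, Real.sin_add_pi_div_two]
  set D := potentialDr ϖ α (z φ).1⁻¹ ((z φ).2.2 * Real.cos φ) with hD
  set k := stiffness α φ (z φ)
  set g := phaseSpeed α φ (z φ)
  set R := (z φ).2.2
  set p := (z φ).2.1
  set l := pageShift α z v φ
  have hpr : pr (v φ) = ϱ * (Real.cos θ * (k * (R * Real.cos φ)) + Real.sin θ * (R * Real.sin φ))
      - c * D := by
    rw [hv]
    simp only [frameOne, frameTwo, hamiltonianField, phys, pr, pz, rad, height, Prod.smul_mk,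
      Prod.mk_add_mk, smul_eq_mul, potentialDz_phys hα hz]
    ring
  have hpz : pz (v φ) = ϱ * (-(Real.cos θ * D) + Real.sin θ * p) - c * (k * (R * Real.cos φ)) := by
    rw [hv]
    simp only [frameOne, frameTwo, hamiltonianField, phys, pr, pz, rad, height, Prod.smul_mk,
      Prod.mk_add_mk, smul_eq_mul, potentialDz_phys hα hz]
    ring
  have hr : rad (v φ) = ϱ * (-(Real.cos θ * (R * Real.sin φ))
      + Real.sin θ * (k * (R * Real.cos φ))) + c * p := by
    rw [hv]
    simp only [frameOne, frameTwo, hamiltonianField, phys, pr, pz, rad, height, Prod.smul_mk,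
      Prod.mk_add_mk, smul_eq_mul, potentialDz_phys hα hz]
    ring
  have hh : height (v φ) = ϱ * (-(Real.cos θ * p) - Real.sin θ * D) - c * (R * Real.sin φ) := by
    rw [hv]
    simp only [frameOne, frameTwo, hamiltonianField, phys, pr, pz, rad, height, Prod.smul_mk,
      Prod.mk_add_mk, smul_eq_mul, potentialDz_phys hα hz]
    ring
  have hcs := Real.sin_sq_add_cos_sq φ
  have hcθ := Real.sin_sq_add_cos_sq θ
  set b₁ := Real.sin (θ - φ) with hb₁
  set b₂ := Real.cos (θ - φ) with hb₂
  rw [Real.sin_sub] at hb₁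
  rw [Real.cos_sub] at hb₂
  have e1 : pz (v φ) * Real.cos φ + height (v φ) * Real.sin φ
      = ϱ * (p * b₁ - D * b₂) - c * (R * g) := by
    rw [hpz, hh, hgd, hb₁, hb₂]
    ring
  rw [e1] at hs
  have e2 : R * g * (pageProjOne α z v φ * -b₁ + pageProjTwo ϖ α z v φ * b₂)
      = ϱ * ((R * g) ^ 2 + (p * b₁ - D * b₂) ^ 2) := by
    have h3 : rad (v φ) * b₁ + pr (v φ) * b₂ = ϱ * (R * g) + c * (p * b₁ - D * b₂) := by
      rw [hr, hpr, hgd, hb₁, hb₂]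
      linear_combination (ϱ * R * (Real.sin φ ^ 2 + k * Real.cos φ ^ 2)) * hcθ
    simp only [pageProjOne, pageProjTwo]
    linear_combination (p * b₁ - D * b₂) * hs + (R * g) * h3
  have hRg : 0 < R * g := mul_pos hR hg
  refine pos_of_mul_pos_right (a := R * g) ?_ hRg.le
  have : R * g * (pageProjOne α z v φ * -b₁ + pageProjTwo ϖ α z v φ * b₂) > 0 := by
    rw [e2]
    positivity
  linarith

theorem symp_frame_eq_zero {x v : Phase} {a b c : ℝ}
    (hv : v = a • frameOne ϖ α x + b • frameTwo ϖ α x + c • hamiltonianField ϖ α x) :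
    symp v (hamiltonianField ϖ α x) = 0 := by
  rw [hv]
  simp only [symp, frameOne, frameTwo, hamiltonianField, pr, pz, rad, height, Prod.smul_mk,
    Prod.mk_add_mk, smul_eq_mul]
  ring

/-- Solutions near the reference solution, parametrized by their position on a page. -/
theorem IsReference.exists_nearby (H : Admissible ϖ α h) (hz : IsReference ϖ α h z) {k : ℤ}
    (hk : k = 0 ∨ k = 1) :
    ∃ C > 0, ∃ κ > 0, ∀ q : ℝ × ℝ, ‖q - ((z (k * (Real.pi / 2))).1, (0 : ℝ))‖ < κ →
      (∃ y, IsSol ϖ α h y ∧ (∀ φ, 0 ≤ (y φ).2.2) ∧ (y (k * (Real.pi / 2))).1 = q.1 ∧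
        (y (k * (Real.pi / 2))).2.1 = q.2) ∧
      ∀ y, IsSol ϖ α h y → (∀ φ, 0 ≤ (y φ).2.2) → (y (k * (Real.pi / 2))).1 = q.1 →
        (y (k * (Real.pi / 2))).2.1 = q.2 →
        dist (y (k * (Real.pi / 2))) (z (k * (Real.pi / 2)))
          ≤ C * ‖q - ((z (k * (Real.pi / 2))).1, (0 : ℝ))‖ := by
  have hα := H.α_pos
  obtain ⟨ρ, h1, -, h3⟩ := H.exists_initialRadius hk
  set φ₀ : ℝ := k * (Real.pi / 2)
  set q₀ : ℝ × ℝ := ((z φ₀).1, 0) with hq₀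
  have hp0 : (z φ₀).2.1 = 0 := hz.momentum_eq_zero k
  obtain ⟨hu, hE, -⟩ := hz.isSol φ₀
  have hlt := H.disc_lt hu (hz.radius_pos φ₀) hE
  rw [hp0] at hlt
  have hd := (h3 q₀ hu hlt).isBigO_sub
  obtain ⟨C, hC⟩ := hd.bound
  have hev : ∀ᶠ q : ℝ × ℝ in 𝓝 q₀, 0 < q.1 ∧
      (ϖ * q.1 - centre ϖ α) ^ 2 + q.2 ^ 2 < discRadius ϖ α h ^ 2 := by
    have hf : ∀ᶠ q : ℝ × ℝ in 𝓝 q₀, 0 < q.1 :=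
      continuous_fst.continuousAt.eventually_const_lt hu
    refine hf.and ?_
    have : Continuous fun q : ℝ × ℝ => (ϖ * q.1 - centre ϖ α) ^ 2 + q.2 ^ 2 := by fun_prop
    exact this.continuousAt.eventually_lt_const hlt
  obtain ⟨κ, hκ, hball⟩ := Metric.eventually_nhds_iff.mp (hC.and hev)
  refine ⟨max 1 C, by positivity, κ, hκ, fun q hq => ?_⟩
  obtain ⟨hqC, hq0, hqd⟩ := hball (y := q) (by rwa [dist_eq_norm])
  obtain ⟨hρ0, hρE⟩ := h1 q hq0 hqd.le
  obtain ⟨hρ0', hρE'⟩ := h1 q₀ hu hlt.le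
  have hzρ : z φ₀ = (q₀.1, q₀.2, ρ q₀) :=
    eq_of_polarEnergy_eq (φ := φ₀) (ϖ := ϖ) hα hu rfl hp0 (hz.radius_pos φ₀).le hρ0'
      (hE.trans hρE'.symm)
  refine ⟨?_, fun y hy hyR hy1 hy2 => ?_⟩
  · obtain ⟨y, hy, hy0⟩ := H.exists_sol (φ₀ := φ₀) (y₀ := (q.1, q.2, ρ q)) hq0 hρE
    exact ⟨y, hy, hy.radius_nonneg hα (φ₀ := φ₀) (by rw [hy0]; exact hρ0), by rw [hy0], by rw [hy0]⟩
  · have hyρ : y φ₀ = (q.1, q.2, ρ q) :=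
      eq_of_polarEnergy_eq (φ := φ₀) (ϖ := ϖ) hα (hy φ₀).1 hy1 hy2 (hyR φ₀) hρ0
        ((hy φ₀).2.1.trans hρE.symm)
    rw [hyρ, hzρ, dist_eq_norm]
    have e1 : ‖q - q₀‖ ≤ max 1 C * ‖q - q₀‖ :=
      le_mul_of_one_le_left (norm_nonneg _) (le_max_left _ _)
    refine max_le ((norm_fst_le (q - q₀)).trans e1) (max_le ((norm_snd_le (q - q₀)).trans e1) ?_)
    refine hqC.trans ?_
    gcongr
    exact le_max_right _ _

end reference
section reference
variable {ϖ α h : ℝ} {z : ℝ → State}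

/-- The page determinant is the almost constant symplectic pairing plus a small correction from the
near tangency, so an initial size cε outweighs the total error. -/
theorem IsVariation.det_pageProj_ne_zero (hα : 0 < α) {φ₀ N B η ε Λ c : ℝ} (hz : IsSol ϖ α h z)
    (hzR : ∀ φ, 0 < (z φ).2.2) {y : ℝ → State} {v : ℝ → Phase} (hB : 0 ≤ B) (hη : 0 ≤ η)
    (hε : 0 < ε) (hΛ : ∀ φ ∈ Icc φ₀ N, |pageShift α z v φ| ≤ Λ)
    (hy : IsVariation ϖ α z φ₀ N B η ε fun φ => phys φ (y φ) - phys φ (z φ))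
    (hv : IsVariation ϖ α z φ₀ N B η 1 v) (hc : (10 * B * (N - φ₀) + 2 * Λ) * η < c)
    (hdet : c * ε ≤ |pageOne z y φ₀ * pageProjTwo ϖ α z v φ₀
      - pageTwo z y φ₀ * pageProjOne α z v φ₀|) {φ : ℝ} (hφ : φ ∈ Icc φ₀ N) :
    pageOne z y φ * pageProjTwo ϖ α z v φ - pageTwo z y φ * pageProjOne α z v φ ≠ 0 := by
  intro h0
  have hφ₀ : φ₀ ∈ Icc φ₀ N := left_mem_Icc.mpr (hφ.1.trans hφ.2)
  rw [det_pageProj hα (hz φ).1 (hzR φ)] at h0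
  rw [det_pageProj hα (hz φ₀).1 (hzR φ₀)] at hdet
  have h1 := hy.abs_symp_sub_le hα (fun φ => (hz φ).1) hB hη hε.le zero_le_one hv hφ
  have hb : ∀ φ ∈ Icc φ₀ N, |pageShift α z v φ * symp (phys φ (y φ) - phys φ (z φ))
      (hamiltonianField ϖ α (phys φ (z φ)))| ≤ Λ * (η * ε) := fun φ hφ => by
    obtain ⟨-, -, -, -, -, -, h5⟩ := hy φ hφ
    rw [abs_mul]
    have := (abs_nonneg _).trans (hΛ φ hφ)
    gcongr
    exact hΛ φ hφ
  have h2 := hb φ hφ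
  have h3 := hb φ₀ hφ₀
  have h4 : (10 * B * (N - φ₀) + 2 * Λ) * η * ε < c * ε := by gcongr
  rw [abs_le] at h1 h2 h3
  rw [le_abs] at hdet
  rcases hdet with h5 | h5 <;> linarith

/-- A solution close to the reference turns like a solution v of the linearized flow. They cannot be
compared directly, since v may start along the symmetry line. An auxiliary solution y', starting
transversally to the line and to the projection of v, mediates. The bound 3π must not depend on N;
only the neighbourhood does. -/
theorem IsReference.exists_pageArg_near (H : Admissible ϖ α h) (hz : IsReference ϖ α h z) {k : ℤ}
    (hk : k = 0 ∨ k = 1) {v : ℝ → Phase} {R θ c : ℝ → ℝ}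
    (hv : ∀ φ, HasDerivAt v ((phaseSpeed α φ (z φ))⁻¹ •
        fderiv ℝ (hamiltonianField ϖ α) (phys φ (z φ)) (v φ)) φ)
    (hθ : Continuous θ)
    (hR : ∀ φ, 0 < R φ ∧ v φ = (R φ * Real.cos (θ φ)) • frameOne ϖ α (phys φ (z φ))
        + (R φ * Real.sin (θ φ)) • frameTwo ϖ α (phys φ (z φ))
        + c φ • hamiltonianField ϖ α (phys φ (z φ)))
    {N : ℝ} (hN : k * (Real.pi / 2) ≤ N) :
    ∃ s₁, (z (k * (Real.pi / 2))).1 < s₁ ∧ ∀ y,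
      IsSol ϖ α h y → (∀ φ, 0 ≤ (y φ).2.2) → (y (k * (Real.pi / 2))).2.1 = 0 →
      (z (k * (Real.pi / 2))).1 < (y (k * (Real.pi / 2))).1 → (y (k * (Real.pi / 2))).1 < s₁ →
      |pageArg ϖ α (k * (Real.pi / 2)) z y N
        - (θ N - N - (θ (k * (Real.pi / 2)) - k * (Real.pi / 2)))| ≤ 3 * Real.pi := by
  have hα := H.α_pos
  obtain ⟨C, hC, κ, hκ, hnb⟩ := hz.exists_nearby H hk
  have hp0 : (z (k * (Real.pi / 2))).2.1 = 0 := hz.momentum_eq_zero k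
  set φ₀ : ℝ := k * (Real.pi / 2)
  have hs := hz.isSol
  have hzR := hz.radius_pos
  have hvc : Continuous v := continuous_iff_continuousAt.mpr fun φ => (hv φ).continuousAt
  have hφ₀ : φ₀ ∈ Icc φ₀ N := left_mem_Icc.mpr hN
  have hNN : N ∈ Icc φ₀ N := right_mem_Icc.mpr hN
  obtain ⟨M, hM, hbox⟩ := H.exists_box
  have hM0 : 0 < M := by linarith
  have hmem : ∀ y, IsSol ϖ α h y → ∀ φ, (y φ).1 ≤ M := fun y hy φ =>
    (mem_box.mp (interior_subset (hbox φ _ (hy φ).1 (hy φ).2.1))).1.2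
  -- the projection of `v` to the page
  have hlc : Continuous (pageShift α z v) := by
    have h1 : Continuous fun φ => (z φ).2.2 * phaseSpeed α φ (z φ) :=
      hs.continuous.snd.snd.mul (hs.continuous_phaseSpeed hα)
    have h2 : Continuous fun φ => pz (v φ) * Real.cos φ + height (v φ) * Real.sin φ :=
      (hvc.snd.fst.mul Real.continuous_cos).add (hvc.snd.snd.snd.mul Real.continuous_sin)
    exact h2.div h1 fun φ => (mul_pos (hzR φ) (phaseSpeed_pos hα (hs φ).1)).ne'
  have hDc : Continuous fun φ => potentialDr ϖ α (z φ).1⁻¹ ((z φ).2.2 * Real.cos φ) := by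
    have h1 : Continuous fun φ => hamiltonianField ϖ α (phys φ (z φ)) :=
      continuous_iff_continuousAt.mpr fun φ =>
        (contDiffAt_hamiltonianField hα (inv_pos.mpr (hs φ).1)).continuousAt.comp
          (f := fun φ => phys φ (z φ)) (hasDerivAt_phys hα (hs φ).1 (hs φ).2.2).continuousAt
    exact h1.fst.neg.congr fun φ => neg_neg _
  have hq₁c : Continuous (pageProjOne α z v) :=
    (hvc.snd.snd.fst.add (hlc.mul hs.continuous.snd.fst)).neg
  have hq₂c : Continuous (pageProjTwo ϖ α z v) := hvc.fst.sub (hlc.mul hDc)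
  have hdot : ∀ φ, 0 < pageProjOne α z v φ * Real.cos (θ φ - φ + Real.pi / 2)
      + pageProjTwo ϖ α z v φ * Real.sin (θ φ - φ + Real.pi / 2) := fun φ =>
    pageProj_dot_pos hα (hs φ).1 (hzR φ) (hR φ).1 (hR φ).2
  have hχc : Continuous fun φ => θ φ - φ + Real.pi / 2 :=
    (hθ.sub continuous_id).add continuous_const
  obtain ⟨ν, hν, hνχ⟩ := exists_isArgOn_of_dot_pos hq₁c.continuousOn hq₂c.continuousOn
    hχc.continuousOn (s := Icc φ₀ N) (fun φ _ => hdot φ)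
  -- the constants
  obtain ⟨B₁, hB₁, hvar⟩ := H.exists_isVariation hs φ₀ N
  obtain ⟨B₂, hB₂⟩ := isCompact_Icc.exists_bound_of_continuousOn (s := Icc φ₀ N) hvc.continuousOn
  obtain ⟨Λ, hΛ⟩ := isCompact_Icc.exists_bound_of_continuousOn (s := Icc φ₀ N) hlc.continuousOn
  have hΛ0 : 0 ≤ Λ := (norm_nonneg _).trans (hΛ φ₀ hφ₀)
  set B := max B₁ B₂
  have hB : 0 < B := hB₁.trans_le (le_max_left _ _)
  -- The auxiliary start is displaced by (td, t) in (u, p). The vertical direction d = 0 is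
  -- transverse to v unless the first component of its projection vanishes, and then d = 1 works.
  -- The factor bounded below by 1/M² converts a difference of u into one of r.
  obtain ⟨d, c₀, hd, hc₀, hdc⟩ : ∃ d c₀ : ℝ, (d = 0 ∨ d = 1) ∧ 0 < c₀ ∧ ∀ t, (M ^ 2)⁻¹ ≤ t →
      c₀ ≤ |t * d * pageProjTwo ϖ α z v φ₀ - pageProjOne α z v φ₀| := by
    by_cases h0 : pageProjOne α z v φ₀ = 0
    · have h1 : pageProjTwo ϖ α z v φ₀ ≠ 0 := fun h1 => by
        have := hdot φ₀
        simp [h0, h1] at this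
      refine ⟨1, (M ^ 2)⁻¹ * |pageProjTwo ϖ α z v φ₀|, Or.inr rfl, by positivity, fun t ht => ?_⟩
      have : 0 ≤ t := (by positivity : (0 : ℝ) ≤ (M ^ 2)⁻¹).trans ht
      rw [h0, mul_one, sub_zero, abs_mul, abs_of_nonneg this]
      gcongr
    · exact ⟨0, |pageProjOne α z v φ₀|, Or.inl rfl, by positivity, fun t _ => by simp⟩
  -- The two entries are lower bounds, relative to the distances from the reference, for the initial
  -- determinants of y' with v and of y with y'.
  set c₁ := min (c₀ / C) ((C ^ 2 * M ^ 2)⁻¹)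
  have hc₁ : 0 < c₁ := lt_min (by positivity) (by positivity)
  set W := 10 * B * (N - φ₀) + 2 * Λ + 1
  have hN0 : 0 ≤ N - φ₀ := by linarith
  have hW : 0 < W := by positivity
  set η := c₁ / (2 * W)
  have hη : 0 < η := by positivity
  have hηc : W * η < c₁ := by
    have : W * η = c₁ / 2 := by
      simp only [η]
      field_simp
    linarith
  obtain ⟨ε₀, hε₀, hvarη⟩ := hvar η hη
  have hvv : IsVariation ϖ α z φ₀ N B η 1 v := fun φ hφ => by
    refine ⟨0, 0, ?_, by simpa using hB.le, by simpa using hη.le, ?_, ?_⟩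
    · simpa using hv φ
    · rw [mul_one]
      exact (hB₂ φ hφ).trans (le_max_right _ _)
    · rw [symp_frame_eq_zero (hR φ).2]
      simpa using hη.le
  -- the auxiliary solution
  obtain ⟨t, ht0, htκ, htε⟩ : ∃ t, 0 < t ∧ t < κ ∧ C * t ≤ ε₀ := by
    refine ⟨min (κ / 2) (ε₀ / C), by positivity, (min_le_left _ _).trans_lt (by linarith), ?_⟩
    calc C * min (κ / 2) (ε₀ / C) ≤ C * (ε₀ / C) := by gcongr; exact min_le_right _ _
      _ = ε₀ := by field_simp
  have hdn : |d| ≤ 1 := by rcases hd with rfl | rfl <;> simp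
  have hqn : ‖(((z φ₀).1 + t * d, t) : ℝ × ℝ) - ((z φ₀).1, 0)‖ ≤ t := by
    simp only [Prod.mk_sub_mk, add_sub_cancel_left, sub_zero]
    refine max_le ?_ ?_
    · simp only [Real.norm_eq_abs, abs_mul, abs_of_pos ht0]
      exact mul_le_of_le_one_right ht0.le hdn
    · simp only [Real.norm_eq_abs, abs_of_pos ht0, le_refl]
  obtain ⟨⟨y', hy', hyR', hy1', hy2'⟩, hdist'⟩ := hnb _ (hqn.trans_lt htκ)
  dsimp only at hy1' hy2'
  have hε' : dist (y' φ₀) (z φ₀) ≤ C * t :=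
    (hdist' y' hy' hyR' hy1' hy2').trans (by gcongr)
  set ε' := dist (y' φ₀) (z φ₀) with hε'def
  have hne' : y' φ₀ ≠ z φ₀ := fun h => by
    rw [h, hp0] at hy2'
    exact ht0.ne hy2'
  have hε'0 : 0 < ε' := dist_pos.mpr hne'
  have hvar' := (hvarη y' hy' (hε'.trans htε)).mono hε'0.le (le_max_left B₁ B₂)
  have hinv : ∀ y, IsSol ϖ α h y → pageOne z y φ₀
      = ((y φ₀).1 - (z φ₀).1) * ((y φ₀).1 * (z φ₀).1)⁻¹ ∧
      (M ^ 2)⁻¹ ≤ ((y φ₀).1 * (z φ₀).1)⁻¹ := fun y hy => by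
    have h1 := (hy φ₀).1
    have h2 := (hs φ₀).1
    constructor
    · unfold pageOne
      field_simp
    · have h3 := hmem y hy φ₀
      have h4 := hmem z hs φ₀
      rw [sq]
      gcongr
  have hdet' : ∀ φ ∈ Icc φ₀ N, pageOne z y' φ * pageProjTwo ϖ α z v φ
      - pageTwo z y' φ * pageProjOne α z v φ ≠ 0 := fun φ hφ => by
    refine hvar'.det_pageProj_ne_zero (c := c₁) hα hs hzR hB.le hη.le hε'0 hΛ hvv ?_ ?_ hφ
    · refine lt_of_le_of_lt ?_ hηc
      gcongr
      exact le_add_of_nonneg_right zero_le_one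
    · obtain ⟨h1, h2⟩ := hinv y' hy'
      have h3 := hdc _ h2
      have e : pageOne z y' φ₀ * pageProjTwo ϖ α z v φ₀
          - pageTwo z y' φ₀ * pageProjOne α z v φ₀ = t * (((y' φ₀).1 * (z φ₀).1)⁻¹ * d
            * pageProjTwo ϖ α z v φ₀ - pageProjOne α z v φ₀) := by
        rw [h1, pageTwo, hp0, hy1', hy2']
        ring
      rw [e, abs_mul, abs_of_pos ht0]
      calc c₁ * ε' ≤ c₀ / C * (C * t) := by
            gcongr
            exact min_le_left _ _
        _ = t * c₀ := by field_simp
        _ ≤ _ := by gcongr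
  have hpage₁ : Continuous (pageOne z y') :=
    continuous_iff_continuousAt.mpr fun φ => (hs.hasDerivAt_pageOne hy' φ).continuousAt
  have hpage₂ : Continuous (pageTwo z y') :=
    continuous_iff_continuousAt.mpr fun φ => (hs.hasDerivAt_pageTwo hy' φ).continuousAt
  obtain ⟨μ, s, hμ, hμν⟩ := exists_isArgOn_of_det_ne_zero hpage₁.continuousOn
    hpage₂.continuousOn hq₁c.continuousOn hq₂c.continuousOn hν hdet'
  -- the solutions on the symmetry line
  refine ⟨(z φ₀).1 + t, by linarith, fun y hy hyR hyp hyl hyu => ?_⟩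
  set σ := (y φ₀).1 - (z φ₀).1 with hσ
  have hσ0 : 0 < σ := sub_pos.mpr hyl
  have hqn' : ‖(((y φ₀).1, 0) : ℝ × ℝ) - ((z φ₀).1, 0)‖ = σ := by
    simp only [Prod.mk_sub_mk, sub_zero, Prod.norm_def, norm_zero, ← hσ, Real.norm_eq_abs,
      abs_of_pos hσ0]
    exact max_eq_left hσ0.le
  obtain ⟨-, hdist⟩ := hnb ((y φ₀).1, 0) (by rw [hqn']; linarith)
  have hε := hdist y hy hyR rfl hyp
  rw [hqn'] at hε
  set ε := dist (y φ₀) (z φ₀) with hεdef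
  have hε00 : 0 < ε := dist_pos.mpr fun h => by
    rw [h] at hyl
    exact lt_irrefl _ hyl
  have hεε₀ : ε ≤ ε₀ := hε.trans (le_trans (by gcongr; linarith) htε)
  have hvary := (hvarη y hy hεε₀).mono hε00.le (le_max_left B₁ B₂)
  have hdet : ∀ φ ∈ Icc φ₀ N, pageOne z y φ * pageTwo z y' φ
      - pageTwo z y φ * pageOne z y' φ ≠ 0 := fun φ hφ h0 => by
    have h1 := hvary.abs_symp_sub_le hα (fun φ => (hs φ).1) hB.le hη.le hε00.le hε'0.le hvar' hφ
    rw [symp_phys_sub, symp_phys_sub, h0] at h1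
    obtain ⟨h2, h3⟩ := hinv y hy
    have e : pageOne z y φ₀ * pageTwo z y' φ₀ - pageTwo z y φ₀ * pageOne z y' φ₀
        = σ * ((y φ₀).1 * (z φ₀).1)⁻¹ * t := by
      rw [h2, pageTwo, pageTwo, hp0, hyp, hy2']
      ring
    have h4 : 0 < (y φ₀).1 * (z φ₀).1 := mul_pos (hy φ₀).1 (hs φ₀).1
    rw [e, zero_sub, abs_neg, abs_of_pos (by positivity)] at h1
    have h5 : (C ^ 2 * M ^ 2)⁻¹ * (ε * ε') ≤ σ * ((y φ₀).1 * (z φ₀).1)⁻¹ * t := by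
      calc (C ^ 2 * M ^ 2)⁻¹ * (ε * ε') ≤ (C ^ 2 * M ^ 2)⁻¹ * ((C * σ) * (C * t)) := by gcongr
        _ = σ * (M ^ 2)⁻¹ * t := by field_simp
        _ ≤ _ := by gcongr
    have h6 : 10 * B * η * (N - φ₀) * (ε * ε') < (C ^ 2 * M ^ 2)⁻¹ * (ε * ε') := by
      have h7 : 10 * B * η * (N - φ₀) ≤ W * η := by
        have : 10 * B * η * (N - φ₀) = (10 * B * (N - φ₀)) * η := by ring
        rw [this]
        gcongr
        simp only [W]
        linarith
      have h8 : 10 * B * η * (N - φ₀) < (C ^ 2 * M ^ 2)⁻¹ :=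
        h7.trans_lt (hηc.trans_le (min_le_right _ _))
      gcongr
    linarith
  have harg := (isArgOn_pageArg H hs hy (fun φ => (hzR φ).le) hyR hyl (hyp.trans hp0.symm)).mono
    (subset_univ (Icc φ₀ N))
  -- The passages from y to y', from y' to the projection of v, and from there to θ - φ each cost at
  -- most π.
  have a1 := abs_sub_lt_pi_of_det_ne_zero harg hμ hdet hNN
  rw [pageArg_self] at a1
  have a2 := hμν N hNN
  have a3 := hμν φ₀ hφ₀
  have a4 := hνχ N hNN
  have a5 := hνχ φ₀ hφ₀
  rw [abs_lt] at a1 a2 a3 a4 a5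
  rw [abs_le]
  constructor <;> linarith

/-- Over the least period T the phase gains exactly 2π on the reference orbit, and θ gains 2πρ on
average. -/
theorem IsReference.tendsto_rotation (H : Admissible ϖ α h) (hz : IsReference ϖ α h z)
    {φ₀ T ρ : ℝ} {τ : ℝ ≃o ℝ} {θ : ℝ → ℝ}
    (hx : IsTrajectory ϖ α h (fun t => phys (τ.symm t) (z (τ.symm t))))
    (hT : IsLeast {S : ℝ | 0 < S ∧
        Function.Periodic (fun t => phys (τ.symm t) (z (τ.symm t))) S} T)
    (hlim : Tendsto (fun φ => θ φ / τ φ) atTop (𝓝 (ρ * (2 * Real.pi) / T))) :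
    Tendsto (fun φ => (θ φ - φ - (θ φ₀ - φ₀)) / φ) atTop (𝓝 (ρ - 1)) := by
  have hT0 := hT.1.1
  have hpi := Real.pi_pos
  have hτtop : Tendsto τ atTop atTop := τ.tendsto_atTop
  have hper : ∀ φ, phys (φ + 2 * Real.pi) (z (φ + 2 * Real.pi)) = phys φ (z φ) := fun φ => by
    have := hz.shift_int 2 φ
    push_cast at this
    rw [this]
    simp [phys]
  have key := add_leastPeriod_eq (b := τ.symm) (c := 2 * Real.pi) τ.symm.continuous
    τ.symm.strictMono τ.symm.tendsto_atTop Real.two_pi_pos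
    (fun s t hst => (phys_eq_phys (hz.radius_pos _) (hz.radius_pos _) hst).2)
    (fun t ht => by
      have h2 : phys (τ.symm t) (z (τ.symm t)) = phys (τ.symm 0) (z (τ.symm 0)) := by
        rw [ht, hper]
      intro s
      have := IsTrajectory.unique H.α_pos hx hx h2 s
      simpa [add_comm] using this) hT
  have h1 := (tendsto_div_of_add_period τ.symm.continuous hT0 key).comp hτtop
  have h2 : Tendsto (fun φ => φ / τ φ) atTop (𝓝 (2 * Real.pi / T)) :=
    h1.congr fun φ => by simp only [Function.comp, τ.symm_apply_apply]
  have h3 : Tendsto (fun φ => (θ φ - φ) / φ) atTop (𝓝 (ρ - 1)) := by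
    have := (hlim.sub h2).div h2 (by positivity)
    refine (this.congr' ?_).trans (le_of_eq ?_)
    · filter_upwards [hτtop.eventually_gt_atTop 0] with φ hφ
      simp only [Pi.div_apply]
      rw [← sub_div, div_div_div_cancel_right₀ hφ.ne']
    · congr 1
      field_simp
  exact tendsto_div_of_abs_sub_le tendsto_id h3 (C := |θ φ₀ - φ₀|)
    (Eventually.of_forall fun φ => by rw [sub_sub_cancel_left, abs_neg])

end reference
-- Conclusion
section shots
variable {ϖ α h : ℝ} {z : ℝ → State}

theorem Admissible.exists_boundary_sol (H : Admissible ϖ α h) (φ₀ : ℝ) :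
    ∃ y, IsSol ϖ α h y ∧ y φ₀ = (maxInvRadius ϖ α h, 0, 0) := by
  have hϖ := H.ϖ_pos
  have h1 := H.discRadius_pos
  have h2 := H.centre_pos
  refine H.exists_sol (div_pos (by linarith) hϖ) ?_
  have h3 := two_mul_polarEnergy (ϖ := ϖ) (α := α) (φ := φ₀) (y := (maxInvRadius ϖ α h, 0, 0)) hϖ
  have hm : ϖ * maxInvRadius ϖ α h - centre ϖ α = discRadius ϖ α h := by
    unfold maxInvRadius
    field_simp
    ring
  simp only [ratioSq_of_radius, Real.sqrt_one, hm, H.discRadius_sq] at h3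
  linarith

/-- Equality of the two rates is (ρ₁ - 1)(ρ₂ - 1) = 1, that is ρ₁ + ρ₂ = ρ₁ρ₂, which is resonance.
-/
theorem sub_one_ne_one_div {ρ₁ ρ₂ : ℝ} (h₁ : 1 < ρ₁) (h : ρ₁⁻¹ + ρ₂⁻¹ ≠ 1) :
    ρ₂ - 1 ≠ 1 / (ρ₁ - 1) := by
  intro he
  have h2 : 0 < ρ₁ - 1 := by linarith
  have h3 : 0 < 1 / (ρ₁ - 1) := by positivity
  rw [← he] at h3
  have h4 : 0 < ρ₂ := by linarith
  rw [eq_div_iff h2.ne'] at he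
  apply h
  field_simp
  linarith

/-- Large primes q make the window (lo j, hi j) for m longer than 4, which leaves room for an odd m
coprime to j. The power of 2 is prescribed because it decides the symmetry type. -/
theorem exists_infinite_shots (H : Admissible ϖ α h) {ζ : Set Phase}
    (hz : IsReference ϖ α h z) (hζ : orbitOf z = ζ)
    (hres : IsNonResonant ϖ α h (eulerOrbit ϖ α h) ζ) {k : ℤ} (hk : k = 0 ∨ k = 1) (e : ℕ) :
    ∃ Q : Set ℕ, Q.Infinite ∧ ∀ j ∈ Q, ∃ (q : ℕ) (m : ℤ) (y : ℝ → State), q.Prime ∧ 2 < q ∧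
      j = 2 ^ e * q ∧ Odd m ∧ IsShot ϖ α h k j m y := by
  obtain ⟨ρ₁, ρ₂, hρ₁, hρ₂, hne⟩ := hres
  obtain ⟨yb, hyb, hyb0⟩ := H.exists_boundary_sol (k * (Real.pi / 2))
  obtain ⟨hρ, hb⟩ := tendsto_pageArg_euler H hρ₁ hz hyb hyb0
  obtain ⟨τ, v, T, R, θ, c, -, -, hx, hT, hv, hθ, hR, hlim⟩ :=
    hρ₂.exists_lift H hz.isSol (φ₀ := k * (Real.pi / 2)) (by rw [← hζ]; exact ⟨_, rfl⟩)
  have hΨ := hz.tendsto_rotation H (φ₀ := k * (Real.pi / 2)) hx hT hlim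
  obtain ⟨lo, hi, J, hlt, hJ⟩ := exists_rotation_interval H hz hk
    (sub_one_ne_one_div hρ hne) hΨ (fun N hN => hz.exists_pageArg_near H hk hv hθ hR hN)
    hyb hyb0 hb
  obtain ⟨n, hn⟩ := exists_nat_gt (4 / (hi - lo))
  have hd : 0 < hi - lo := sub_pos.mpr hlt
  rw [div_lt_iff₀ hd] at hn
  refine ⟨(fun q => 2 ^ e * q) '' {q | q.Prime ∧ max (max J n) 2 < q}, ?_, ?_⟩
  · refine Set.Infinite.image (fun a _ b _ hab => Nat.eq_of_mul_eq_mul_left (by positivity) hab) ?_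
    refine (Nat.infinite_setOfPred_prime.sdiff (Set.finite_Iic (max (max J n) 2))).mono ?_
    rintro q ⟨h1, h2⟩
    exact ⟨h1, not_le.mp h2⟩
  · rintro _ ⟨q, ⟨hq, hqn⟩, rfl⟩
    have hle : q ≤ 2 ^ e * q := Nat.le_mul_of_pos_left q (by positivity)
    have hq2 : 2 < q := (le_max_right _ _).trans_lt hqn
    have hqJ : J < q := ((le_max_left _ _).trans (le_max_left _ _)).trans_lt hqn
    have hqn' : n < q := ((le_max_right _ _).trans (le_max_left _ _)).trans_lt hqn
    have hnj : (n : ℝ) ≤ (2 ^ e * q : ℕ) := by exact_mod_cast hqn'.le.trans hle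
    obtain ⟨m, h1, h2, hm, hcop⟩ := exists_odd_isCoprime (lo := lo) (hi := hi) (e := e) hq hq2
      (by nlinarith)
    obtain ⟨y, hy, hyR, hp, hu, harg⟩ := hJ _ (hqJ.le.trans hle) m h1 h2
    exact ⟨q, m, y, hq, hq2, rfl, hm, isShot_of_pageArg_eq H hz hy hyR hp hu harg hcop⟩

end shots
end Isosceles

open Isosceles
theorem theorem2p7 (ϖ α h : ℝ) (hϖ : 0 < ϖ) (hα : 0 < α) (hh : h < 0)
    (hlow : 1 / 2 < ϖ ^ 2 * |h|) (hupp : ϖ ^ 2 * |h| < (1 + 4 * α⁻¹) ^ 2 / 2)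
    (ζz : Set Phase)
    (hsub : ζz ⊆ energySurface ϖ α h \ eulerOrbit ϖ α h)
    (hsymm : IsZSymmetric ζz)
    (hsimple : IsSimpleBrakeOrbit ϖ α h ζz)
    (hres : IsNonResonant ϖ α h (eulerOrbit ϖ α h) ζz) :
    {O : Set Phase | IsBrakeOrbit ϖ α h O ∧ IsZSymmetric O}.Infinite ∧
    {O : Set Phase | IsTypeIBrakeOrbit ϖ α h O ∧ ¬ IsZSymmetric O}.Infinite ∧
    {O : Set Phase | IsTypeIIBrakeOrbit ϖ α h O}.Infinite ∧
    {O : Set Phase | IsPeriodicOrbit ϖ α h O ∧ IsZSymmetric O ∧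
      ¬ IsBrakeOrbit ϖ α h O}.Infinite := by
  have H : Admissible ϖ α h := by
    rw [abs_of_neg hh] at hlow hupp
    exact ⟨hϖ, hα, hlow, hupp⟩
  obtain ⟨z, hz, hζ⟩ := exists_reference H hsub hsymm hsimple
  -- The cases by start and length: from phase 0 with j = q, a brake point is joined to a
  -- perpendicular crossing of z = 0; with j = 2q, the brake points lie at phases 0 and qπ, on
  -- opposite sides; with j = 4q, they lie at 0 and 2qπ, on the same side. From phase π/2 with j =
  -- 2q all symmetric phases are odd multiples of π/2, so there is no brake point.
  refine ⟨?_, ?_, ?_, ?_⟩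
  · obtain ⟨Q, hQ, hs⟩ := exists_infinite_shots H hz hζ hres (k := 0) (Or.inl rfl) 0
    refine infinite_of_isShot H (c := 0) hQ fun j hj => ?_
    obtain ⟨q, m, y, hq, hq2, rfl, hm, hy⟩ := hs j hj
    rw [pow_zero, one_mul] at hy ⊢
    exact ⟨m, y, hy, hy.isBrakeOrbit H hq.pos,
      hy.isZSymmetric H (hq.eq_two_or_odd'.resolve_left hq2.ne')⟩
  · obtain ⟨Q, hQ, hs⟩ := exists_infinite_shots H hz hζ hres (k := 0) (Or.inl rfl) 1
    refine infinite_of_isShot H (c := 0) hQ fun j hj => ?_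
    obtain ⟨q, m, y, hq, hq2, rfl, hm, hy⟩ := hs j hj
    rw [pow_one] at hy ⊢
    exact ⟨m, y, hy, hy.isTypeI H (hq.eq_two_or_odd'.resolve_left hq2.ne'),
      hy.not_isZSymmetric H hm⟩
  · obtain ⟨Q, hQ, hs⟩ := exists_infinite_shots H hz hζ hres (k := 0) (Or.inl rfl) 2
    refine infinite_of_isShot H (c := 0) hQ fun j hj => ?_
    obtain ⟨q, m, y, hq, hq2, rfl, hm, hy⟩ := hs j hj
    rw [show 2 ^ 2 * q = 2 * (2 * q) by ring] at hy ⊢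
    exact ⟨m, y, hy, hy.isTypeII H (mul_pos two_pos hq.pos) (even_two_mul q)⟩
  · obtain ⟨Q, hQ, hs⟩ := exists_infinite_shots H hz hζ hres (k := 1) (Or.inr rfl) 1
    refine infinite_of_isShot H (c := 1) hQ fun j hj => ?_
    obtain ⟨q, m, y, hq, hq2, rfl, hm, hy⟩ := hs j hj
    rw [pow_one] at hy ⊢
    exact ⟨m, y, hy, hy.isPeriodicOrbit H (mul_pos two_pos hq.pos), hy.isZSymmetric_of_one H,
      hy.not_isBrakeOrbit H (even_two_mul q)⟩
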